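/- Notation. For $x\in\mathbb R^4$ let $x^2=(x^0)^2-(x^1)^2-(x^2)^2-(x^3)^2$ and let $x^{\dot\alpha\alpha}=\frac1{\sqrt2}\begin{pmatrix}x^0+x^3&x^1+ix^2\\x^1-ix^2&x^0-x^3\end{pmatrix}$, so $x^2=2\det x^{\dot\alpha\alpha}$. Let $x_k$, $k\in\mathbb Z/n$, be the vertices of a closed null polygon in real Minkowski space, $(x_k-x_{k+1})^{\dot\alpha\alpha}=\lambda_k^\alpha\tilde\lambda_k^{\dot\alpha}$ with $\tilde\lambda_k=r_k\bar\lambda_k$, $r_k\in\mathbb R$. Let $Z_k=(\lambda_k,-ix_k\lambda_k)$ be its momentum twistors, $Z_*=(0,\eta)$ a reference twistor, and $Z\cdot\bar W=\lambda_Z\cdot\bar\mu_W+\mu_Z\cdot\bar\lambda_W$ the Hermitian form of signature $(2,2)$. Write $x_{kl}=x_k-x_l$, $n=\bar\eta\eta$ for the null vector of $\eta$, $x\cdot n=\langle\bar\eta|x|\eta]$, and for a loop point $x_0\in\mathbb R^4$ and $\varepsilon>0$ set $$K_{ij}^{\varepsilon}=\int_{\mathbb R^4}\frac{d^4x_0}{i\pi^2}\;\frac{\langle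 i-1\,i\rangle\langle j-1\,j\rangle\,[\eta|x_{0i}x_{0j}|\eta]^2}{(x_{0i}^2+i\varepsilon)(x_{0j}^2+i\varepsilon)\,\langle i-1|x_{0i}|\eta]\langle i|x_{0i}|\eta]\langle j-1|x_{0j}|\eta]\langle j|x_{0j}|\eta]} .$$ Assumptions. $Z_k\cdot\bar Z_*=1$ for all $k$; $i,j\in\mathbb Z/n$ are neither equal nor cyclically adjacent; $x_{ij}^2<0$; $x_{ij}\cdot n\ne0$; and the spinors $\lambda_{i-1},\lambda_i,\lambda_{j-1},\lambda_j$ are pairwise linearly independent. Claim. Put $a_{kl}=iZ_k\cdot\bar Z_l$ and $$v_*=\frac{a_{ij}a_{i-1,j-1}-a_{i,j-1}a_{i-1,j}}{a_{ij}+a_{i-1,j-1}-a_{i-1,j}-a_{i,j-1}},\qquad \mathrm{Li}_2(z)=-\int_0^1\frac{\log(1-tz)}{t}\,dt$$ (principal logarithm). Then: 1. For every $\varepsilon>0$ the integral $K^\varepsilon_{ij}$ converges absolutely, and $$K_{ij}:=\lim_{\varepsilon\to0^+}K_{ij}^{\varepsilon}=\mathrm{Li}_2\!\left(\frac{a_{ij}}{v_*}\right)+\mathrm{Li}_2\!\left(\frac{a_{i-1,j-1}}{v_*}\right)-\mathrm{Li}_2\!\left(\frac{a_{i-1,j}}{v_*}\right)-\mathrm{Li}_2\!\left(\frac{a_{i,j-1}}{v_*}\right)+\text{c.c.}$$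 2. Wherever $x_{0i}\cdot n$, $x_{0j}\cdot n$ and the four factors $\langle\cdot|x_{0\cdot}|\eta]$ in the denominator are nonzero, the normalized integrand (the factor $d^4x_0/(i\pi^2)$ included) is the $d\log$ form $-\frac1{4\pi^2}\frac{ds_0}{s_0+i\varepsilon f_i}\wedge\frac{dt_0}{t_0+i\varepsilon f_j}\wedge\frac{ds}{s}\wedge\frac{dt}{t}$ on real Minkowski space with orientation $dx^0\wedge dx^1\wedge dx^2\wedge dx^3$, where $s_0=-x_{0i}^2/(2x_{0i}\cdot n)$, $t_0=-x_{0j}^2/(2x_{0j}\cdot n)$, $s=\langle i-1|x_{0i}|\eta]/\langle i|x_{0i}|\eta]$, $t=\langle j-1|x_{0j}|\eta]/\langle j|x_{0j}|\eta]$, $f_i=-1/(2x_{0i}\cdot n)$, $f_j=-1/(2x_{0j}\cdot n)$. 3. $a_{kl}=\langle k|x_{kl}|l]$ for all $k,l$; the denominator of $v_*$ is nonzero; and $v_*=x_{ij}^2/(2x_{ij}\cdot n)\neq0$. 4. The formula is dual conformally invariant up to the choice of reference twistor: for every linear $g$ of twistor space preserving the Hermitian form, replacing every $Z_k$ by $gZ_k$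 and $Z_*$ by $gZ_*$ preserves the normalization $Z_k\cdot\bar Z_*=1$ and the value of the formula. If $(gZ_k)$ and $gZ_*$ are again the twistors and the reference twistor of a polygon and reference spinor satisfying the assumptions, then $K_{ij}$ takes the same value for both. -/

import Mathlib

open scoped Matrix Topology ComplexConjugate
open Filter MeasureTheory

noncomputable section

namespace Kermit

/-- Points of (dual) Minkowski space in Cartesian coordinates `(x⁰, x¹, x², x³)`. -/
abbrev Mink : Type := Fin 4 → ℝ

/-- Two-component spinors. -/
abbrev Spinor : Type := Fin 2 → ℂ

/-- Momentum twistors `Z = (λ_α, μ^α̇)`. -/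
abbrev Twistor : Type := Spinor × Spinor

/-- The Minkowski square, of signature `(+,-,-,-)`. -/
def sq (x : Mink) : ℝ := x 0 ^ 2 - x 1 ^ 2 - x 2 ^ 2 - x 3 ^ 2

/-- The Hermitian matrix `x^{α̇α}` of `x` (row `α̇`, column `α`); it satisfies `x² = 2 det x^{α̇α}`. -/
def herm (x : Mink) : Matrix (Fin 2) (Fin 2) ℂ :=
  ((Real.sqrt 2 : ℝ) : ℂ)⁻¹ •
    !![(x 0 : ℂ) + x 3, (x 1 : ℂ) + Complex.I * x 2;
       (x 1 : ℂ) - Complex.I * x 2, (x 0 : ℂ) - x 3]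

theorem sq_eq_two_mul_det (x : Mink) : (sq x : ℂ) = 2 * (herm x).det := by
  have h : ((Real.sqrt 2 : ℝ) : ℂ) ^ 2 = 2 := by
    rw [← Complex.ofReal_pow, Real.sq_sqrt (by norm_num)]
    norm_num
  have h0 : ((Real.sqrt 2 : ℝ) : ℂ) ≠ 0 := by
    intro h1
    rw [h1] at h
    norm_num at h
  simp only [herm, sq, Matrix.det_smul, Matrix.det_fin_two_of, Fintype.card_fin]
  push_cast
  rw [inv_pow, h]
  linear_combination (-(x 2 : ℂ) ^ 2) * Complex.I_sq

/-- The alternating spinor bracket `⟨u v⟩`. -/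
def angle (u v : Spinor) : ℂ := u 0 * v 1 - u 1 * v 0

/-- Moving a spinor index with the alternating form. -/
def moveIndex (u : Spinor) : Spinor := ![-u 1, u 0]

/-- `⟨u|x|w] = w_α̇ x^{α̇α} u_α`, for spinors with lower indices. -/
def sandwich (u : Spinor) (x : Mink) (w : Spinor) : ℂ := w ⬝ᵥ (herm x *ᵥ u)

/-- `⟨u|x|η]`, for a reference spinor `η^α̇`. -/
def linFactor (η : Spinor) (u : Spinor) (x : Mink) : ℂ := sandwich u x (moveIndex η)

/-- `x · n = ⟨η̄|x|η]`, where `n = η̄ η` is the real null vector of the reference spinor. -/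
def dotN (η : Spinor) (x : Mink) : ℂ := sandwich (star (moveIndex η)) x (moveIndex η)

/-- The spinor `[η|x`, with components `η_α̇ x^{α̇α}`. -/
def etaSpinor (η : Spinor) (x : Mink) : Spinor := moveIndex η ᵥ* herm x

/-- The Hermitian pairing `Z · W̄ = λ_α μ̄_W^α + μ^α̇ λ̄_{W α̇}`, of signature `(2,2)`. -/
def pairing (Z W : Twistor) : ℂ := Z.1 ⬝ᵥ star W.2 + Z.2 ⬝ᵥ star W.1

/-- The reference twistor `Z_* = (0, η)`. -/
def refTwistor (η : Spinor) : Twistor := (0, η)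

/-- A closed polygon in real Minkowski space with `n` null edges
`(x_k - x_{k+1})^{α̇α} = λ_k^α λ̃_k^α̇`, where reality of the edge means `λ̃_k = r_k λ̄_k` with `r_k`
real. The spinors `lam k` are recorded with lower index. -/
structure NullPolygon (n : ℕ) where
  /-- The vertices (region momenta). -/
  x : ZMod n → Mink
  /-- The spinors of the edges. -/
  lam : ZMod n → Spinor
  /-- The real scales of the edges. -/
  r : ZMod n → ℝ
  edge : ∀ k, herm (x k - x (k + 1)) =
    (r k : ℂ) • Matrix.vecMulVec (star (moveIndex (lam k))) (moveIndex (lam k))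

variable {n : ℕ}

/-- The momentum twistors `Z_k = (λ_k, -i x_k λ_k)` of the polygon. -/
def NullPolygon.Z (P : NullPolygon n) (k : ZMod n) : Twistor :=
  (P.lam k, (-Complex.I) • (herm (P.x k) *ᵥ P.lam k))

/-- The invariants `a_{kl} = i Z_k · Z̄_l`. -/
def aInv (Z : ZMod n → Twistor) (k l : ZMod n) : ℂ := Complex.I * pairing (Z k) (Z l)

/-- `v_*` as a function of the twistors. -/
def vStar (Z : ZMod n → Twistor) (i j : ZMod n) : ℂ :=
  (aInv Z i j * aInv Z (i - 1) (j - 1) - aInv Z i (j - 1) * aInv Z (i - 1) j) /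
    (aInv Z i j + aInv Z (i - 1) (j - 1) - aInv Z (i - 1) j - aInv Z i (j - 1))

/-- The dilogarithm `Li₂ z = -∫₀^z log (1 - w) dw / w` along the straight segment `w = t z`, with the
principal logarithm. -/
def dilog (z : ℂ) : ℂ := -∫ t in (0 : ℝ)..1, Complex.log (1 - (t : ℂ) * z) / (t : ℂ)

/-- `Li₂(a_{ij}/v_*) + Li₂(a_{i-1,j-1}/v_*) - Li₂(a_{i-1,j}/v_*) - Li₂(a_{i,j-1}/v_*)`. -/
def dilogSum (Z : ZMod n → Twistor) (i j : ZMod n) : ℂ :=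
  dilog (aInv Z i j / vStar Z i j) + dilog (aInv Z (i - 1) (j - 1) / vStar Z i j)
    - dilog (aInv Z (i - 1) j / vStar Z i j) - dilog (aInv Z i (j - 1) / vStar Z i j)

/-- The dilogarithm formula: `dilogSum` plus its complex conjugate. -/
def kermitValue (Z : ZMod n → Twistor) (i j : ZMod n) : ℂ :=
  dilogSum Z i j + conj (dilogSum Z i j)

/-- The integrand of the MHV diagram `K_{ij}` at loop region momentum `x₀`, with propagators
`1/(x_{0i}² + iε)` and `1/(x_{0j}² + iε)`. -/
def kermitIntegrand (P : NullPolygon n) (η : Spinor) (i j : ZMod n) (ε : ℝ) (x₀ : Mink) : ℂ :=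
  (angle (P.lam (i - 1)) (P.lam i) * angle (P.lam (j - 1)) (P.lam j) *
      angle (etaSpinor η (x₀ - P.x i)) (etaSpinor η (x₀ - P.x j)) ^ 2) /
    (((sq (x₀ - P.x i) : ℂ) + Complex.I * ε) * ((sq (x₀ - P.x j) : ℂ) + Complex.I * ε) *
      linFactor η (P.lam (i - 1)) (x₀ - P.x i) * linFactor η (P.lam i) (x₀ - P.x i) *
      linFactor η (P.lam (j - 1)) (x₀ - P.x j) * linFactor η (P.lam j) (x₀ - P.x j))

/-- The Kermit integral with Feynman parameter `ε`, in the one-loop normalization `d⁴x₀ / (i π²)`. -/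
def kermit (P : NullPolygon n) (η : Spinor) (i j : ZMod n) (ε : ℝ) : ℂ :=
  (1 / (Complex.I * (Real.pi : ℂ) ^ 2)) * ∫ x₀ : Mink, kermitIntegrand P η i j ε x₀

/-- The coordinate `s₀` (for the vertex `y = x_i`) or `t₀` (for `y = x_j`):
`- x_{0y}² / (2 x_{0y} · n)`. -/
def realCoord (η : Spinor) (y x₀ : Mink) : ℂ := -(sq (x₀ - y) : ℂ) / (2 * dotN η (x₀ - y))

/-- The shift `f_i` (for `y = x_i`) or `f_j` (for `y = x_j`): `-1 / (2 x_{0y} · n)`. -/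
def shift (η : Spinor) (y x₀ : Mink) : ℂ := -1 / (2 * dotN η (x₀ - y))

/-- The coordinate `s` (for `y = x_i`, spinors `λ_{i-1}, λ_i`) or `t` (for `y = x_j`, spinors
`λ_{j-1}, λ_j`). -/
def complexCoord (η : Spinor) (u u' : Spinor) (y x₀ : Mink) : ℂ :=
  linFactor η u (x₀ - y) / linFactor η u' (x₀ - y)

/-- The Jacobian determinant `∂(F₀, F₁, F₂, F₃) / ∂(x⁰, x¹, x², x³)` at `x₀`. -/
def jacobian (F : Fin 4 → Mink → ℂ) (x₀ : Mink) : ℂ :=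
  Matrix.det (Matrix.of fun k m : Fin 4 => fderiv ℝ (F k) x₀ (Pi.single m 1))

/-- The density with respect to `d⁴x₀` of
`-(1/4π²) ds₀/(s₀ + iε f_i) ∧ dt₀/(t₀ + iε f_j) ∧ ds/s ∧ dt/t` on real Minkowski space. -/
def dlogDensity (P : NullPolygon n) (η : Spinor) (i j : ZMod n) (ε : ℝ) (x₀ : Mink) : ℂ :=
  -(1 / (4 * (Real.pi : ℂ) ^ 2)) *
    (jacobian ![realCoord η (P.x i), realCoord η (P.x j),
        complexCoord η (P.lam (i - 1)) (P.lam i) (P.x i),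
        complexCoord η (P.lam (j - 1)) (P.lam j) (P.x j)] x₀ /
      ((realCoord η (P.x i) x₀ + Complex.I * ε * shift η (P.x i) x₀) *
        (realCoord η (P.x j) x₀ + Complex.I * ε * shift η (P.x j) x₀) *
        complexCoord η (P.lam (i - 1)) (P.lam i) (P.x i) x₀ *
        complexCoord η (P.lam (j - 1)) (P.lam j) (P.x j) x₀))

/-- The kinematics of a generic diagram `K_{ij}`: normalized twistors, `i` and `j` neither equal nor
cyclically adjacent, `x_{ij}² < 0`, `x_{ij} · n ≠ 0`, and the momenta of the four legs
`i-1, i, j-1, j` pairwise non-collinear. -/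
structure GenericKinematics (P : NullPolygon n) (η : Spinor) (i j : ZMod n) : Prop where
  normalized : ∀ k, pairing (P.Z k) (refTwistor η) = 1
  ne : i ≠ j
  ne_succ : j ≠ i + 1
  succ_ne : i ≠ j + 1
  spacelike : sq (P.x i - P.x j) < 0
  dotN_ne : dotN η (P.x i - P.x j) ≠ 0
  legs_i : angle (P.lam (i - 1)) (P.lam i) ≠ 0
  legs_j : angle (P.lam (j - 1)) (P.lam j) ≠ 0
  legs_ij : ∀ k ∈ ({i - 1, i} : Set (ZMod n)), ∀ l ∈ ({j - 1, j} : Set (ZMod n)),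
    angle (P.lam k) (P.lam l) ≠ 0

/-- Dual conformal transformations: invertible linear maps of twistor space that preserve the
Hermitian pairing, the group `U(2,2)`. -/
def IsDualConformal (g : Twistor ≃ₗ[ℂ] Twistor) : Prop :=
  ∀ U V : Twistor, pairing (g U) (g V) = pairing U V

end Kermit

end

/-! The proof adapts coordinates to the chord X = x_i - x_j. Since X² < 0 and X·n ≠ 0, there is a
spinor ξ, normalized against η, with ⟨ξ|X|η] = 0 (`chordFrame`). The components of x_{0i} in the
basis ξ, η̄ become two real coordinates τ, σ and a complex one q, in which x_{0i}² = X²(στ + |q|²)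
and x_{0j}² = X²((σ-1)(τ-1) + |q|²). Every leg is λ_k = ξ + m b_k η̄ for a complex number b_k, its
position. For legs at i with position β, and legs at j with position γ, the linear factors are
multiples of q - βτ and q + γ(1-τ), and the bracket squared in the numerator is a multiple of q. Two
partial fractions therefore turn the integrand into an alternating sum of four terms, one for each
pair of legs (`kermitIntegrand_eq_legSum`). The same positions give a_kl/v_* = 1 - b_k conj(b_l)
(`aInv_div_vStar`), so each pair of legs accounts for one dilogarithm.

For one pair the convergence is not evident: the propagators vanish on hypersurfaces and the linear
factors on surfaces of codimension two. All bounds are made with powers ‖z‖^(-a), integrated in the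
order σ, q, τ, each time by the composition formula for Riesz potentials on the line
(`exists_lintegral_sing_mul_sing_le`). The exponents are chosen so that every one-dimensional
singularity stays integrable and no two of the dangerous points of the τ-line collide
(`lintegral_loopWeight_lt_top`).

For the value, the σ-integral is a residue: it vanishes unless 0 < τ < 1, and there it leaves |q|² +
τ(1-τ) - iε, which has no zero even at ε = 0. So the limit ε → 0 is dominated convergence
(`tendsto_integral_regulated`). The q-integral is done in polar coordinates: the angular average
turns the two poles into radial cutoffs and the radial integral gives logarithms. What remains is an
integral over τ that depends only on w = β γ̄ (`integral_radialIntegrand`). The inversion u ↦ |w|²/u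
conjugates its integrand, so it is real, and an explicit primitive vanishing at 0 and ∞ identifies
it with -2(Re Li₂(1-w) - Li₂(1)) (`neg_integral_radialIntegrand`). The constants Li₂(1) cancel in
the alternating sum.

The d log statement is a Jacobian computation: the four differentials are combinations of the four
matrix entries of dx in the frame, whose determinant is constant (`det_sandwich`). Dual conformal
invariance holds because the value depends on the twistors only through their pairings. -/

noncomputable section

namespace Kermit

open scoped ENNReal
open Set

/-! ### Singular power weights and Riesz composition on the line -/

/-- The singular weight `‖z‖ ^ (-a)` as an extended nonnegative real, infinite at `z = 0`. -/
def sing {E : Type*} [NormedAddCommGroup E] (a : ℝ) (z : E) : ℝ≥0∞ := ‖z‖ₑ⁻¹ ^ a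

section sing

variable {E F : Type*} [NormedAddCommGroup E] [NormedAddCommGroup F]

theorem sing_mul_self {a b : ℝ} (ha : 0 ≤ a) (hb : 0 ≤ b) (z : E) :
    sing a z * sing b z = sing (a + b) z := by
  rw [sing, sing, sing, ENNReal.rpow_add_of_nonneg _ _ ha hb]

theorem sing_mul {K : Type*} [NormedDivisionRing K] {a : ℝ} (ha : 0 ≤ a) (z w : K) :
    sing a (z * w) = sing a z * sing a w := by
  rw [sing, sing, sing, enorm_mul, ENNReal.mul_inv (Or.inr enorm_ne_top) (Or.inl enorm_ne_top),
    ENNReal.mul_rpow_of_nonneg _ _ ha]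

theorem sing_ne_top {a : ℝ} (ha : 0 ≤ a) {z : E} (hz : z ≠ 0) : sing a z ≠ ∞ := by
  rw [sing]
  exact ENNReal.rpow_ne_top_of_nonneg ha (by simpa using hz)

theorem sing_ne_zero {a : ℝ} (ha : 0 ≤ a) (z : E) : sing a z ≠ 0 := by
  rw [sing]
  intro h
  rcases (ENNReal.rpow_eq_zero_iff.1 h) with h | h
  · simp at h
  · linarith [h.2]

theorem sing_anti {a : ℝ} (ha : 0 ≤ a) {z : E} {w : F} (h : ‖w‖ ≤ ‖z‖) : sing a z ≤ sing a w := by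
  refine ENNReal.rpow_le_rpow (ENNReal.inv_le_inv.2 ?_) ha
  rw [← ofReal_norm, ← ofReal_norm]
  exact ENNReal.ofReal_le_ofReal h

theorem sing_congr {a : ℝ} {z : E} {w : F} (h : ‖z‖ = ‖w‖) : sing a z = sing a w := by
  rw [sing, sing, ← ofReal_norm, ← ofReal_norm, h]

theorem sing_le_mul {a c : ℝ} (ha : 0 ≤ a) (hc : 0 < c) {z : E} {w : F} (h : ‖w‖ ≤ c * ‖z‖) :
    sing a z ≤ ENNReal.ofReal c ^ a * sing a w := by
  have h1 : sing a (c * ‖z‖) ≤ sing a w := by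
    refine sing_anti ha ?_
    rw [Real.norm_of_nonneg (by positivity)]
    exact h
  rw [sing_mul ha] at h1
  calc sing a z = (ENNReal.ofReal c * (ENNReal.ofReal c)⁻¹) ^ a * sing a z := by
        rw [ENNReal.mul_inv_cancel (by simpa using hc) ENNReal.ofReal_ne_top]; simp
    _ = ENNReal.ofReal c ^ a * (sing a c * sing a ‖z‖) := by
        rw [ENNReal.mul_rpow_of_nonneg _ _ ha, mul_assoc]
        congr 2
        · rw [sing, Real.enorm_of_nonneg hc.le]
        · exact sing_congr (by simp)
    _ ≤ _ := by gcongr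

theorem sing_mul_sing_le {a b : ℝ} (ha : 0 ≤ a) (hb : 0 ≤ b) (z : E) (w : F) :
    sing a z * sing b w ≤ sing (a + b) z + sing (a + b) w := by
  rcases le_total ‖z‖ ‖w‖ with h | h
  · refine le_trans ?_ le_self_add
    rw [← sing_mul_self ha hb]
    gcongr
    exact sing_anti hb h
  · refine le_trans ?_ le_add_self
    rw [← sing_mul_self ha hb]
    gcongr
    exact sing_anti ha h

theorem enorm_inv_le_sing {K : Type*} [NormedDivisionRing K] (z : K) : ‖z⁻¹‖ₑ ≤ sing 1 z := by
  rw [sing, ENNReal.rpow_one]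
  rcases eq_or_ne z 0 with h | h
  · simp [h]
  · rw [enorm_inv h]

@[fun_prop]
theorem measurable_sing [MeasurableSpace E] [BorelSpace E] (a : ℝ) :
    Measurable (sing a : E → ℝ≥0∞) := by
  unfold sing
  fun_prop

theorem sing_of_ne_zero {a : ℝ} {z : E} (hz : z ≠ 0) : sing a z = ENNReal.ofReal (‖z‖ ^ (-a)) := by
  have h := norm_pos_iff.2 hz
  rw [sing, ← ofReal_norm, ENNReal.inv_rpow, ← ENNReal.rpow_neg, ENNReal.ofReal_rpow_of_pos h]

end sing

theorem lintegral_Icc_sing_lt_top {a : ℝ} (ha : a < 1) (M : ℝ) :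
    ∫⁻ x in Icc (-M) M, sing a x < ∞ := by
  have h1 : ∀ M : ℝ, IntegrableOn (fun x : ℝ => |x| ^ (-a)) (Ioc 0 M) := by
    intro M
    rcases le_total M 0 with h | h
    · simp [Ioc_eq_empty_of_le h]
    have := (intervalIntegral.intervalIntegrable_rpow' (a := 0) (b := M) (r := -a) (by linarith))
    rw [intervalIntegrable_iff_integrableOn_Ioc_of_le h] at this
    refine this.congr_fun (fun x hx => ?_) measurableSet_Ioc
    simp only [abs_of_pos hx.1]
  have h2 : IntegrableOn (fun x : ℝ => |x| ^ (-a)) (Ico (-M) 0) := by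
    have := ((Measure.measurePreserving_neg (volume : Measure ℝ)).integrableOn_comp_preimage
      (MeasurableEquiv.neg ℝ).measurableEmbedding).2 (h1 M)
    simpa [Function.comp_def] using this
  have h3 : IntegrableOn (fun x : ℝ => |x| ^ (-a)) (Icc (-M) M) := by
    refine ((h1 M).union (h2.union (integrableOn_singleton (x := (0:ℝ)) (by simp) (by simp)))).mono_set ?_
    intro x hx
    rcases lt_trichotomy x 0 with h | h | h
    · exact Or.inr (Or.inl ⟨hx.1, h⟩)
    · exact Or.inr (Or.inr h)
    · exact Or.inl ⟨h, hx.2⟩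
  refine lt_of_le_of_lt (lintegral_mono_ae ?_) h3.hasFiniteIntegral
  refine ae_restrict_of_ae ?_
  filter_upwards [Measure.ae_ne volume (0 : ℝ)] with x hx
  rw [sing_of_ne_zero hx, Real.enorm_of_nonneg (by positivity), Real.norm_eq_abs]


theorem lintegral_far_sing_lt_top {a : ℝ} (ha : 1 < a) :
    ∫⁻ x in {x : ℝ | 2 < |x|}, sing a x < ∞ := by
  have h1 : IntegrableOn (fun x : ℝ => |x| ^ (-a)) (Ioi 2) :=
    (integrableOn_Ioi_rpow_of_lt (a := -a) (by linarith) (by norm_num : (0 : ℝ) < 2)).congr_fun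
      (fun x hx => by
        simp only [abs_of_pos (lt_trans two_pos (mem_Ioi.1 hx))]) measurableSet_Ioi
  have h2 : IntegrableOn (fun x : ℝ => |x| ^ (-a)) (Iio (-2)) := by
    have := ((Measure.measurePreserving_neg (volume : Measure ℝ)).integrableOn_comp_preimage
      (MeasurableEquiv.neg ℝ).measurableEmbedding).2 h1
    simpa [Function.comp_def] using this
  have h3 : IntegrableOn (fun x : ℝ => |x| ^ (-a)) {x : ℝ | 2 < |x|} := by
    refine (h1.union h2).mono_set ?_
    intro x hx
    have hx' : 2 < |x| := by simpa using hx
    rcases lt_abs.1 hx' with h | h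
    · exact Or.inl h
    · exact Or.inr (by simp only [mem_Iio]; linarith)
  refine lt_of_le_of_lt (lintegral_mono_ae ?_) h3.hasFiniteIntegral
  refine ae_restrict_of_ae ?_
  filter_upwards [Measure.ae_ne volume (0 : ℝ)] with x hx
  rw [sing_of_ne_zero hx, Real.enorm_of_nonneg (by positivity), Real.norm_eq_abs]

/-- Near 0 and near 1 only one factor is singular, with exponent below 1. Beyond distance 2 both
factors are comparable to powers of |x|, and a + b > 1 gives the decay. -/
theorem lintegral_sing_mul_sing_one_lt_top {a b : ℝ} (ha : 0 ≤ a) (hb : 0 ≤ b) (ha1 : a < 1)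
    (hb1 : b < 1) (hab : 1 < a + b) : ∫⁻ x : ℝ, sing a (x - 1) * sing b x < ∞ := by
  have key : ∀ x : ℝ, sing a (x - 1) * sing b x ≤
      ENNReal.ofReal 2 ^ b * (Icc (-3) 3).indicator (sing a) (x - 1) +
      ENNReal.ofReal 2 ^ a * (Icc (-3) 3).indicator (sing b) x +
      ENNReal.ofReal 2 ^ a * {x : ℝ | 2 < |x|}.indicator (sing (a + b)) x := by
    intro x
    by_cases hx : 2 < |x|
    · refine le_trans ?_ le_add_self
      rw [indicator_of_mem (by exact hx), ← sing_mul_self ha hb, ← mul_assoc]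
      gcongr
      refine sing_le_mul ha two_pos ?_
      rw [Real.norm_eq_abs, Real.norm_eq_abs]
      have := abs_sub_abs_le_abs_sub x 1
      rw [abs_one] at this
      linarith
    · refine le_trans ?_ le_self_add
      have hx' := abs_le.1 (not_lt.1 hx)
      rw [indicator_of_mem (by constructor <;> linarith), indicator_of_mem
        (by constructor <;> linarith)]
      rcases le_total (1 / 2) |x| with h | h
      · refine le_trans ?_ le_self_add
        rw [mul_comm]
        gcongr
        refine (sing_le_mul (w := (1 : ℝ)) hb two_pos ?_).trans (by simp [sing])
        rw [Real.norm_eq_abs, Real.norm_eq_abs, abs_one]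
        linarith
      · refine le_trans ?_ le_add_self
        gcongr
        refine (sing_le_mul (w := (1 : ℝ)) ha two_pos ?_).trans (by simp [sing])
        have := abs_sub_abs_le_abs_sub 1 x
        rw [Real.norm_eq_abs, Real.norm_eq_abs, abs_one, abs_sub_comm]
        rw [abs_one] at this
        linarith
  refine lt_of_le_of_lt (lintegral_mono key) ?_
  have m1 : Measurable ((Icc (-3 : ℝ) 3).indicator (sing a)) :=
    (measurable_sing a).indicator measurableSet_Icc
  have m2 : Measurable ((Icc (-3 : ℝ) 3).indicator (sing b)) :=
    (measurable_sing b).indicator measurableSet_Icc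
  have ms : MeasurableSet {x : ℝ | 2 < |x|} := measurableSet_lt measurable_const (by fun_prop)
  have m3 : Measurable ({x : ℝ | 2 < |x|}.indicator (sing (a + b))) :=
    (measurable_sing _).indicator ms
  have m1' : Measurable fun x : ℝ => (Icc (-3 : ℝ) 3).indicator (sing a) (x - 1) :=
    m1.comp (measurable_id.sub_const 1)
  rw [lintegral_add_left (by fun_prop), lintegral_add_left (by fun_prop),
    lintegral_const_mul _ m1', lintegral_const_mul _ m2, lintegral_const_mul _ m3,
    lintegral_sub_right_eq_self (fun x => (Icc (-3 : ℝ) 3).indicator (sing a) x) 1,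
    lintegral_indicator measurableSet_Icc, lintegral_indicator measurableSet_Icc,
    lintegral_indicator ms]
  have h2 : ∀ c : ℝ, 0 ≤ c → ENNReal.ofReal 2 ^ c < ∞ := fun c hc =>
    ENNReal.rpow_lt_top_of_nonneg hc ENNReal.ofReal_ne_top
  exact ENNReal.add_lt_top.2 ⟨ENNReal.add_lt_top.2
    ⟨ENNReal.mul_lt_top (h2 _ hb) (lintegral_Icc_sing_lt_top ha1 3),
      ENNReal.mul_lt_top (h2 _ ha) (lintegral_Icc_sing_lt_top hb1 3)⟩,
      ENNReal.mul_lt_top (h2 _ ha) (lintegral_far_sing_lt_top hab)⟩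

theorem lintegral_comp_mul_left_real (f : ℝ → ℝ≥0∞) {c : ℝ} (hc : c ≠ 0) :
    ∫⁻ x, f x = ENNReal.ofReal |c| * ∫⁻ x, f (c * x) := by
  conv_lhs => rw [← Real.smul_map_volume_mul_left hc]
  rw [lintegral_smul_measure, smul_eq_mul]
  congr 1
  exact (Homeomorph.mulLeft₀ c hc).toMeasurableEquiv.measurableEmbedding.lintegral_map f

/-- The one-dimensional composition formula for Riesz potentials, as a bound. -/
theorem exists_lintegral_sing_mul_sing_le {a b : ℝ} (ha : 0 ≤ a) (hb : 0 ≤ b) (ha1 : a < 1)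
    (hb1 : b < 1) (hab : 1 < a + b) : ∃ C : ℝ≥0∞, C ≠ ∞ ∧ ∀ s t : ℝ,
      ∫⁻ x : ℝ, sing a (x - s) * sing b (x - t) ≤ C * sing (a + b - 1) (s - t) := by
  refine ⟨∫⁻ x : ℝ, sing a (x - 1) * sing b x,
    (lintegral_sing_mul_sing_one_lt_top ha hb ha1 hb1 hab).ne, fun s t => ?_⟩
  have hab' : 0 < a + b - 1 := by linarith
  rcases eq_or_ne s t with rfl | h
  -- For coinciding points the right side is infinite, provided that the constant is nonzero; the
  -- integrand of the constant vanishes nowhere.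
  · have : sing (a + b - 1) (s - s) = ∞ := by simp [sing, hab']
    rw [this, ENNReal.mul_top]
    · exact le_top
    · refine (lintegral_pos_iff_support (by fun_prop)).2 ?_ |>.ne'
      have : Function.support (fun x : ℝ => sing a (x - 1) * sing b x) = univ := by
        ext x
        simp [sing_ne_zero ha, sing_ne_zero hb]
      simp [this]
  · have hc : s - t ≠ 0 := sub_ne_zero.2 h
    have e1 : ∫⁻ x : ℝ, sing a (x - s) * sing b (x - t) =
        ∫⁻ x : ℝ, sing a (x - (s - t)) * sing b x := by
      rw [← lintegral_add_right_eq_self _ t]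
      refine lintegral_congr fun x => ?_
      congr 2 <;> ring
    rw [e1, lintegral_comp_mul_left_real _ hc]
    -- Scaling by s - t moves the two singularities to 1 and 0. It costs one power of |s - t| from
    -- the measure, which is the -1 in the exponent.
    have e2 : ∀ x, sing a ((s - t) * x - (s - t)) * sing b ((s - t) * x) =
        sing (a + b) (s - t) * (sing a (x - 1) * sing b x) := by
      intro x
      rw [show (s - t) * x - (s - t) = (s - t) * (x - 1) by ring, sing_mul ha, sing_mul hb,
        ← sing_mul_self ha hb]
      ring
    simp_rw [e2]
    rw [lintegral_const_mul _ (by fun_prop), ← mul_assoc, mul_comm]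
    refine mul_le_mul_right ?_ _
    rw [show a + b = 1 + (a + b - 1) by ring, ← sing_mul_self zero_le_one hab'.le, ← mul_assoc]
    rw [show ENNReal.ofReal |s - t| * sing 1 (s - t) = 1 by
      rw [sing, ENNReal.rpow_one, ← Real.norm_eq_abs, ofReal_norm,
        ENNReal.mul_inv_cancel (by simpa using hc) enorm_ne_top]]
    rw [one_mul]
    simp

/-! ### Polar coordinates with the squared radius -/

/-- Polar coordinates on the complex plane, with the squared radius as first coordinate. -/
def polarSq (p : ℝ × ℝ) : ℂ := (Real.sqrt p.1 : ℂ) * Complex.exp (p.2 * Complex.I)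

theorem continuous_polarSq : Continuous polarSq := by
  unfold polarSq
  fun_prop

/-- The measure `dρ dφ` on `ρ > 0`, `-π < φ < π`. -/
def polarSqMeasure : Measure (ℝ × ℝ) :=
  (volume.restrict (Ioi 0)).prod (volume.restrict (Ioo (-Real.pi) Real.pi))

theorem normSq_polarSq {p : ℝ × ℝ} (hp : 0 ≤ p.1) : ‖polarSq p‖ ^ 2 = p.1 := by
  simp [polarSq, Complex.norm_exp, Real.sq_sqrt hp]

/-- With ρ = r² one has r dr dφ = dρ dφ / 2, hence the factor 2. The squared radius makes |q|² + N
linear in the radial variable. -/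
theorem map_polarSq : polarSqMeasure.map polarSq = (2 : ℝ≥0∞) • volume := by
  refine Measure.ext_of_lintegral _ fun f hf => ?_
  have hm : Measurable fun p => f (polarSq p) := hf.comp continuous_polarSq.measurable
  rw [lintegral_map hf continuous_polarSq.measurable, lintegral_smul_measure, polarSqMeasure,
    lintegral_prod _ hm.aemeasurable]
  have himg : (fun r : ℝ => r ^ 2) '' Ioi 0 = Ioi 0 := by
    ext x
    constructor
    · rintro ⟨r, hr, rfl⟩
      exact pow_pos (mem_Ioi.1 hr) 2
    · intro hx
      exact ⟨Real.sqrt x, Real.sqrt_pos.2 hx, Real.sq_sqrt (le_of_lt hx)⟩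
  have hinj : InjOn (fun r : ℝ => r ^ 2) (Ioi 0) := by
    intro a ha b hb h
    exact (pow_left_inj₀ (le_of_lt ha) (le_of_lt hb) two_ne_zero).1 h
  have h1 := lintegral_image_eq_lintegral_abs_deriv_mul (f := fun r : ℝ => r ^ 2)
    (f' := fun r => 2 * r) measurableSet_Ioi (fun x _ => by
      simpa using (hasDerivAt_pow 2 x).hasDerivWithinAt) hinj
    (fun ρ => ∫⁻ φ in Ioo (-Real.pi) Real.pi, f (polarSq (ρ, φ)))
  rw [himg] at h1
  rw [h1, ← Complex.lintegral_comp_polarCoord_symm, polarCoord_target,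
    Measure.volume_eq_prod, ← Measure.prod_restrict, lintegral_prod, smul_eq_mul,
    ← lintegral_const_mul]
  · refine setLIntegral_congr_fun measurableSet_Ioi fun r hr => ?_
    have hr' : (0 : ℝ) < r := hr
    simp only [smul_eq_mul]
    rw [lintegral_const_mul _ (by
      refine hf.comp ?_
      simp only [Complex.polarCoord_symm_apply]
      fun_prop), abs_of_pos (by positivity), ENNReal.ofReal_mul two_pos.le, ENNReal.ofReal_ofNat, mul_assoc]
    congr 2
    refine lintegral_congr fun φ => ?_
    congr 1
    simp only [polarSq, Real.sqrt_sq hr'.le, Complex.polarCoord_symm_apply]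
    rw [Complex.exp_mul_I, Complex.ofReal_cos, Complex.ofReal_sin]
  · refine Measurable.lintegral_prod_right' (f := fun p : ℝ × ℝ => ENNReal.ofReal p.1 • f (Complex.polarCoord.symm p)) ?_
    simp only [Complex.polarCoord_symm_apply]
    fun_prop
  · simp only [Complex.polarCoord_symm_apply]
    fun_prop

theorem lintegral_eq_polarSq {f : ℂ → ℝ≥0∞} (hf : Measurable f) :
    2 * ∫⁻ q, f q = ∫⁻ ρ in Ioi (0 : ℝ), ∫⁻ φ in Ioo (-Real.pi) Real.pi, f (polarSq (ρ, φ)) := by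
  rw [← smul_eq_mul, ← lintegral_smul_measure, ← map_polarSq, lintegral_map hf continuous_polarSq.measurable,
    polarSqMeasure]
  exact lintegral_prod _ (hf.comp continuous_polarSq.measurable).aemeasurable

theorem integrable_comp_polarSq {f : ℂ → ℂ} (hf : Integrable f) :
    Integrable (fun p => f (polarSq p)) polarSqMeasure := by
  have : Integrable f (polarSqMeasure.map polarSq) := by
    rw [map_polarSq]
    exact hf.smul_measure (by simp)
  exact this.comp_measurable continuous_polarSq.measurable

theorem integral_eq_polarSq {f : ℂ → ℂ} (hf : Integrable f) :
    2 * ∫ q, f q = ∫ ρ in Ioi (0 : ℝ), ∫ φ in Ioo (-Real.pi) Real.pi, f (polarSq (ρ, φ)) := by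
  have hm : AEStronglyMeasurable f (polarSqMeasure.map polarSq) := by
    rw [map_polarSq]
    exact hf.aestronglyMeasurable.smul_measure _
  rw [← integral_prod _ (integrable_comp_polarSq hf)]
  rw [show (volume.restrict (Ioi (0:ℝ))).prod (volume.restrict (Ioo (-Real.pi) Real.pi)) =
    polarSqMeasure from rfl, ← integral_map continuous_polarSq.measurable.aemeasurable hm,
    map_polarSq, integral_smul_measure]
  simp

/-- Jordan's inequality |sin x| ≥ 2|x|/π reduces the period around 0 to a power of |x|; periodicity
gives every other interval of integration. -/
theorem lintegral_sing_sin_lt_top {a : ℝ} (ha : 0 ≤ a) (ha1 : a < 1) (α : ℝ) :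
    ∫⁻ φ in Ioo (-Real.pi) Real.pi, sing a (Real.sin (φ - α)) < ∞ := by
  have hle : ∀ x : ℝ, ‖|Real.sin x| ^ (-a)‖ₑ ≤ sing a (Real.sin x) := by
    intro x
    rcases eq_or_ne (Real.sin x) 0 with h | h
    · rcases ha.eq_or_lt with h' | h'
      · simp [← h', sing]
      · simp [h, sing, h']
    · rw [sing_of_ne_zero h, Real.enorm_of_nonneg (by positivity), Real.norm_eq_abs]
  have hper : Function.Periodic (fun x : ℝ => |Real.sin x| ^ (-a)) Real.pi := by
    intro x
    simp
  have hint : IntervalIntegrable (fun x : ℝ => |Real.sin x| ^ (-a)) volume (-(Real.pi / 2))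
      (-(Real.pi / 2) + Real.pi) := by
    rw [intervalIntegrable_iff_integrableOn_Icc_of_le (by linarith [Real.pi_pos])]
    refine ⟨(Measurable.pow_const (by fun_prop) _).aestronglyMeasurable, ?_⟩
    calc ∫⁻ x in Icc (-(Real.pi / 2)) (-(Real.pi / 2) + Real.pi), ‖|Real.sin x| ^ (-a)‖ₑ
        ≤ ∫⁻ x in Icc (-(Real.pi / 2)) (-(Real.pi / 2) + Real.pi),
            ENNReal.ofReal (Real.pi / 2) ^ a * sing a x := by
          refine setLIntegral_mono (by fun_prop) fun x hx => (hle x).trans ?_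
          refine sing_le_mul ha (by positivity) ?_
          rw [Real.norm_eq_abs, Real.norm_eq_abs]
          have := Real.mul_abs_le_abs_sin (x := x) (abs_le.2 ⟨hx.1, by linarith [hx.2]⟩)
          rw [div_mul_eq_mul_div, div_le_iff₀ Real.pi_pos] at this
          linarith
      _ < ∞ := by
          rw [lintegral_const_mul _ (by fun_prop)]
          refine ENNReal.mul_lt_top (ENNReal.rpow_lt_top_of_nonneg ha ENNReal.ofReal_ne_top) ?_
          rw [show -(Real.pi / 2) + Real.pi = Real.pi / 2 by ring]
          exact lintegral_Icc_sing_lt_top ha1 _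
  have hint' := (hper.intervalIntegrable Real.pi_ne_zero hint (-Real.pi - α)
    (Real.pi - α)).comp_sub_right α
  rw [sub_add_cancel, sub_add_cancel, intervalIntegrable_iff_integrableOn_Ioo_of_le
    (by linarith [Real.pi_pos])] at hint'
  refine lt_of_le_of_lt (lintegral_mono_ae ?_) hint'.hasFiniteIntegral
  refine ae_restrict_of_ae ?_
  have hc : {φ : ℝ | Real.sin (φ - α) = 0}.Countable := by
    refine (countable_range (fun n : ℤ => n * Real.pi + α)).mono ?_
    intro φ hφ
    obtain ⟨n, hn⟩ := Real.sin_eq_zero_iff.1 hφ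
    exact ⟨n, by simp only; linarith⟩
  filter_upwards [hc.ae_notMem volume] with φ hφ
  have h : Real.sin (φ - α) ≠ 0 := hφ
  rw [sing_of_ne_zero h, Real.enorm_of_nonneg (by positivity), Real.norm_eq_abs]

/-! ### Singular integrals over the transverse plane -/

/-- The difference of the squares of the two sides is (2rR - (r² + R²) cos ψ)². The right side is
the squared distance of two points at radii r and R, so the bound separates radius from angle. -/
theorem abs_sub_mul_abs_sin_le (r R ψ : ℝ) :
    |r ^ 2 - R ^ 2| * |Real.sin ψ| ≤ r ^ 2 + R ^ 2 - 2 * r * R * Real.cos ψ := by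
  have h0 : 0 ≤ r ^ 2 + R ^ 2 - 2 * r * R * Real.cos ψ := by
    nlinarith [sq_nonneg (r - R * Real.cos ψ), sq_nonneg (R * Real.sin ψ), Real.sin_sq_add_cos_sq ψ]
  rw [← abs_mul]
  refine abs_le_of_sq_le_sq ?_ h0
  have hs : Real.sin ψ ^ 2 = 1 - Real.cos ψ ^ 2 := by
    linarith [Real.sin_sq_add_cos_sq ψ]
  rw [mul_pow, hs]
  nlinarith [sq_nonneg (2 * r * R - (r ^ 2 + R ^ 2) * Real.cos ψ)]

/-- Distance from a point to a line through the origin and to a circle around it, combined. -/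
theorem sing_polarSq_sub_le {a : ℝ} (ha : 0 ≤ a) {ρ : ℝ} (hρ : 0 ≤ ρ) (φ τ : ℝ) (β : ℂ) :
    sing (2 * a) (polarSq (ρ, φ) - β * τ) ≤
      sing a (ρ - ‖β‖ ^ 2 * τ ^ 2) * sing a (Real.sin (φ - β.arg)) := by
  have h1 : ‖polarSq (ρ, φ) - β * τ‖ ^ 2 =
      (√ρ) ^ 2 + (‖β‖ * τ) ^ 2 - 2 * √ρ * (‖β‖ * τ) * Real.cos (φ - β.arg) := by
    have hβ : β * τ = ((‖β‖ * τ : ℝ) : ℂ) * (Real.cos β.arg + Real.sin β.arg * Complex.I) := by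
      conv_lhs => rw [← Complex.norm_mul_cos_add_sin_mul_I β]
      push_cast
      ring
    rw [hβ, polarSq, Complex.exp_mul_I, ← Complex.ofReal_cos, ← Complex.ofReal_sin,
      Complex.sq_norm, Complex.normSq_apply, Real.cos_sub]
    simp only [Complex.sub_re, Complex.sub_im, Complex.add_re, Complex.add_im, Complex.mul_re,
      Complex.mul_im, Complex.ofReal_re, Complex.ofReal_im, Complex.I_re, Complex.I_im]
    linear_combination (√ρ) ^ 2 * Real.sin_sq_add_cos_sq φ +
      (‖β‖ * τ) ^ 2 * Real.sin_sq_add_cos_sq β.arg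
  rw [← sing_mul ha, show (2 : ℝ) * a = a + a by ring, ← sing_mul_self ha ha, ← sing_mul ha]
  refine sing_anti ha ?_
  rw [norm_mul, norm_mul, ← pow_two, h1, Real.norm_eq_abs, Real.norm_eq_abs]
  refine le_trans (le_of_eq ?_) (abs_sub_mul_abs_sin_le (√ρ) (‖β‖ * τ) (φ - β.arg))
  rw [Real.sq_sqrt hρ, mul_pow]

/-- Half of 5/4 goes to the radial and half to the angular factor. The angular power 5/8 is
integrable, and the radial powers compose to 5/8 + 1/2 - 1 = 1/8. -/
theorem exists_lintegral_sing_sub_le (β : ℂ) : ∃ C : ℝ≥0∞, C ≠ ∞ ∧ ∀ τ c : ℝ,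
    ∫⁻ q : ℂ, sing (5 / 4) (q - β * τ) * sing (1 / 2) (‖q‖ ^ 2 + c) ≤
      C * sing (1 / 8) (‖β‖ ^ 2 * τ ^ 2 + c) := by
  obtain ⟨C, hC, h⟩ := exists_lintegral_sing_mul_sing_le (a := 5 / 8) (b := 1 / 2) (by norm_num)
    (by norm_num) (by norm_num) (by norm_num) (by norm_num)
  set S := ∫⁻ φ in Ioo (-Real.pi) Real.pi, sing (5 / 8) (Real.sin (φ - β.arg))
  have hS : S < ∞ := lintegral_sing_sin_lt_top (by norm_num) (by norm_num) _
  refine ⟨S * C, ENNReal.mul_ne_top hS.ne hC, fun τ c => ?_⟩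
  have h1 := lintegral_eq_polarSq
    (f := fun q : ℂ => sing (5 / 4) (q - β * τ) * sing (1 / 2) (‖q‖ ^ 2 + c)) (by fun_prop)
  calc ∫⁻ q : ℂ, sing (5 / 4) (q - β * τ) * sing (1 / 2) (‖q‖ ^ 2 + c)
      ≤ 2 * ∫⁻ q : ℂ, sing (5 / 4) (q - β * τ) * sing (1 / 2) (‖q‖ ^ 2 + c) :=
        le_mul_of_one_le_left' (by norm_num)
    _ = _ := h1
    _ ≤ ∫⁻ ρ in Ioi (0 : ℝ), ∫⁻ φ in Ioo (-Real.pi) Real.pi,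
        sing (5 / 8) (Real.sin (φ - β.arg)) *
          (sing (5 / 8) (ρ - ‖β‖ ^ 2 * τ ^ 2) * sing (1 / 2) (ρ - (-c))) := by
        refine setLIntegral_mono' measurableSet_Ioi fun ρ hρ => lintegral_mono fun φ => ?_
        have hρ' : 0 ≤ ρ := le_of_lt hρ
        rw [normSq_polarSq (p := (ρ, φ)) hρ', sub_neg_eq_add, ← mul_assoc]
        gcongr
        have := sing_polarSq_sub_le (a := 5 / 8) (by norm_num) hρ' φ τ β
        rw [show (2 : ℝ) * (5 / 8) = 5 / 4 by norm_num] at this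
        exact this.trans_eq (mul_comm _ _)
    _ = ∫⁻ ρ in Ioi (0 : ℝ),
        S * (sing (5 / 8) (ρ - ‖β‖ ^ 2 * τ ^ 2) * sing (1 / 2) (ρ - (-c))) := by
        refine lintegral_congr fun ρ => ?_
        rw [lintegral_mul_const _ (by fun_prop)]
    _ = S * ∫⁻ ρ in Ioi (0 : ℝ),
        (sing (5 / 8) (ρ - ‖β‖ ^ 2 * τ ^ 2) * sing (1 / 2) (ρ - (-c))) :=
        lintegral_const_mul _ (by fun_prop)
    _ ≤ S * ∫⁻ ρ : ℝ, (sing (5 / 8) (ρ - ‖β‖ ^ 2 * τ ^ 2) * sing (1 / 2) (ρ - (-c))) := by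
        gcongr
        exact Measure.restrict_le_self
    _ ≤ S * (C * sing (5 / 8 + 1 / 2 - 1) (‖β‖ ^ 2 * τ ^ 2 - (-c))) := by
        gcongr
        exact h _ _
    _ = _ := by
        rw [sub_neg_eq_add, ← mul_assoc]
        norm_num

/-- The larger of u and v is at least half of |v - u|, so 3/4 of its power can be replaced by a
power of |v - u|; the remaining 1/4 is moved to the smaller one. The total 5/4 stays below 2, hence
integrable in the plane. -/
theorem sing_one_mul_sing_one_le (u v : ℂ) : sing 1 u * sing 1 v ≤
    ENNReal.ofReal 2 ^ (3 / 4 : ℝ) * (sing (3 / 4) (v - u) * (sing (5 / 4) u + sing (5 / 4) v)) := by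
  have key : ∀ x y : ℂ, ‖x‖ ≤ ‖y‖ → sing 1 x * sing 1 y ≤
      ENNReal.ofReal 2 ^ (3 / 4 : ℝ) * (sing (3 / 4) (y - x) * sing (5 / 4) x) := by
    intro x y hxy
    rw [show sing 1 y = sing (3 / 4) y * sing (1 / 4) y by
        rw [sing_mul_self (by norm_num) (by norm_num)]; norm_num,
      show sing (5 / 4) x = sing 1 x * sing (1 / 4) x by
        rw [sing_mul_self (by norm_num) (by norm_num)]; norm_num]
    calc sing 1 x * (sing (3 / 4) y * sing (1 / 4) y)
        ≤ sing 1 x * ((ENNReal.ofReal 2 ^ (3 / 4 : ℝ) * sing (3 / 4) (y - x)) *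
          sing (1 / 4) x) := by
          gcongr
          · refine sing_le_mul (by norm_num) two_pos ?_
            linarith [norm_sub_le y x]
          · exact sing_anti (by norm_num) hxy
      _ = _ := by ring
  rcases le_total ‖u‖ ‖v‖ with h | h
  · refine (key u v h).trans ?_
    gcongr
    exact le_self_add
  · rw [mul_comm (sing 1 u)]
    refine (key v u h).trans ?_
    rw [sing_congr (norm_sub_rev u v)]
    gcongr
    exact le_add_self

/-! ### The majorant of the loop integral -/

/-- The weight that dominates the loop integrand after the integration over one light-cone
coordinate. -/
def loopWeight (β γ : ℂ) (p : ℝ × ℂ) : ℝ≥0∞ :=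
  sing 1 (p.2 - β * p.1) * sing 1 (p.2 + γ * (1 - p.1)) *
    sing (1 / 2) (‖p.2‖ ^ 2 + p.1 * (1 - p.1))

@[fun_prop]
theorem measurable_loopWeight (β γ : ℂ) : Measurable (loopWeight β γ) := by
  unfold loopWeight
  fun_prop

/-- A function of `τ` that bounds the integral of `loopWeight`. -/
def loopBound (β γ : ℂ) (τ : ℝ) : ℝ≥0∞ :=
  sing (3 / 4) (β * τ + γ * (1 - τ)) * (sing (1 / 8) (τ * (1 + (‖β‖ ^ 2 - 1) * τ)) +
    sing (1 / 8) ((1 - τ) * (1 + (‖γ‖ ^ 2 - 1) * (1 - τ))))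

/-- The two poles βτ and -γ(1-τ) are at distance |βτ + γ(1-τ)|, which comes out with power 3/4. Each
pole then contributes the radial composition with |q|² + τ(1-τ), evaluated at the squared modulus of
that pole. -/
theorem exists_lintegral_loopWeight_le (β γ : ℂ) : ∃ C : ℝ≥0∞, C ≠ ∞ ∧ ∀ τ : ℝ,
    ∫⁻ q : ℂ, loopWeight β γ (τ, q) ≤ C * loopBound β γ τ := by
  obtain ⟨C₁, hC₁, h₁⟩ := exists_lintegral_sing_sub_le β
  obtain ⟨C₂, hC₂, h₂⟩ := exists_lintegral_sing_sub_le (-γ)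
  set A := ENNReal.ofReal 2 ^ (3 / 4 : ℝ)
  have hA : A ≠ ∞ := ENNReal.rpow_ne_top_of_nonneg (by norm_num) ENNReal.ofReal_ne_top
  refine ⟨A * (C₁ + C₂), ENNReal.mul_ne_top hA (ENNReal.add_ne_top.2 ⟨hC₁, hC₂⟩), fun τ => ?_⟩
  set G := sing (3 / 4) (β * τ + γ * (1 - τ)) with hG
  calc ∫⁻ q : ℂ, loopWeight β γ (τ, q)
      ≤ ∫⁻ q : ℂ, (A * G) * (sing (5 / 4) (q - β * τ) * sing (1 / 2) (‖q‖ ^ 2 + τ * (1 - τ)) +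
        sing (5 / 4) (q - (-γ) * (1 - τ : ℝ)) * sing (1 / 2) (‖q‖ ^ 2 + τ * (1 - τ))) := by
        refine lintegral_mono fun q => ?_
        rw [← add_mul, ← mul_assoc, loopWeight]
        refine mul_le_mul_left ((sing_one_mul_sing_one_le _ _).trans (le_of_eq ?_)) _
        rw [show (τ, q).2 + γ * (1 - (τ, q).1) - ((τ, q).2 - β * (τ, q).1) =
          β * τ + γ * (1 - τ) by ring, ← hG, ← mul_assoc]
        congr 3
        push_cast
        ring
    _ ≤ (A * G) * (C₁ * sing (1 / 8) (‖β‖ ^ 2 * τ ^ 2 + τ * (1 - τ)) +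
        C₂ * sing (1 / 8) (‖-γ‖ ^ 2 * (1 - τ) ^ 2 + τ * (1 - τ))) := by
        rw [lintegral_const_mul _ (by fun_prop), lintegral_add_left (by fun_prop)]
        gcongr
        · exact h₁ τ _
        · exact h₂ (1 - τ) _
    _ ≤ (A * G) * ((C₁ + C₂) * sing (1 / 8) (‖β‖ ^ 2 * τ ^ 2 + τ * (1 - τ)) +
        (C₁ + C₂) * sing (1 / 8) (‖-γ‖ ^ 2 * (1 - τ) ^ 2 + τ * (1 - τ))) := by
        gcongr
        · exact le_self_add
        · exact le_add_self
    _ = _ := by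
        rw [loopBound, ← hG, norm_neg,
          show ‖β‖ ^ 2 * τ ^ 2 + τ * (1 - τ) = τ * (1 + (‖β‖ ^ 2 - 1) * τ) by ring,
          show ‖γ‖ ^ 2 * (1 - τ) ^ 2 + τ * (1 - τ) =
            (1 - τ) * (1 + (‖γ‖ ^ 2 - 1) * (1 - τ)) by ring]
        ring

/-- If the affine function has a real zero, take t there: its values at 0 and 1 are γ and β, so t is
neither endpoint. If its zero is not real, the function is bounded away from 0 and any t works; 2 is
an arbitrary choice. -/
theorem exists_abs_sub_le_norm {β γ : ℂ} (hβ : β ≠ 0) (hγ : γ ≠ 0) (h : β ≠ γ) :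
    ∃ t c : ℝ, t ≠ 0 ∧ t ≠ 1 ∧ 0 < c ∧ ∀ τ : ℝ, |τ - t| ≤ c * ‖β * τ + γ * (1 - τ)‖ := by
  have hs : β - γ ≠ 0 := sub_ne_zero.2 h
  have hs' : 0 < ‖β - γ‖ := norm_pos_iff.2 hs
  set z : ℂ := -γ / (β - γ) with hz
  have hg : ∀ τ : ℝ, ‖β * τ + γ * (1 - τ)‖ = ‖β - γ‖ * ‖(τ : ℂ) - z‖ := by
    intro τ
    rw [← norm_mul, hz]
    congr 1
    field_simp
    ring
  by_cases him : z.im = 0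
  · have hzr : z = (z.re : ℂ) := Complex.ext rfl (by simp [him])
    refine ⟨z.re, ‖β - γ‖⁻¹, ?_, ?_, by positivity, fun τ => ?_⟩
    · intro h0
      rw [h0, hz, div_eq_iff hs] at hzr
      simp [hγ] at hzr
    · intro h0
      rw [h0, hz, div_eq_iff hs] at hzr
      apply hβ
      simp only [Complex.ofReal_one, one_mul] at hzr
      linear_combination -hzr
    · rw [hg, ← mul_assoc, inv_mul_cancel₀ hs'.ne', one_mul, hzr, ← Complex.ofReal_sub,
        Complex.norm_real, Complex.ofReal_re, Real.norm_eq_abs]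
  · have hi : 0 < |z.im| := abs_pos.2 him
    refine ⟨2, (1 + ‖z - 2‖ / |z.im|) * ‖β - γ‖⁻¹, by norm_num, by norm_num, by positivity,
      fun τ => ?_⟩
    rw [hg, mul_assoc, ← mul_assoc ‖β - γ‖⁻¹, inv_mul_cancel₀ hs'.ne', one_mul]
    have h1 : |z.im| ≤ ‖(τ : ℂ) - z‖ := by
      have := Complex.abs_im_le_norm ((τ : ℂ) - z)
      simpa using this
    have h2 : |τ - 2| ≤ ‖(τ : ℂ) - z‖ + ‖z - 2‖ := by
      have h3 := norm_add_le ((τ : ℂ) - z) (z - 2)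
      rw [sub_add_sub_cancel] at h3
      have h4 : ‖(τ : ℂ) - 2‖ = |τ - 2| := by
        rw [show (τ : ℂ) - 2 = ((τ - 2 : ℝ) : ℂ) by push_cast; ring, Complex.norm_real,
          Real.norm_eq_abs]
      rwa [h4] at h3
    have h5 : ‖z - 2‖ ≤ ‖z - 2‖ / |z.im| * ‖(τ : ℂ) - z‖ := by
      rw [div_mul_eq_mul_div, le_div_iff₀ hi]
      gcongr
    linarith

/-- The zero of 1 + (b-1)τ is never 0, and it is 1 only for b = 0. So this singularity also avoids
the endpoints. -/
theorem sing_affine_cases {b : ℝ} (hb : b ≠ 0) :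
    (∀ τ : ℝ, sing (1 / 8) (1 + (b - 1) * τ) = 1) ∨
    ∃ t : ℝ, t ≠ 0 ∧ t ≠ 1 ∧ ∃ K : ℝ≥0∞, K ≠ ∞ ∧
      ∀ τ : ℝ, sing (1 / 8) (1 + (b - 1) * τ) = K * sing (1 / 8) (τ - t) := by
  rcases eq_or_ne b 1 with rfl | h
  · left
    intro τ
    simp [sing]
  · right
    have h' : b - 1 ≠ 0 := sub_ne_zero.2 h
    refine ⟨-(b - 1)⁻¹, neg_ne_zero.2 (inv_ne_zero h'), ?_, sing (1 / 8) (b - 1),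
      sing_ne_top (by norm_num) h', fun τ => ?_⟩
    · intro h1
      apply hb
      field_simp at h1
      linarith
    · rw [← sing_mul (by norm_num)]
      congr 1
      field_simp
      ring

theorem lintegral_endpoint_lt_top {s t : ℝ} (hst : s ≠ t) :
    ∫⁻ τ : ℝ, sing (5 / 8) (τ - s) * sing (3 / 4) (τ - t) < ∞ := by
  obtain ⟨C, hC, h⟩ := exists_lintegral_sing_mul_sing_le (a := 5 / 8) (b := 3 / 4) (by norm_num)
    (by norm_num) (by norm_num) (by norm_num) (by norm_num)
  exact (h s t).trans_lt (ENNReal.mul_lt_top hC.lt_top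
    (sing_ne_top (by norm_num) (sub_ne_zero.2 hst)).lt_top)

/-- Two singularities away from s may coincide with each other: 3/4 + 1/8 = 7/8 is still below 1. -/
theorem lintegral_endpoint_lt_top' {s t t' : ℝ} (hst : s ≠ t) (hst' : s ≠ t') :
    ∫⁻ τ : ℝ, sing (5 / 8) (τ - s) * (sing (3 / 4) (τ - t) * sing (1 / 8) (τ - t')) < ∞ := by
  obtain ⟨C, hC, h⟩ := exists_lintegral_sing_mul_sing_le (a := 5 / 8) (b := 7 / 8) (by norm_num)
    (by norm_num) (by norm_num) (by norm_num) (by norm_num)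
  have fin : ∀ t, s ≠ t → ∫⁻ τ : ℝ, sing (5 / 8) (τ - s) * sing (7 / 8) (τ - t) < ∞ :=
    fun t hst => (h s t).trans_lt (ENNReal.mul_lt_top hC.lt_top
      (sing_ne_top (by norm_num) (sub_ne_zero.2 hst)).lt_top)
  calc _ ≤ ∫⁻ τ : ℝ, (sing (5 / 8) (τ - s) * sing (7 / 8) (τ - t) +
        sing (5 / 8) (τ - s) * sing (7 / 8) (τ - t')) := by
        refine lintegral_mono fun τ => ?_
        rw [← mul_add]
        gcongr
        refine (sing_mul_sing_le (by norm_num) (by norm_num) _ _).trans (le_of_eq ?_)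
        norm_num
    _ < ∞ := by
        rw [lintegral_add_left (by fun_prop)]
        exact ENNReal.add_lt_top.2 ⟨fin t hst, fin t' hst'⟩

/-- The endpoint singularities have power 5/8, the zero of βτ + γ(1-τ) has power 3/4, and the
remaining factor has 1/8. The last two sit away from 0 and 1, and 5/8 + 3/4 > 1 gives integrability
at infinity. -/
theorem lintegral_endpoints_lt_top {β γ : ℂ} (hβ : β ≠ 0) (hγ : γ ≠ 0) (hβγ : β ≠ γ) {b : ℝ}
    (hb : b ≠ 0) :
    ∫⁻ τ : ℝ, (sing (5 / 8) τ + sing (5 / 8) (1 - τ)) *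
      (sing (3 / 4) (β * τ + γ * (1 - τ)) * sing (1 / 8) (1 + (b - 1) * τ)) < ∞ := by
  obtain ⟨t, c, ht0, ht1, hc, hg⟩ := exists_abs_sub_le_norm hβ hγ hβγ
  set A := ENNReal.ofReal c ^ (3 / 4 : ℝ)
  have hA : A ≠ ∞ := ENNReal.rpow_ne_top_of_nonneg (by norm_num) ENNReal.ofReal_ne_top
  have hG : ∀ τ : ℝ, sing (3 / 4) (β * τ + γ * (1 - τ)) ≤ A * sing (3 / 4) (τ - t) := fun τ =>
    sing_le_mul (by norm_num) hc (hg τ)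
  have h1 : ∀ τ : ℝ, sing (5 / 8) (1 - τ) = sing (5 / 8) (τ - 1) := fun τ =>
    sing_congr (norm_sub_rev _ _)
  rcases sing_affine_cases hb with h | ⟨t', ht0', ht1', K, hK, h⟩
  · calc _ ≤ ∫⁻ τ : ℝ, A * (sing (5 / 8) (τ - 0) * sing (3 / 4) (τ - t) +
          sing (5 / 8) (τ - 1) * sing (3 / 4) (τ - t)) := by
          refine lintegral_mono fun τ => ?_
          simp only [h, h1, mul_one]
          rw [← add_mul, sub_zero, ← mul_assoc, mul_comm A, mul_assoc]
          gcongr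
          exact hG τ
      _ < ∞ := by
          rw [lintegral_const_mul _ (by fun_prop), lintegral_add_left (by fun_prop)]
          exact ENNReal.mul_lt_top hA.lt_top (ENNReal.add_lt_top.2
            ⟨lintegral_endpoint_lt_top ht0.symm, lintegral_endpoint_lt_top ht1.symm⟩)
  · calc _ ≤ ∫⁻ τ : ℝ, (A * K) *
          (sing (5 / 8) (τ - 0) * (sing (3 / 4) (τ - t) * sing (1 / 8) (τ - t')) +
          sing (5 / 8) (τ - 1) * (sing (3 / 4) (τ - t) * sing (1 / 8) (τ - t'))) := by
          refine lintegral_mono fun τ => ?_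
          simp only [h, h1]
          rw [← add_mul, sub_zero, ← mul_assoc, mul_comm (A * K), mul_assoc, mul_assoc]
          refine mul_le_mul_right ?_ _
          calc _ ≤ (A * sing (3 / 4) (τ - t)) * (K * sing (1 / 8) (τ - t')) := by
                gcongr
                exact hG τ
            _ = _ := by ring
      _ < ∞ := by
          rw [lintegral_const_mul _ (by fun_prop), lintegral_add_left (by fun_prop)]
          exact ENNReal.mul_lt_top (ENNReal.mul_lt_top hA.lt_top hK.lt_top)
            (ENNReal.add_lt_top.2 ⟨lintegral_endpoint_lt_top' ht0.symm ht0'.symm,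
              lintegral_endpoint_lt_top' ht1.symm ht1'.symm⟩)

/-- Each summand of the bound carries a factor 1/8 at one endpoint, which is absorbed into the half
powers: 1/2 + 1/8 = 5/8. The second summand is the first one reflected by τ ↦ 1 - τ with β and γ
exchanged. -/
theorem lintegral_loopBound_lt_top {β γ : ℂ} (hβ : β ≠ 0) (hγ : γ ≠ 0) (hβγ : β ≠ γ) :
    ∫⁻ τ : ℝ, (sing (1 / 2) τ + sing (1 / 2) (1 - τ)) * loopBound β γ τ < ∞ := by
  have h1 := lintegral_endpoints_lt_top hβ hγ hβγ (b := ‖β‖ ^ 2) (by simpa using hβ)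
  have h2 := lintegral_endpoints_lt_top hγ hβ hβγ.symm (b := ‖γ‖ ^ 2) (by simpa using hγ)
  rw [← lintegral_sub_left_eq_self _ (1 : ℝ)] at h2
  have key : ∀ x y : ℝ, (sing (1 / 2) x + sing (1 / 2) y) * sing (1 / 8) x ≤
      2 * (sing (5 / 8) x + sing (5 / 8) y) := by
    intro x y
    have e : (1 / 2 + 1 / 8 : ℝ) = 5 / 8 := by norm_num
    rw [add_mul, sing_mul_self (by norm_num) (by norm_num), e, mul_comm 2, mul_two]
    have := sing_mul_sing_le (a := 1 / 2) (b := 1 / 8) (by norm_num) (by norm_num) y x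
    rw [e, add_comm] at this
    exact add_le_add le_self_add this
  calc _ ≤ ∫⁻ τ : ℝ, (2 * ((sing (5 / 8) τ + sing (5 / 8) (1 - τ)) *
      (sing (3 / 4) (β * τ + γ * (1 - τ)) * sing (1 / 8) (1 + (‖β‖ ^ 2 - 1) * τ))) +
      2 * ((sing (5 / 8) (1 - τ) + sing (5 / 8) (1 - (1 - τ))) *
      (sing (3 / 4) (γ * (1 - τ : ℝ) + β * (1 - (1 - τ : ℝ))) *
        sing (1 / 8) (1 + (‖γ‖ ^ 2 - 1) * (1 - τ))))) := by
        refine lintegral_mono fun τ => ?_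
        rw [loopBound, sing_mul (by norm_num), sing_mul (by norm_num), sub_sub_cancel,
          show γ * ((1 - τ : ℝ) : ℂ) + β * (1 - ((1 - τ : ℝ) : ℂ)) = β * τ + γ * (1 - τ) by
            push_cast; ring, mul_add, mul_add]
        refine add_le_add ?_ ?_
        · calc _ = ((sing (1 / 2) τ + sing (1 / 2) (1 - τ)) * sing (1 / 8) τ) *
              (sing (3 / 4) (β * τ + γ * (1 - τ)) * sing (1 / 8) (1 + (‖β‖ ^ 2 - 1) * τ)) := by
                ring
            _ ≤ _ := by
                rw [← mul_assoc 2]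
                exact mul_le_mul_left (key _ _) _
        · calc _ = ((sing (1 / 2) (1 - τ) + sing (1 / 2) τ) * sing (1 / 8) (1 - τ)) *
              (sing (3 / 4) (β * τ + γ * (1 - τ)) *
                sing (1 / 8) (1 + (‖γ‖ ^ 2 - 1) * (1 - τ))) := by
                ring
            _ ≤ _ := by
                rw [← mul_assoc 2]
                exact mul_le_mul_left (key _ _) _
    _ < ∞ := by
        rw [lintegral_add_left (by fun_prop), lintegral_const_mul _ (by fun_prop),
          lintegral_const_mul _ (by fun_prop)]
        exact ENNReal.add_lt_top.2 ⟨ENNReal.mul_lt_top (by simp) h1,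
          ENNReal.mul_lt_top (by simp) h2⟩

/-- The dominating function of the loop integral has finite integral. -/
theorem lintegral_loopWeight_lt_top {β γ : ℂ} (hβ : β ≠ 0) (hγ : γ ≠ 0) (hβγ : β ≠ γ) :
    ∫⁻ p : ℝ × ℂ, (sing (1 / 2) p.1 + sing (1 / 2) (1 - p.1)) * loopWeight β γ p < ∞ := by
  obtain ⟨C, hC, h⟩ := exists_lintegral_loopWeight_le β γ
  rw [Measure.volume_eq_prod, lintegral_prod _ (by fun_prop)]
  calc _ ≤ ∫⁻ τ : ℝ, C * ((sing (1 / 2) τ + sing (1 / 2) (1 - τ)) * loopBound β γ τ) := by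
        refine lintegral_mono fun τ => ?_
        simp only
        rw [lintegral_const_mul _ (by fun_prop), ← mul_assoc, mul_comm C, mul_assoc]
        gcongr
        exact h τ
    _ < ∞ := by
        rw [lintegral_const_mul' _ _ hC]
        exact ENNReal.mul_lt_top hC.lt_top (lintegral_loopBound_lt_top hβ hγ hβγ)

/-! ### Absolute convergence for one pair of legs -/

/-- The loop integrand for one pair of legs, in the coordinates `((τ, q), σ)` adapted to the
reference spinor. -/
def legIntegrand (β γ : ℂ) (ε : ℝ) (p : (ℝ × ℂ) × ℝ) : ℂ :=
  1 / ((p.1.2 - β * p.1.1) * (p.1.2 + γ * (1 - p.1.1)) *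
    ((((-(p.2 * p.1.1 + ‖p.1.2‖ ^ 2) : ℝ) : ℂ) + Complex.I * ε) *
      ((((p.2 - 1) * (1 - p.1.1) - ‖p.1.2‖ ^ 2 : ℝ) : ℂ) + Complex.I * ε)))

theorem measurable_legIntegrand (β γ : ℂ) (ε : ℝ) : Measurable (legIntegrand β γ ε) := by
  unfold legIntegrand
  fun_prop

/-- A pole of order one on the real line is not integrable. A quarter of its power is paid for with
a power of ε, which costs nothing while ε is fixed. -/
theorem sing_one_add_I_mul_le (x ε : ℝ) :
    sing 1 ((x : ℂ) + Complex.I * ε) ≤ sing (3 / 4) x * sing (1 / 4) ε := by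
  have e : sing 1 ((x : ℂ) + Complex.I * ε) =
      sing (3 / 4) ((x : ℂ) + Complex.I * ε) * sing (1 / 4) ((x : ℂ) + Complex.I * ε) := by
    rw [sing_mul_self (by norm_num) (by norm_num)]
    norm_num
  rw [e]
  refine mul_le_mul' (sing_anti (a := 3 / 4) (by norm_num) ?_)
    (sing_anti (a := 1 / 4) (by norm_num) ?_)
  · simpa using Complex.abs_re_le_norm ((x : ℂ) + Complex.I * ε)
  · simpa using Complex.abs_im_le_norm ((x : ℂ) + Complex.I * ε)

/-- With the imaginary parts bounded away, the propagators have real zeros s and t in σ. Two powers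
3/4 compose to 1/2 of s - t, whose numerator up to sign is |q|² + τ(1-τ) and whose denominator
τ(1-τ) lowers the powers 3/4 of τ and 1-τ to 1/4. -/
theorem exists_lintegral_legIntegrand_le (β γ : ℂ) : ∃ C : ℝ≥0∞, C ≠ ∞ ∧
    ∀ (ε τ : ℝ) (q : ℂ), τ ≠ 0 → τ ≠ 1 →
      ∫⁻ σ, ‖legIntegrand β γ ε ((τ, q), σ)‖ₑ ≤
        C * sing (1 / 2) ε * (sing (1 / 4) τ * sing (1 / 4) (1 - τ) * loopWeight β γ (τ, q)) := by
  obtain ⟨C, hC, h⟩ := exists_lintegral_sing_mul_sing_le (a := 3 / 4) (b := 3 / 4) (by norm_num)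
    (by norm_num) (by norm_num) (by norm_num) (by norm_num)
  refine ⟨C, hC, fun ε τ q h0 h1 => ?_⟩
  have h1' : 1 - τ ≠ 0 := sub_ne_zero.2 h1.symm
  set ρ := ‖q‖ ^ 2 with hρ
  set A := sing 1 (q - β * τ) * sing 1 (q + γ * (1 - τ)) with hA
  set s := -(ρ / τ) with hs
  set t := 1 + ρ / (1 - τ) with ht
  have e12 : (1 / 4 + 1 / 2 : ℝ) = 3 / 4 := by norm_num
  calc ∫⁻ σ, ‖legIntegrand β γ ε ((τ, q), σ)‖ₑ
      ≤ ∫⁻ σ, (A * sing (1 / 2) ε * (sing (3 / 4) τ * sing (3 / 4) (1 - τ))) *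
          (sing (3 / 4) (σ - s) * sing (3 / 4) (σ - t)) := by
        refine lintegral_mono fun σ => ?_
        rw [legIntegrand, one_div]
        refine (enorm_inv_le_sing _).trans ?_
        rw [sing_mul zero_le_one, sing_mul zero_le_one, sing_mul zero_le_one]
        simp only [← hρ, ← hA]
        calc _ ≤ A * ((sing (3 / 4) (-(σ * τ + ρ)) * sing (1 / 4) ε) *
              (sing (3 / 4) ((σ - 1) * (1 - τ) - ρ) * sing (1 / 4) ε)) := by
              gcongr
              · exact sing_one_add_I_mul_le _ _
              · exact sing_one_add_I_mul_le _ _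
          _ = _ := by
              rw [show -(σ * τ + ρ) = -(τ * (σ - s)) by rw [hs]; field_simp; ring,
                show (σ - 1) * (1 - τ) - ρ = (1 - τ) * (σ - t) by rw [ht]; field_simp; ring,
                sing_congr (norm_neg (τ * (σ - s))), sing_mul (by norm_num),
                sing_mul (by norm_num),
                show sing (1 / 2) ε = sing (1 / 4) ε * sing (1 / 4) ε by
                  rw [sing_mul_self (by norm_num) (by norm_num)]; norm_num]
              ring
    _ ≤ (A * sing (1 / 2) ε * (sing (3 / 4) τ * sing (3 / 4) (1 - τ))) *
          (C * sing (1 / 2) (s - t)) := by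
        rw [lintegral_const_mul _ (by fun_prop)]
        gcongr
        convert! h s t using 3
        norm_num
    _ = _ := by
        have hN : ρ + τ * (1 - τ) = -(τ * ((1 - τ) * (s - t))) := by
          rw [hs, ht]
          field_simp
          ring
        rw [loopWeight]
        simp only [← hρ, ← hA]
        rw [hN, sing_congr (norm_neg (τ * ((1 - τ) * (s - t)))), sing_mul (by norm_num),
          sing_mul (by norm_num), ← e12, ← sing_mul_self (by norm_num) (by norm_num),
          ← sing_mul_self (by norm_num) (by norm_num)]
        ring

theorem ae_fst_ne (t : ℝ) : ∀ᵐ p : ℝ × ℂ, p.1 ≠ t := by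
  rw [Measure.volume_eq_prod]
  exact Measure.quasiMeasurePreserving_fst.ae (Measure.ae_ne volume t)

/-- Absolute convergence of the loop integral for one pair of legs. -/
theorem integrable_legIntegrand {β γ : ℂ} (hβ : β ≠ 0) (hγ : γ ≠ 0) (hβγ : β ≠ γ) {ε : ℝ}
    (hε : ε ≠ 0) : Integrable (legIntegrand β γ ε) := by
  refine ⟨(measurable_legIntegrand β γ ε).aestronglyMeasurable, ?_⟩
  obtain ⟨C, hC, h⟩ := exists_lintegral_legIntegrand_le β γ
  rw [hasFiniteIntegral_iff_enorm, Measure.volume_eq_prod,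
    lintegral_prod _ (measurable_legIntegrand β γ ε).enorm.aemeasurable]
  have hK : C * sing (1 / 2) ε ≠ ∞ := ENNReal.mul_ne_top hC (sing_ne_top (by norm_num) hε)
  calc _ ≤ ∫⁻ p : ℝ × ℂ, C * sing (1 / 2) ε *
        ((sing (1 / 2) p.1 + sing (1 / 2) (1 - p.1)) * loopWeight β γ p) := by
        refine lintegral_mono_ae ?_
        filter_upwards [ae_fst_ne 0, ae_fst_ne 1] with p h0 h1
        refine (h ε p.1 p.2 h0 h1).trans ?_
        gcongr
        -- The product of the quarter powers is replaced by a sum of half powers, so that the same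
        -- majorant also serves after the exact σ-integration.
        refine (sing_mul_sing_le (by norm_num) (by norm_num) _ _).trans (le_of_eq ?_)
        norm_num
    _ < ∞ := by
        rw [lintegral_const_mul' _ _ hK]
        exact ENNReal.mul_lt_top hK.lt_top (lintegral_loopWeight_lt_top hβ hγ hβγ)

/-! ### The exact integral over σ -/

section line

open Complex

/-- The divergent log s cancels in the difference, so only the limits of c - z/s with c = ±1 are
needed. -/
theorem log_sub_sub_log_sub_eq {s : ℝ} (hs : 0 < s) {z w c : ℂ} (hz : c * s - z ≠ 0)
    (hw : c * s - w ≠ 0) : log (c * s - z) - log (c * s - w) =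
      log (c - z * (s⁻¹ : ℝ)) - log (c - w * (s⁻¹ : ℝ)) := by
  have hs' : (s : ℂ) ≠ 0 := by exact_mod_cast hs.ne'
  have key : ∀ z : ℂ, c * s - z ≠ 0 → log (c * s - z) = Real.log s + log (c - z * (s⁻¹ : ℝ)) := by
    intro z hz
    have e : c * s - z = s * (c - z * (s⁻¹ : ℝ)) := by
      push_cast
      field_simp
    rw [e, log_ofReal_mul hs]
    intro h
    rw [e, h, mul_zero] at hz
    exact hz rfl
  rw [key z hz, key w hw]
  ring

theorem tendsto_sub_mul_inv (c z : ℂ) : Tendsto (fun s : ℝ => c - z * (s⁻¹ : ℝ)) atTop (𝓝 c) := by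
  have h := (continuous_ofReal.tendsto 0).comp tendsto_inv_atTop_zero
  simpa using (h.const_mul z).const_sub c

theorem ofReal_sub_ne_zero {z : ℂ} (hz : z.im ≠ 0) (s : ℝ) : (s : ℂ) - z ≠ 0 := by
  intro h
  have := congrArg im h
  simp at this
  exact hz this

theorem tendsto_log_sub_sub_log_sub_atTop {z w : ℂ} (hz : z.im ≠ 0) (hw : w.im ≠ 0) :
    Tendsto (fun s : ℝ => log (s - z) - log (s - w)) atTop (𝓝 0) := by
  have h1 : ∀ z : ℂ, Tendsto (fun s : ℝ => log (1 - z * (s⁻¹ : ℝ))) atTop (𝓝 0) := by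
    intro z
    have := (continuousAt_clog (by simp : (1 : ℂ) ∈ slitPlane)).tendsto.comp
      (tendsto_sub_mul_inv 1 z)
    simpa [Function.comp_def] using this
  have h2 := (h1 z).sub (h1 w)
  rw [sub_zero] at h2
  refine h2.congr' ?_
  filter_upwards [eventually_gt_atTop 0] with s hs
  have := log_sub_sub_log_sub_eq (c := 1) hs (z := z) (w := w)
    (by simpa using ofReal_sub_ne_zero hz s) (by simpa using ofReal_sub_ne_zero hw s)
  rw [← this, one_mul]

/-- The point -1 - z/s approaches the branch cut from below when Im z > 0, and from above when Im z
< 0. This jump is the only source of the 2πi. -/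
theorem tendsto_log_neg_one_sub {z : ℂ} (hz : 0 < z.im) :
    Tendsto (fun s : ℝ => log (-1 - z * (s⁻¹ : ℝ))) atTop (𝓝 (-(Real.pi * I))) := by
  have h := tendsto_log_nhdsWithin_im_neg_of_re_neg_of_im_zero (z := -1) (by simp) (by simp)
  have h' : Tendsto (fun s : ℝ => -1 - z * (s⁻¹ : ℝ)) atTop (𝓝[{z : ℂ | z.im < 0}] (-1)) := by
    refine tendsto_nhdsWithin_iff.2 ⟨tendsto_sub_mul_inv _ _, ?_⟩
    filter_upwards [eventually_gt_atTop 0] with s hs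
    have : 0 < z.im * s⁻¹ := by positivity
    simpa using this
  simpa [Function.comp_def] using h.comp h'

theorem tendsto_log_neg_one_sub' {z : ℂ} (hz : z.im < 0) :
    Tendsto (fun s : ℝ => log (-1 - z * (s⁻¹ : ℝ))) atTop (𝓝 (Real.pi * I)) := by
  have h := tendsto_log_nhdsWithin_im_nonneg_of_re_neg_of_im_zero (z := -1) (by simp) (by simp)
  have h' : Tendsto (fun s : ℝ => -1 - z * (s⁻¹ : ℝ)) atTop (𝓝[{z : ℂ | 0 ≤ z.im}] (-1)) := by
    refine tendsto_nhdsWithin_iff.2 ⟨tendsto_sub_mul_inv _ _, ?_⟩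
    filter_upwards [eventually_gt_atTop 0] with s hs
    have : z.im * s⁻¹ ≤ 0 := mul_nonpos_of_nonpos_of_nonneg hz.le (by positivity)
    simpa using this
  simpa [Function.comp_def] using h.comp h'

theorem tendsto_log_sub_sub_log_sub_atBot {z w a b : ℂ} (hz : z.im ≠ 0) (hw : w.im ≠ 0)
    (ha : Tendsto (fun s : ℝ => log (-1 - z * (s⁻¹ : ℝ))) atTop (𝓝 a))
    (hb : Tendsto (fun s : ℝ => log (-1 - w * (s⁻¹ : ℝ))) atTop (𝓝 b)) :
    Tendsto (fun s : ℝ => log (s - z) - log (s - w)) atBot (𝓝 (a - b)) := by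
  have h3 : Tendsto (fun s : ℝ => log (((-s : ℝ) : ℂ) - z) - log (((-s : ℝ) : ℂ) - w)) atTop
      (𝓝 (a - b)) := by
    refine (ha.sub hb).congr' ?_
    filter_upwards [eventually_gt_atTop 0] with s hs
    have := log_sub_sub_log_sub_eq (c := -1) hs (z := z) (w := w)
      (by simpa using ofReal_sub_ne_zero hz (-s)) (by simpa using ofReal_sub_ne_zero hw (-s))
    rw [← this]
    simp
  simpa [Function.comp_def] using h3.comp tendsto_neg_atBot_atTop

/-- The antiderivative (log(s-z) - log(s-w))/(z-w) is smooth on the whole line, since s - z and s -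
w have constant nonzero imaginary part and never meet the cut. The integral is its jump between the
two ends. -/
theorem integral_inv_mul_inv {z w a b : ℂ} (hz : z.im ≠ 0) (hw : w.im ≠ 0) (hzw : z ≠ w)
    (hint : Integrable fun s : ℝ => ((s - z) * (s - w))⁻¹)
    (ha : Tendsto (fun s : ℝ => log (-1 - z * (s⁻¹ : ℝ))) atTop (𝓝 a))
    (hb : Tendsto (fun s : ℝ => log (-1 - w * (s⁻¹ : ℝ))) atTop (𝓝 b)) :
    ∫ s : ℝ, (((s : ℂ) - z) * (s - w))⁻¹ = (b - a) / (z - w) := by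
  have hs : z - w ≠ 0 := sub_ne_zero.2 hzw
  have hd : ∀ {z : ℂ}, z.im ≠ 0 → ∀ s : ℝ, HasDerivAt (fun s : ℝ => log ((s : ℂ) - z))
      ((s : ℂ) - z)⁻¹ s := by
    intro z hz s
    have h1 : HasDerivAt (fun s : ℝ => (s : ℂ) - z) 1 s := (ofRealCLM.hasDerivAt (x := s)).sub_const z
    have h2 := h1.clog_real (mem_slitPlane_iff.2 (Or.inr (by simpa using hz)))
    simpa using h2
  have h := integral_of_hasDerivAt_of_tendsto
    (f := fun s : ℝ => (log (s - z) - log (s - w)) / (z - w)) (f' := fun s : ℝ => ((s - z) * (s - w))⁻¹)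
    (m := (a - b) / (z - w)) (n := 0) (fun s => ?_) hint
    ((tendsto_log_sub_sub_log_sub_atBot hz hw ha hb).div_const _)
    (by simpa using (tendsto_log_sub_sub_log_sub_atTop hz hw).div_const (z - w))
  · rw [h]
    ring
  · convert! ((hd hz s).sub (hd hw s)).div_const (z - w) using 1
    have h1 := ofReal_sub_ne_zero hz s
    have h2 := ofReal_sub_ne_zero hw s
    field_simp
    ring

end line

open Complex in
/-- The integral over the light-cone coordinate `σ`: the two poles lie on opposite sides of the real
axis exactly when `0 < τ < 1`. -/
theorem integral_legIntegrand {β γ : ℂ} {ε τ : ℝ} (hε : 0 < ε) {q : ℂ} (h0 : τ ≠ 0) (h1 : τ ≠ 1)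
    (hint : Integrable fun σ => legIntegrand β γ ε ((τ, q), σ)) :
    ∫ σ, legIntegrand β γ ε ((τ, q), σ) =
      (Ioo (0 : ℝ) 1).indicator (fun τ : ℝ => 2 * Real.pi * I /
        ((q - β * τ) * (q + γ * (1 - τ)) *
          (((‖q‖ ^ 2 + τ * (1 - τ) : ℝ) : ℂ) - I * ε))) τ := by
  -- On the zero set of the linear factors both sides are 0, by the convention for division by 0.
  rcases eq_or_ne ((q - β * τ) * (q + γ * (1 - τ))) 0 with hA | hA
  · have : ∀ σ, legIntegrand β γ ε ((τ, q), σ) = 0 := by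
      intro σ
      simp [legIntegrand, hA]
    simp only [this, integral_zero]
    by_cases h : τ ∈ Ioo (0 : ℝ) 1
    · rw [indicator_of_mem h, hA]
      simp
    · rw [indicator_of_notMem h]
  set A := (q - β * τ) * (q + γ * (1 - τ)) with hAdef
  set ρ := ‖q‖ ^ 2 with hρ
  have h1' : 1 - τ ≠ 0 := sub_ne_zero.2 h1.symm
  have h0c : (τ : ℂ) ≠ 0 := by exact_mod_cast h0
  have h1c : (1 - τ : ℂ) ≠ 0 := by exact_mod_cast h1'
  -- z and w are the zeros in σ of the two propagators; their imaginary parts have the signs of τ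
  -- and of τ - 1.
  set z : ℂ := ((-ρ / τ : ℝ) : ℂ) + ((ε / τ : ℝ) : ℂ) * I with hz
  set w : ℂ := ((1 + ρ / (1 - τ) : ℝ) : ℂ) + ((-(ε / (1 - τ)) : ℝ) : ℂ) * I with hw
  have hzi : z.im = ε / τ := by rw [hz]; simp [-ofReal_div]
  have hwi : w.im = -(ε / (1 - τ)) := by rw [hw]; simp [-ofReal_div, -ofReal_neg]
  have hz0 : z.im ≠ 0 := by rw [hzi]; positivity
  have hw0 : w.im ≠ 0 := by rw [hwi]; exact neg_ne_zero.2 (div_ne_zero hε.ne' h1')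
  set N : ℂ := ((ρ + τ * (1 - τ) : ℝ) : ℂ) - I * ε with hN
  have hN0 : N ≠ 0 := by
    intro h
    have := congrArg im h
    rw [hN] at this
    simp [-ofReal_add, -ofReal_mul] at this
    exact hε.ne' this
  have hzw' : z - w = -N / (τ * (1 - τ)) := by
    rw [hz, hw, hN]
    push_cast
    field_simp
    ring
  have hzw : z ≠ w := by
    rw [← sub_ne_zero, hzw']
    exact div_ne_zero (neg_ne_zero.2 hN0) (mul_ne_zero h0c h1c)
  have hform : ∀ σ : ℝ, legIntegrand β γ ε ((τ, q), σ) =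
      (A * (-τ * (1 - τ)))⁻¹ * ((σ - z) * (σ - w))⁻¹ := by
    intro σ
    rw [legIntegrand, one_div, ← mul_inv]
    simp only [← hρ, ← hAdef]
    congr 1
    rw [hz, hw]
    push_cast
    field_simp
    ring
  have hK : (A * (-τ * (1 - τ)))⁻¹ ≠ 0 :=
    inv_ne_zero (mul_ne_zero hA (mul_ne_zero (neg_ne_zero.2 h0c) h1c))
  simp only [hform] at hint ⊢
  rw [integrable_const_mul_iff (IsUnit.mk0 _ hK)] at hint
  rw [integral_const_mul]
  by_cases h : τ ∈ Ioo (0 : ℝ) 1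
  · have hp1 : 0 < z.im := by rw [hzi]; exact div_pos hε h.1
    have hp2 : w.im < 0 := by rw [hwi]; exact neg_neg_of_pos (div_pos hε (by linarith [h.2]))
    rw [indicator_of_mem h, integral_inv_mul_inv hz0 hw0 hzw hint (tendsto_log_neg_one_sub hp1)
      (tendsto_log_neg_one_sub' hp2), hzw']
    change _ = 2 * Real.pi * I / (A * N)
    field_simp
    ring
  · rw [indicator_of_notMem h]
    rcases lt_or_gt_of_ne h0 with hτ | hτ
    · have hp1 : z.im < 0 := by rw [hzi]; exact div_neg_of_pos_of_neg hε hτ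
      have hp2 : w.im < 0 := by rw [hwi]; exact neg_neg_of_pos (div_pos hε (by linarith))
      rw [integral_inv_mul_inv hz0 hw0 hzw hint (tendsto_log_neg_one_sub' hp1)
        (tendsto_log_neg_one_sub' hp2)]
      simp
    · have hτ1 : 1 < τ := by
        rcases lt_or_gt_of_ne h1 with h' | h'
        · exact absurd ⟨hτ, h'⟩ h
        · exact h'
      have hp1 : 0 < z.im := by rw [hzi]; exact div_pos hε hτ
      have hp2 : 0 < w.im := by
        rw [hwi]
        exact neg_pos.2 (div_neg_of_pos_of_neg hε (by linarith))
      rw [integral_inv_mul_inv hz0 hw0 hzw hint (tendsto_log_neg_one_sub hp1)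
        (tendsto_log_neg_one_sub hp2)]
      simp

/-! ### The exact integral over the transverse plane -/

section angular

open Real

/-- The pole is outside the circle, so this is the mean value property at the center. -/
theorem circleAverage_inv_sub_of_lt {a : ℂ} {r : ℝ} (hr : 0 < r) (h : r < ‖a‖) :
    circleAverage (fun z => (z - a)⁻¹) 0 r = -a⁻¹ := by
  have hne : ∀ z ∈ Metric.closedBall (0 : ℂ) |r|, z - a ≠ 0 := by
    intro z hz h0
    rw [sub_eq_zero.1 h0, mem_closedBall_zero_iff, abs_of_pos hr] at hz
    linarith
  have := circleAverage_of_differentiable_on_off_countable (f := fun z : ℂ => (z - a)⁻¹) (c := 0)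
    (R := r) (s := ∅) countable_empty
    (ContinuousOn.inv₀ (by fun_prop) hne)
    (fun z hz => DifferentiableAt.inv (by fun_prop)
      (hne z (Metric.ball_subset_closedBall hz.1)))
  rw [this]
  simp

/-- Inverting the unit circle turns the function into z/(r - az), which is holomorphic on the disc
and vanishes at its center. -/
theorem circleAverage_inv_sub_of_gt {a : ℂ} {r : ℝ} (h : ‖a‖ < r) :
    circleAverage (fun z => (z - a)⁻¹) 0 r = 0 := by
  have hr : 0 < r := lt_of_le_of_lt (norm_nonneg a) h
  have hr' : (r : ℂ) ≠ 0 := by exact_mod_cast hr.ne'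
  have hne : ∀ z ∈ Metric.closedBall (0 : ℂ) |1|, r - a * z ≠ 0 := by
    intro z hz h0
    rw [mem_closedBall_zero_iff, abs_one] at hz
    have h1 : ‖a * z‖ = r := by
      rw [← sub_eq_zero.1 h0, Complex.norm_real, norm_of_nonneg hr.le]
    rw [norm_mul] at h1
    nlinarith [norm_nonneg a, norm_nonneg z]
  rw [circleAverage_eq_circleAverage_zero_one]
  have h1 : circleAverage (fun z : ℂ => (r * z + 0 - a)⁻¹) 0 1 =
      circleAverage (fun z : ℂ => z / (r - a * z)) 0 1 := by
    rw [← circleAverage_zero_one_congr_inv]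
    refine circleAverage_congr_sphere fun z hz => ?_
    have hz0 : z ≠ 0 := by
      rintro rfl
      simp at hz
    have := hne z (Metric.sphere_subset_closedBall hz)
    simp only [add_zero]
    rw [inv_eq_one_div, div_eq_div_iff]
    · field_simp
    · intro h0
      apply this
      have : (r * z⁻¹ - a) * z = 0 := by rw [h0, zero_mul]
      field_simp at this
      linear_combination this
    · exact this
  rw [h1]
  have := circleAverage_of_differentiable_on_off_countable (f := fun z : ℂ => z / (r - a * z))
    (c := 0) (R := 1) (s := ∅) countable_empty
    (ContinuousOn.div (by fun_prop) (by fun_prop) hne)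
    (fun z hz => DifferentiableAt.div (by fun_prop) (by fun_prop)
      (hne z (Metric.ball_subset_closedBall hz.1)))
  rw [this]
  simp

theorem setIntegral_eq_circleAverage (f : ℂ → ℂ) {ρ : ℝ} :
    ∫ φ in Ioo (-π) π, f (polarSq (ρ, φ)) = 2 * π * circleAverage f 0 (√ρ) := by
  rw [circleAverage_def, ← integral_Ioc_eq_integral_Ioo,
    ← intervalIntegral.integral_of_le (by linarith [pi_pos])]
  have hper : Function.Periodic (fun θ => f (circleMap 0 (√ρ) θ)) (2 * π) := fun x => by
    simp only [periodic_circleMap 0 (√ρ) x]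
  have := hper.intervalIntegral_add_eq (-π) 0
  rw [zero_add, show -π + 2 * π = π by ring] at this
  rw [← this, Complex.real_smul, ← mul_assoc]
  have hpi : (π : ℂ) ≠ 0 := by exact_mod_cast pi_ne_zero
  push_cast
  rw [mul_inv_cancel₀ (mul_ne_zero two_ne_zero hpi), one_mul]
  simp [polarSq, circleMap]

/-- Partial fractions leave one average per pole, and a pole contributes only from circles smaller
than its modulus. The radial integral is thereby cut off at ‖a‖² or ‖b‖². -/
theorem setIntegral_inv_mul_inv {a b : ℂ} (hab : a ≠ b) {ρ : ℝ} (hρ : 0 < ρ)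
    (ha : ρ ≠ ‖a‖ ^ 2) (hb : ρ ≠ ‖b‖ ^ 2) :
    ∫ φ in Ioo (-π) π, ((polarSq (ρ, φ) - a) * (polarSq (ρ, φ) - b))⁻¹ =
      2 * π / (a - b) * ((if ρ < ‖b‖ ^ 2 then b⁻¹ else 0) - if ρ < ‖a‖ ^ 2 then a⁻¹ else 0) := by
  have hs : a - b ≠ 0 := sub_ne_zero.2 hab
  have hr : 0 < √ρ := sqrt_pos.2 hρ
  have hne : ∀ {a : ℂ}, ρ ≠ ‖a‖ ^ 2 → ∀ z ∈ Metric.sphere (0 : ℂ) |√ρ|, z - a ≠ 0 := by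
    intro a ha z hz h0
    rw [sub_eq_zero.1 h0, mem_sphere_zero_iff_norm, abs_of_pos hr] at hz
    rw [hz, sq_sqrt hρ.le] at ha
    exact ha rfl
  have havg : ∀ {a : ℂ}, ρ ≠ ‖a‖ ^ 2 → circleAverage (fun z => (z - a)⁻¹) 0 (√ρ) =
      -if ρ < ‖a‖ ^ 2 then a⁻¹ else 0 := by
    intro a ha
    split_ifs with h
    · refine circleAverage_inv_sub_of_lt hr ?_
      rw [sqrt_lt hρ.le (norm_nonneg a)]
      exact h
    · rw [neg_zero]
      refine circleAverage_inv_sub_of_gt ?_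
      rw [lt_sqrt (norm_nonneg a)]
      exact lt_of_le_of_ne (not_lt.1 h) ha.symm
  have hci : ∀ {a : ℂ}, ρ ≠ ‖a‖ ^ 2 → CircleIntegrable (fun z => (z - a)⁻¹) 0 (√ρ) := fun ha =>
    ContinuousOn.circleIntegrable' (ContinuousOn.inv₀ (by fun_prop) (hne ha))
  rw [setIntegral_eq_circleAverage (fun z => ((z - a) * (z - b))⁻¹)]
  have h1 : circleAverage (fun z => ((z - a) * (z - b))⁻¹) 0 (√ρ) =
      circleAverage (fun z => (a - b)⁻¹ • ((z - a)⁻¹ - (z - b)⁻¹)) 0 (√ρ) := by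
    refine circleAverage_congr_sphere fun z hz => ?_
    have h2 := hne ha z hz
    have h3 := hne hb z hz
    simp only [smul_eq_mul]
    field_simp
    ring
  rw [h1, circleAverage_fun_smul, circleAverage_fun_sub (hci ha) (hci hb), havg ha, havg hb,
    smul_eq_mul]
  field_simp
  ring

end angular

theorem integrableOn_cutoff {N A : ℝ} (hN : 0 < N) (c : ℂ) :
    IntegrableOn (fun ρ : ℝ => (((ρ + N : ℝ) : ℂ))⁻¹ * if ρ < A then c else 0) (Ioi 0) := by
  have h : IntegrableOn (fun ρ : ℝ => (((ρ + N : ℝ) : ℂ))⁻¹ * c) (Icc 0 A) := by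
    refine ContinuousOn.integrableOn_Icc (ContinuousOn.mul (ContinuousOn.inv₀ (by fun_prop) ?_)
      continuousOn_const)
    intro x hx
    have : x + N ≠ 0 := by linarith [hx.1]
    exact_mod_cast this
  have h2 := (h.mono_set Ioo_subset_Icc_self).integrable_indicator measurableSet_Ioo
  refine h2.integrableOn.congr_fun (fun ρ hρ => ?_) measurableSet_Ioi
  by_cases hA : ρ < A
  · rw [indicator_of_mem (by exact ⟨hρ, hA⟩), if_pos hA]
  · rw [indicator_of_notMem (fun h => hA h.2), if_neg hA, mul_zero]

theorem integral_cutoff {N A : ℝ} (hN : 0 < N) (hA : 0 ≤ A) (c : ℂ) :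
    ∫ ρ in Ioi (0 : ℝ), (((ρ + N : ℝ) : ℂ))⁻¹ * (if ρ < A then c else 0) =
      c * Real.log (1 + A / N) := by
  have h1 : ∀ ρ ∈ Ioi (0 : ℝ), (((ρ + N : ℝ) : ℂ))⁻¹ * (if ρ < A then c else 0) =
      (Iio A).indicator (fun ρ : ℝ => (((ρ + N)⁻¹ : ℝ) : ℂ) * c) ρ := by
    intro ρ _
    by_cases hA : ρ < A
    · rw [indicator_of_mem (by exact hA), if_pos hA]
      push_cast
      rfl
    · rw [indicator_of_notMem (by exact hA), if_neg hA, mul_zero]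
  rw [setIntegral_congr_fun measurableSet_Ioi h1, setIntegral_indicator measurableSet_Iio,
    Ioi_inter_Iio, integral_mul_const, ← integral_Ioc_eq_integral_Ioo,
    ← intervalIntegral.integral_of_le hA, intervalIntegral.integral_ofReal,
    intervalIntegral.integral_comp_add_right (fun x => x⁻¹) N, integral_inv_of_pos (by linarith)
    (by linarith), mul_comm, zero_add]
  congr 3
  field_simp
  ring

/-- The integral over the transverse plane. -/
theorem integral_transverse {a b : ℂ} (hab : a ≠ b) {N : ℝ} (hN : 0 < N)
    (hint : Integrable fun q : ℂ => ((q - a) * (q - b) * ((‖q‖ ^ 2 + N : ℝ) : ℂ))⁻¹) :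
    ∫ q : ℂ, ((q - a) * (q - b) * ((‖q‖ ^ 2 + N : ℝ) : ℂ))⁻¹ =
      Real.pi / (a - b) * (b⁻¹ * Real.log (1 + ‖b‖ ^ 2 / N) - a⁻¹ * Real.log (1 + ‖a‖ ^ 2 / N)) := by
  have h := integral_eq_polarSq hint
  have h2 : ∫ ρ in Ioi (0 : ℝ), ∫ φ in Ioo (-Real.pi) Real.pi,
      ((polarSq (ρ, φ) - a) * (polarSq (ρ, φ) - b) * ((‖polarSq (ρ, φ)‖ ^ 2 + N : ℝ) : ℂ))⁻¹ =
      ∫ ρ in Ioi (0 : ℝ), 2 * Real.pi / (a - b) *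
        ((((ρ + N : ℝ) : ℂ))⁻¹ * (if ρ < ‖b‖ ^ 2 then b⁻¹ else 0) -
          (((ρ + N : ℝ) : ℂ))⁻¹ * (if ρ < ‖a‖ ^ 2 then a⁻¹ else 0)) := by
    refine setIntegral_congr_ae measurableSet_Ioi ?_
    filter_upwards [Measure.ae_ne volume (‖a‖ ^ 2), Measure.ae_ne volume (‖b‖ ^ 2)]
      with ρ ha hb hρ
    have hρ' : 0 < ρ := hρ
    have h3 : ∀ φ, ((polarSq (ρ, φ) - a) * (polarSq (ρ, φ) - b) *
        ((‖polarSq (ρ, φ)‖ ^ 2 + N : ℝ) : ℂ))⁻¹ =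
        ((polarSq (ρ, φ) - a) * (polarSq (ρ, φ) - b))⁻¹ * (((ρ + N : ℝ) : ℂ))⁻¹ := by
      intro φ
      rw [normSq_polarSq (p := (ρ, φ)) hρ'.le, mul_inv]
    simp only [h3]
    rw [integral_mul_const, setIntegral_inv_mul_inv hab hρ' ha hb]
    ring
  rw [h2, integral_const_mul, integral_sub (integrableOn_cutoff hN _) (integrableOn_cutoff hN _),
    integral_cutoff hN (by positivity), integral_cutoff hN (by positivity)] at h
  refine mul_left_cancel₀ two_ne_zero (h.trans ?_)
  ring

/-! ### Removing the regulator -/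

/-- The result of the `σ`-integration of `legIntegrand`. -/
def regulated (β γ : ℂ) (ε : ℝ) (p : ℝ × ℂ) : ℂ :=
  (Ioo (0 : ℝ) 1).indicator (fun τ : ℝ => 2 * Real.pi * Complex.I /
    ((p.2 - β * τ) * (p.2 + γ * (1 - τ)) *
      (((‖p.2‖ ^ 2 + τ * (1 - τ) : ℝ) : ℂ) - Complex.I * ε))) p.1

theorem regulated_eq_zero {β γ : ℂ} {ε : ℝ} {p : ℝ × ℂ} (hp : p.1 ∉ Ioo (0 : ℝ) 1) :
    regulated β γ ε p = 0 := indicator_of_notMem hp _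

theorem regulated_of_mem {β γ : ℂ} {ε : ℝ} {p : ℝ × ℂ} (hp : p.1 ∈ Ioo (0 : ℝ) 1) :
    regulated β γ ε p = 2 * Real.pi * Complex.I /
    ((p.2 - β * p.1) * (p.2 + γ * (1 - p.1)) *
      (((‖p.2‖ ^ 2 + p.1 * (1 - p.1) : ℝ) : ℂ) - Complex.I * ε)) := indicator_of_mem hp _

theorem sing_half_mul_le (τ : ℝ) :
    sing (1 / 2) (τ * (1 - τ)) ≤
      ENNReal.ofReal 2 ^ (1 / 2 : ℝ) * (sing (1 / 2) τ + sing (1 / 2) (1 - τ)) := by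
  have key : ∀ x : ℝ, 1 / 2 ≤ x → sing (1 / 2) x ≤ ENNReal.ofReal 2 ^ (1 / 2 : ℝ) := by
    intro x hx
    refine (sing_le_mul (w := (1 : ℝ)) (by norm_num) two_pos ?_).trans (by simp [sing])
    rw [Real.norm_eq_abs, Real.norm_eq_abs, abs_one, abs_of_pos (by linarith)]
    linarith
  rw [sing_mul (by norm_num), mul_add]
  rcases le_total (1 / 2) τ with h | h
  · refine le_trans ?_ le_add_self
    exact mul_le_mul_left (key _ h) _
  · refine le_trans ?_ le_self_add
    rw [mul_comm]
    exact mul_le_mul_left (key _ (by linarith)) _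

/-- The bound is uniform in ε: on 0 < τ < 1 the real part N = |q|² + τ(1-τ) of the propagator factor
is positive. Half of its power is kept and half is estimated by N ≥ τ(1-τ), which produces the
majorant already integrated. -/
theorem enorm_regulated_le (β γ : ℂ) (ε : ℝ) (p : ℝ × ℂ) : ‖regulated β γ ε p‖ₑ ≤
    (‖(2 * Real.pi * Complex.I : ℂ)‖ₑ * ENNReal.ofReal 2 ^ (1 / 2 : ℝ)) *
      ((sing (1 / 2) p.1 + sing (1 / 2) (1 - p.1)) * loopWeight β γ p) := by
  by_cases hp : p.1 ∈ Ioo (0 : ℝ) 1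
  · have hN0 : 0 < p.1 * (1 - p.1) := mul_pos hp.1 (by linarith [hp.2])
    set N := ‖p.2‖ ^ 2 + p.1 * (1 - p.1) with hN
    have hNge : p.1 * (1 - p.1) ≤ N := by
      rw [hN]
      linarith [sq_nonneg ‖p.2‖]
    have h1 : sing 1 ((N : ℂ) - Complex.I * ε) ≤ sing (1 / 2) N * (ENNReal.ofReal 2 ^ (1 / 2 : ℝ) *
        (sing (1 / 2) p.1 + sing (1 / 2) (1 - p.1))) := by
      calc sing 1 ((N : ℂ) - Complex.I * ε) ≤ sing 1 N := by
            refine sing_anti zero_le_one ?_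
            simpa using Complex.abs_re_le_norm ((N : ℂ) - Complex.I * ε)
        _ = sing (1 / 2) N * sing (1 / 2) N := by
            rw [sing_mul_self (by norm_num) (by norm_num)]
            norm_num
        _ ≤ sing (1 / 2) N * sing (1 / 2) (p.1 * (1 - p.1)) := by
            refine mul_le_mul_right (sing_anti (by norm_num) ?_) _
            rw [Real.norm_of_nonneg hN0.le, Real.norm_of_nonneg (hN0.le.trans hNge)]
            exact hNge
        _ ≤ _ := mul_le_mul_right (sing_half_mul_le _) _
    rw [regulated_of_mem hp, div_eq_mul_inv, enorm_mul]
    simp only [← hN]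
    refine (mul_le_mul_right (enorm_inv_le_sing _) _).trans ?_
    rw [sing_mul zero_le_one, sing_mul zero_le_one]
    refine (mul_le_mul_right (mul_le_mul_right h1 _) _).trans (le_of_eq ?_)
    rw [loopWeight]
    simp only [← hN]
    ring
  · rw [regulated_eq_zero hp]
    simp

theorem exists_integrable_bound_regulated {β γ : ℂ} (hβ : β ≠ 0) (hγ : γ ≠ 0) (hβγ : β ≠ γ) :
    ∃ b : ℝ × ℂ → ℝ, Integrable b ∧ ∀ᵐ p, ∀ ε, ‖regulated β γ ε p‖ ≤ b p := by
  have hfin := lintegral_loopWeight_lt_top hβ hγ hβγ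
  set K := ‖(2 * Real.pi * Complex.I : ℂ)‖ₑ * ENNReal.ofReal 2 ^ (1 / 2 : ℝ) with hK
  have hK' : K ≠ ∞ := ENNReal.mul_ne_top enorm_ne_top
    (ENNReal.rpow_ne_top_of_nonneg (by norm_num) ENNReal.ofReal_ne_top)
  have hfin' : ∫⁻ p : ℝ × ℂ, K * ((sing (1 / 2) p.1 + sing (1 / 2) (1 - p.1)) *
      loopWeight β γ p) ≠ ∞ := by
    rw [lintegral_const_mul' _ _ hK']
    exact (ENNReal.mul_lt_top hK'.lt_top hfin).ne
  refine ⟨_, integrable_toReal_of_lintegral_ne_top (by fun_prop) hfin', ?_⟩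
  filter_upwards [ae_lt_top' (by fun_prop) hfin'] with p hp ε
  rw [← toReal_enorm]
  exact ENNReal.toReal_mono hp.ne (enorm_regulated_le β γ ε p)

theorem measurable_regulated (β γ : ℂ) (ε : ℝ) : Measurable (regulated β γ ε) := by
  have : regulated β γ ε = (Prod.fst ⁻¹' Ioo (0 : ℝ) 1).indicator (fun p : ℝ × ℂ =>
      2 * Real.pi * Complex.I / ((p.2 - β * p.1) * (p.2 + γ * (1 - p.1)) *
      (((‖p.2‖ ^ 2 + p.1 * (1 - p.1) : ℝ) : ℂ) - Complex.I * ε))) := by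
    ext p
    by_cases hp : p.1 ∈ Ioo (0 : ℝ) 1
    · rw [regulated_of_mem hp, indicator_of_mem (by exact hp)]
    · rw [regulated_eq_zero hp, indicator_of_notMem (by exact hp)]
  rw [this]
  exact Measurable.indicator (by fun_prop) (measurable_fst measurableSet_Ioo)

theorem integrable_regulated {β γ : ℂ} (hβ : β ≠ 0) (hγ : γ ≠ 0) (hβγ : β ≠ γ) (ε : ℝ) :
    Integrable (regulated β γ ε) := by
  obtain ⟨b, hb, h⟩ := exists_integrable_bound_regulated hβ hγ hβγ
  refine hb.mono' (measurable_regulated β γ ε).aestronglyMeasurable ?_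
  filter_upwards [h] with p hp using hp ε

theorem integral_legIntegrand_eq {β γ : ℂ} (hβ : β ≠ 0) (hγ : γ ≠ 0) (hβγ : β ≠ γ) {ε : ℝ}
    (hε : 0 < ε) : ∫ x, legIntegrand β γ ε x = ∫ p, regulated β γ ε p := by
  have hint := integrable_legIntegrand hβ hγ hβγ hε.ne'
  rw [Measure.volume_eq_prod] at hint ⊢
  rw [integral_prod _ hint]
  refine integral_congr_ae ?_
  filter_upwards [ae_fst_ne 0, ae_fst_ne 1, hint.prod_right_ae] with p h0 h1 hp
  exact integral_legIntegrand hε h0 h1 hp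

theorem tendsto_integral_regulated {β γ : ℂ} (hβ : β ≠ 0) (hγ : γ ≠ 0) (hβγ : β ≠ γ) :
    Tendsto (fun ε => ∫ p, regulated β γ ε p) (𝓝[>] 0) (𝓝 (∫ p, regulated β γ 0 p)) := by
  obtain ⟨b, hb, h⟩ := exists_integrable_bound_regulated hβ hγ hβγ
  refine tendsto_integral_filter_of_dominated_convergence b
    (Eventually.of_forall fun ε => (measurable_regulated β γ ε).aestronglyMeasurable)
    (Eventually.of_forall fun ε => ?_) hb (Eventually.of_forall fun p => ?_)
  · filter_upwards [h] with p hp using hp ε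
  · refine Tendsto.mono_left ?_ nhdsWithin_le_nhds
    by_cases hp : p.1 ∈ Ioo (0 : ℝ) 1
    · simp only [regulated_of_mem hp]
      have hN : 0 < ‖p.2‖ ^ 2 + p.1 * (1 - p.1) :=
        add_pos_of_nonneg_of_pos (sq_nonneg _) (mul_pos hp.1 (by linarith [hp.2]))
      simp only [div_eq_mul_inv, mul_inv]
      refine Tendsto.const_mul _ (Tendsto.const_mul _ ?_)
      refine Tendsto.inv₀ ?_ ?_
      · have : Continuous fun ε : ℝ => ((‖p.2‖ ^ 2 + p.1 * (1 - p.1) : ℝ) : ℂ) - Complex.I * ε := by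
          fun_prop
        exact this.tendsto 0
      · simp only [Complex.ofReal_zero, mul_zero, sub_zero]
        exact_mod_cast hN.ne'
    · simp only [regulated_eq_zero hp]
      exact tendsto_const_nhds

/-! ### Reduction to an integral over τ -/

/-- The one-dimensional integrand that is left of the loop integral. -/
def radialIntegrand (β γ : ℂ) (τ : ℝ) : ℂ :=
  (β * τ + γ * (1 - τ))⁻¹ *
    (γ / τ * Real.log (1 + ‖β‖ ^ 2 * τ / (1 - τ)) +
      β / (1 - τ) * Real.log (1 + ‖γ‖ ^ 2 * (1 - τ) / τ))

theorem ae_affine_ne {β γ : ℂ} (h : β ≠ γ) : ∀ᵐ τ : ℝ, β * τ + γ * (1 - τ) ≠ 0 := by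
  have hc : {τ : ℝ | β * τ + γ * (1 - τ) = 0}.Subsingleton := by
    intro s hs t ht
    have hs' : β * s + γ * (1 - s) = 0 := hs
    have ht' : β * t + γ * (1 - t) = 0 := ht
    have : (β - γ) * (s - t) = 0 := by linear_combination hs' - ht'
    rcases mul_eq_zero.1 this with h' | h'
    · exact absurd (sub_eq_zero.1 h') h
    · exact_mod_cast sub_eq_zero.1 h'
  filter_upwards [hc.countable.ae_notMem volume] with τ hτ using hτ

/-- The excluded τ are those where the two poles βτ and -γ(1-τ) coincide and partial fractions fail;
there is at most one. -/
theorem ae_integral_regulated {β γ : ℂ} (hβ : β ≠ 0) (hγ : γ ≠ 0) (hβγ : β ≠ γ) :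
    ∀ᵐ τ : ℝ, β * γ * ∫ q, regulated β γ 0 (τ, q) =
      (Ioo (0 : ℝ) 1).indicator (fun τ => -(2 * Complex.I * Real.pi ^ 2) * radialIntegrand β γ τ) τ := by
  have hint := integrable_regulated hβ hγ hβγ 0
  rw [Measure.volume_eq_prod] at hint
  filter_upwards [ae_affine_ne hβγ, hint.prod_right_ae] with τ hg hτint
  by_cases h : τ ∈ Ioo (0 : ℝ) 1
  · have h0 : 0 < τ := h.1
    have h1 : 0 < 1 - τ := by linarith [h.2]
    have h0c : (τ : ℂ) ≠ 0 := by exact_mod_cast h0.ne'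
    have h1c : (1 - τ : ℂ) ≠ 0 := by exact_mod_cast h1.ne'
    have hN : 0 < τ * (1 - τ) := mul_pos h0 h1
    have hform : ∀ q, regulated β γ 0 (τ, q) = 2 * Real.pi * Complex.I *
        ((q - β * τ) * (q - (-(γ * (1 - τ)))) * ((‖q‖ ^ 2 + τ * (1 - τ) : ℝ) : ℂ))⁻¹ := by
      intro q
      rw [regulated_of_mem h, div_eq_mul_inv]
      simp
    simp only [hform] at hτint ⊢
    have hpi : (2 * Real.pi * Complex.I : ℂ) ≠ 0 := by
      simp [Real.pi_ne_zero]
    rw [integrable_const_mul_iff (IsUnit.mk0 _ hpi)] at hτint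
    have hab : β * τ ≠ -(γ * (1 - τ)) := by
      intro h'
      apply hg
      rw [h']
      ring
    have e1 : ‖β * τ‖ ^ 2 / (τ * (1 - τ)) = ‖β‖ ^ 2 * τ / (1 - τ) := by
      rw [norm_mul, Complex.norm_real, Real.norm_of_nonneg h0.le]
      field_simp
    have e2 : ‖-(γ * (1 - τ : ℂ))‖ ^ 2 / (τ * (1 - τ)) = ‖γ‖ ^ 2 * (1 - τ) / τ := by
      rw [norm_neg, norm_mul, show (1 - τ : ℂ) = ((1 - τ : ℝ) : ℂ) by push_cast; rfl,
        Complex.norm_real, Real.norm_of_nonneg h1.le]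
      field_simp
    rw [integral_const_mul, integral_transverse hab hN hτint, e1, e2, indicator_of_mem h,
      radialIntegrand]
    rw [sub_neg_eq_add]
    field_simp
    ring
  · rw [indicator_of_notMem h]
    have : ∀ q, regulated β γ 0 (τ, q) = 0 := fun q => regulated_eq_zero h
    simp [this]

/-- No estimate of the logarithms is needed: up to a constant this is a Fubini marginal of an
integrable function. -/
theorem integrableOn_radialIntegrand {β γ : ℂ} (hβ : β ≠ 0) (hγ : γ ≠ 0) (hβγ : β ≠ γ) :
    IntegrableOn (radialIntegrand β γ) (Ioo 0 1) := by
  have hint := integrable_regulated hβ hγ hβγ 0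
  rw [Measure.volume_eq_prod] at hint
  have h1 := (hint.integral_prod_left.const_mul (β * γ)).congr (ae_integral_regulated hβ hγ hβγ)
  rw [integrable_indicator_iff measurableSet_Ioo] at h1
  have hpi : (-(2 * Complex.I * Real.pi ^ 2) : ℂ) ≠ 0 := by
    simp [Real.pi_ne_zero]
  exact (integrable_const_mul_iff (IsUnit.mk0 _ hpi) _).1 h1

/-- The limit `ε → 0` of the loop integral for one pair of legs, as a one-dimensional integral. -/
theorem tendsto_integral_legIntegrand {β γ : ℂ} (hβ : β ≠ 0) (hγ : γ ≠ 0) (hβγ : β ≠ γ) :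
    Tendsto (fun ε => 1 / (2 * Complex.I * Real.pi ^ 2) * (β * γ * ∫ x, legIntegrand β γ ε x))
      (𝓝[>] 0) (𝓝 (-∫ τ in Ioo 0 1, radialIntegrand β γ τ)) := by
  have hint := integrable_regulated hβ hγ hβγ 0
  have h1 : ∫ τ in Ioo 0 1, -(2 * Complex.I * Real.pi ^ 2) * radialIntegrand β γ τ =
      β * γ * ∫ p, regulated β γ 0 p := by
    rw [Measure.volume_eq_prod] at hint
    rw [← integral_indicator measurableSet_Ioo, ← integral_congr_ae (ae_integral_regulated hβ hγ hβγ),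
      integral_const_mul, Measure.volume_eq_prod, integral_prod _ hint]
  have hpi : (2 * Complex.I * Real.pi ^ 2 : ℂ) ≠ 0 := by
    simp [Real.pi_ne_zero]
  have h2 : -∫ τ in Ioo 0 1, radialIntegrand β γ τ =
      1 / (2 * Complex.I * Real.pi ^ 2) * (β * γ * ∫ p, regulated β γ 0 p) := by
    rw [← h1, integral_const_mul]
    field_simp
  rw [h2]
  refine ((tendsto_integral_regulated hβ hγ hβγ).const_mul _).const_mul _ |>.congr' ?_
  filter_upwards [self_mem_nhdsWithin] with ε hε
  rw [integral_legIntegrand_eq hβ hγ hβγ hε]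

/-! ### Möbius substitution and inversion on the half-line -/

section substitution

variable {E : Type*} [NormedAddCommGroup E] [NormedSpace ℝ E]

theorem image_moebius {c : ℝ} (hc : 0 < c) : (fun u : ℝ => u / (u + c)) '' Ioi 0 = Ioo 0 1 := by
  ext t
  constructor
  · rintro ⟨u, hu, rfl⟩
    have hu' : 0 < u := hu
    exact ⟨by positivity, (div_lt_one (by positivity)).2 (by linarith)⟩
  · rintro ⟨h0, h1⟩
    have h2 : 0 < 1 - t := by linarith
    refine ⟨c * t / (1 - t), by simp only [mem_Ioi]; positivity, ?_⟩
    simp only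
    rw [div_eq_iff (by positivity)]
    field_simp
    ring

theorem hasDerivAt_moebius {c u : ℝ} (hc : 0 < c) (hu : 0 < u) :
    HasDerivAt (fun u : ℝ => u / (u + c)) (c / (u + c) ^ 2) u := by
  have h := (hasDerivAt_id u).div ((hasDerivAt_id u).add_const c) (by simp only [id]; positivity)
  convert! h using 1
  simp only [id]
  ring

theorem injOn_moebius {c : ℝ} (hc : 0 < c) : InjOn (fun u : ℝ => u / (u + c)) (Ioi 0) := by
  intro a ha b hb h
  have ha' : 0 < a := ha
  have hb' : 0 < b := hb
  simp only at h
  rw [div_eq_div_iff (by positivity) (by positivity)] at h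
  have : c * (a - b) = 0 := by linarith
  rcases mul_eq_zero.1 this with h | h <;> linarith

theorem abs_deriv_moebius {c u : ℝ} (hc : 0 < c) : |c / (u + c) ^ 2| = c / (u + c) ^ 2 :=
  abs_of_nonneg (by positivity)

theorem integral_comp_moebius (f : ℝ → E) {c : ℝ} (hc : 0 < c) :
    ∫ τ in Ioo 0 1, f τ = ∫ u in Ioi (0 : ℝ), (c / (u + c) ^ 2) • f (u / (u + c)) := by
  rw [← image_moebius hc, integral_image_eq_integral_abs_deriv_smul measurableSet_Ioi
    (fun u hu => (hasDerivAt_moebius hc hu).hasDerivWithinAt) (injOn_moebius hc)]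
  simp only [abs_deriv_moebius hc]

theorem integrableOn_comp_moebius {f : ℝ → E} {c : ℝ} (hc : 0 < c)
    (hf : IntegrableOn f (Ioo 0 1)) :
    IntegrableOn (fun u => (c / (u + c) ^ 2) • f (u / (u + c))) (Ioi 0) := by
  rw [← image_moebius hc, integrableOn_image_iff_integrableOn_abs_deriv_smul measurableSet_Ioi
    (fun u hu => (hasDerivAt_moebius hc hu).hasDerivWithinAt) (injOn_moebius hc)] at hf
  simpa only [abs_deriv_moebius hc] using hf

theorem image_inversion {c : ℝ} (hc : 0 < c) : (fun u : ℝ => c / u) '' Ioi 0 = Ioi 0 := by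
  ext t
  constructor
  · rintro ⟨u, hu, rfl⟩
    exact div_pos hc hu
  · intro ht
    have ht' : 0 < t := ht
    exact ⟨c / t, div_pos hc ht', by simp only; field_simp⟩

theorem hasDerivAt_inversion {c u : ℝ} (hu : 0 < u) :
    HasDerivAt (fun u : ℝ => c / u) (-(c / u ^ 2)) u := by
  have h := (hasDerivAt_inv hu.ne').const_mul c
  convert! h using 1
  ring

theorem injOn_inversion {c : ℝ} (hc : 0 < c) : InjOn (fun u : ℝ => c / u) (Ioi 0) := by
  intro a ha b hb h
  have ha' : 0 < a := ha
  have hb' : 0 < b := hb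
  simp only at h
  rw [div_eq_div_iff (by positivity) (by positivity)] at h
  exact (mul_left_cancel₀ hc.ne' h).symm

theorem abs_deriv_inversion {c u : ℝ} (hc : 0 < c) : |-(c / u ^ 2)| = c / u ^ 2 := by
  rw [abs_neg]
  exact abs_of_nonneg (by positivity)

theorem integral_comp_inversion (f : ℝ → E) {c : ℝ} (hc : 0 < c) :
    ∫ u in Ioi (0 : ℝ), f u = ∫ u in Ioi (0 : ℝ), (c / u ^ 2) • f (c / u) := by
  conv_lhs => rw [← image_inversion hc]
  rw [integral_image_eq_integral_abs_deriv_smul measurableSet_Ioi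
    (fun u hu => (hasDerivAt_inversion hu).hasDerivWithinAt) (injOn_inversion hc)]
  simp only [abs_deriv_inversion hc]

theorem integrableOn_comp_inversion {f : ℝ → E} {c : ℝ} (hc : 0 < c)
    (hf : IntegrableOn f (Ioi 0)) : IntegrableOn (fun u => (c / u ^ 2) • f (c / u)) (Ioi 0) := by
  rw [← image_inversion hc, integrableOn_image_iff_integrableOn_abs_deriv_smul measurableSet_Ioi
    (fun u hu => (hasDerivAt_inversion hu).hasDerivWithinAt) (injOn_inversion hc)] at hf
  simpa only [abs_deriv_inversion hc] using hf

end substitution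

/-! ### Real part of the dilogarithm as an integral over the half-line -/

section dilog

/-- Near t = 0 the logarithm is O(t). Elsewhere 1/t is bounded, the imaginary part of the logarithm
is at most π, and the logarithm of the norm of a meromorphic function is integrable even if tz
passes through 1. -/
theorem integrableOn_dilog (z : ℂ) :
    IntegrableOn (fun t : ℝ => Complex.log (1 - t * z) / t) (Ioc 0 1) := by
  have hlog : IntegrableOn (fun t : ℝ => Real.log ‖1 - (t : ℂ) * z‖) (Ioc 0 1) := by
    have h : MeromorphicOn (fun t : ℝ => 1 - (t : ℂ) * z) (uIcc 0 1) := by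
      intro t _
      refine AnalyticAt.meromorphicAt ?_
      have : AnalyticAt ℝ (fun t : ℝ => (t : ℂ)) t := Complex.ofRealCLM.analyticAt t
      fun_prop
    have := h.intervalIntegrable_log_norm
    rwa [intervalIntegrable_iff_integrableOn_Ioc_of_le zero_le_one] at this
  set D := 2 * ‖z‖ + 1 with hD
  have hD0 : 0 < D := by positivity
  have hb : IntegrableOn (fun t : ℝ => 3 / 2 * ‖z‖ + D * (|Real.log ‖1 - (t : ℂ) * z‖| + Real.pi))
      (Ioc 0 1) :=
    (integrable_const _).add ((hlog.abs.add (integrable_const _)).const_mul D)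
  refine hb.mono' (Measurable.aestronglyMeasurable (by fun_prop)) ?_
  refine (ae_restrict_iff' measurableSet_Ioc).2 (Eventually.of_forall fun t ht => ?_)
  have ht0 : 0 < t := ht.1
  rw [norm_div, Complex.norm_real, Real.norm_of_nonneg ht0.le, div_le_iff₀ ht0]
  rcases le_total (‖z‖ * t) (1 / 2) with h | h
  · have h1 : ‖-(t * z : ℂ)‖ ≤ 1 / 2 := by
      rwa [norm_neg, norm_mul, Complex.norm_real, Real.norm_of_nonneg ht0.le, mul_comm]
    have h2 := Complex.norm_log_one_add_half_le_self h1
    rw [← sub_eq_add_neg, norm_neg, norm_mul, Complex.norm_real, Real.norm_of_nonneg ht0.le] at h2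
    have h3 : 0 ≤ D * (|Real.log ‖1 - (t : ℂ) * z‖| + Real.pi) * t := by
      have := Real.pi_pos
      positivity
    nlinarith
  · have h1 : 1 ≤ D * t := by
      rw [hD]
      nlinarith
    have h2 : ‖Complex.log (1 - t * z)‖ ≤ |Real.log ‖1 - (t : ℂ) * z‖| + Real.pi := by
      refine (Complex.norm_le_abs_re_add_abs_im _).trans ?_
      rw [Complex.log_re, Complex.log_im]
      gcongr
      exact Complex.abs_arg_le_pi _
    have h3 : 0 ≤ |Real.log ‖1 - (t : ℂ) * z‖| + Real.pi := by
      have := Real.pi_pos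
      positivity
    have h4 : 0 ≤ 3 / 2 * ‖z‖ * t := by positivity
    nlinarith

theorem re_dilog (z : ℂ) :
    (dilog z).re = -∫ t in Ioo (0 : ℝ) 1, Real.log ‖1 - (t : ℂ) * z‖ / t := by
  rw [dilog, intervalIntegral.integral_of_le zero_le_one, Complex.neg_re,
    ← integral_Ioc_eq_integral_Ioo]
  congr 1
  have h := integral_re (integrableOn_dilog z)
  simp only [RCLike.re_eq_complex_re] at h
  rw [← h]
  refine setIntegral_congr_fun measurableSet_Ioc fun t _ => ?_
  simp only [Complex.div_ofReal_re, Complex.log_re]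

theorem integrableOn_re_dilog (z : ℂ) :
    IntegrableOn (fun t : ℝ => Real.log ‖1 - (t : ℂ) * z‖ / t) (Ioo 0 1) := by
  have h := (integrableOn_dilog z).re.mono_measure (Measure.restrict_mono_set volume Ioo_subset_Ioc_self)
  simp only [RCLike.re_eq_complex_re, Complex.div_ofReal_re, Complex.log_re] at h
  exact h

end dilog

/-- The integrand of the real part of `dilog (1 - w) - dilog 1` on the half-line. -/
def logKernel (w : ℂ) (v : ℝ) : ℝ := Real.log ‖1 + w * v‖ / (v * (1 + v))

/-- With t = v/(1+v) one has 1 - t(1-w) = (1 + wv)/(1 + v). The denominator contributes a term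
independent of w. -/
theorem moebius_re_dilog (w : ℂ) {v : ℝ} (hv : 0 < v) (h : 1 + w * v ≠ 0) :
    (1 / (v + 1) ^ 2) • (Real.log ‖1 - ((v / (v + 1) : ℝ) : ℂ) * (1 - w)‖ / (v / (v + 1))) =
      logKernel w v - Real.log (1 + v) / (v * (1 + v)) := by
  have hv1 : 0 < v + 1 := by linarith
  have e : 1 - ((v / (v + 1) : ℝ) : ℂ) * (1 - w) = (1 + w * v) / ((v + 1 : ℝ) : ℂ) := by
    have : ((v : ℂ) + 1) ≠ 0 := by exact_mod_cast hv1.ne'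
    push_cast
    field_simp
    ring
  rw [e, norm_div, Complex.norm_real, Real.norm_of_nonneg hv1.le,
    Real.log_div (norm_ne_zero_iff.2 h) hv1.ne', logKernel, smul_eq_mul, add_comm 1 v]
  field_simp

theorem ae_one_add_mul_ne (w : ℂ) : ∀ᵐ v : ℝ, 1 + w * v ≠ 0 := by
  have hc : {v : ℝ | 1 + w * v = 0}.Subsingleton := by
    intro s hs t ht
    have hs' : 1 + w * s = 0 := hs
    have ht' : 1 + w * t = 0 := ht
    have : w * (s - t) = 0 := by linear_combination hs' - ht'
    rcases mul_eq_zero.1 this with h' | h'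
    · simp [h'] at hs'
    · exact_mod_cast sub_eq_zero.1 h'
  filter_upwards [hc.countable.ae_notMem volume] with τ hτ using hτ

theorem ae_moebius_re_dilog (w : ℂ) :
    (fun v : ℝ => (1 / (v + 1) ^ 2) • (Real.log ‖1 - ((v / (v + 1) : ℝ) : ℂ) * (1 - w)‖ /
      (v / (v + 1)))) =ᵐ[volume.restrict (Ioi 0)]
      fun v => logKernel w v - Real.log (1 + v) / (v * (1 + v)) := by
  refine (ae_restrict_iff' measurableSet_Ioi).2 ?_
  filter_upwards [ae_one_add_mul_ne w] with v h hv
  exact moebius_re_dilog w hv h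

/-- This is the case w = 0, where `logKernel` vanishes. -/
theorem integrableOn_log_one_add :
    IntegrableOn (fun v : ℝ => Real.log (1 + v) / (v * (1 + v))) (Ioi 0) := by
  have h := (integrableOn_comp_moebius one_pos (integrableOn_re_dilog (1 - 0))).congr
    (ae_moebius_re_dilog 0)
  refine (h.neg).congr (Eventually.of_forall fun v => ?_)
  simp [logKernel]

theorem integrableOn_logKernel (w : ℂ) : IntegrableOn (logKernel w) (Ioi 0) := by
  have h := (integrableOn_comp_moebius one_pos (integrableOn_re_dilog (1 - w))).congr
    (ae_moebius_re_dilog w)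
  refine (h.add integrableOn_log_one_add).congr (Eventually.of_forall fun v => ?_)
  simp

/-- The part independent of w is the real part of Li₂(1), by the case w = 0. -/
theorem re_dilog_sub_re_dilog_one (w : ℂ) :
    (dilog (1 - w)).re - (dilog 1).re = -∫ v in Ioi 0, logKernel w v := by
  have h : ∀ w, (dilog (1 - w)).re = -((∫ v in Ioi 0, logKernel w v) -
      ∫ v in Ioi (0 : ℝ), Real.log (1 + v) / (v * (1 + v))) := by
    intro w
    rw [re_dilog, integral_comp_moebius _ one_pos, integral_congr_ae (ae_moebius_re_dilog w),
      integral_sub (integrableOn_logKernel w) integrableOn_log_one_add]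
  have h1 := h 0
  have h0 : ∫ v in Ioi 0, logKernel 0 v = 0 := by simp [logKernel]
  rw [sub_zero, h0] at h1
  rw [h, h1]
  ring

/-! ### Evaluation of the one-dimensional integral -/

/-- The radial integrand after the substitution `u = |β|² τ / (1 - τ)`. -/
def stereoIntegrand (w : ℂ) (u : ℝ) : ℂ :=
  conj w / (u * (u + conj w)) * Real.log (1 + u) +
    (u + conj w)⁻¹ * Real.log (1 + ‖w‖ ^ 2 / u)

/-- In u the first logarithm becomes log(1 + u), the second log(1 + |βγ̄|²/u), and all other
dependence on β and γ collects into w = β γ̄. At the zero of u + w̄ both sides are 0 by the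
convention for inverses. -/
theorem moebius_radialIntegrand {β : ℂ} (γ : ℂ) (hβ : β ≠ 0) {u : ℝ} (hu : 0 < u) :
    (‖β‖ ^ 2 / (u + ‖β‖ ^ 2) ^ 2) • radialIntegrand β γ (u / (u + ‖β‖ ^ 2)) =
      stereoIntegrand (β * conj γ) u := by
  have hb : 0 < ‖β‖ := norm_pos_iff.2 hβ
  have hs : 0 < u + ‖β‖ ^ 2 := by positivity
  have hsc : (u : ℂ) + β * conj β ≠ 0 := by
    rw [Complex.mul_conj, Complex.normSq_eq_norm_sq]
    exact_mod_cast hs.ne'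
  have huc : (u : ℂ) ≠ 0 := by exact_mod_cast hu.ne'
  have hβc : conj β ≠ 0 := by simpa using hβ
  have e0 : 1 - u / (u + ‖β‖ ^ 2) = ‖β‖ ^ 2 / (u + ‖β‖ ^ 2) := by
    field_simp
    ring
  have e0c : 1 - ((u / (u + ‖β‖ ^ 2) : ℝ) : ℂ) = β * conj β / (u + β * conj β) := by
    rw [← Complex.ofReal_one, ← Complex.ofReal_sub, e0, Complex.mul_conj,
      Complex.normSq_eq_norm_sq]
    push_cast
    rfl
  have e0d : ((u / (u + ‖β‖ ^ 2) : ℝ) : ℂ) = u / (u + β * conj β) := by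
    rw [Complex.mul_conj, Complex.normSq_eq_norm_sq]
    push_cast
    rfl
  have e1 : ‖β‖ ^ 2 * (u / (u + ‖β‖ ^ 2)) / (1 - u / (u + ‖β‖ ^ 2)) = u := by
    rw [e0]
    field_simp
  have e2 : ‖γ‖ ^ 2 * (1 - u / (u + ‖β‖ ^ 2)) / (u / (u + ‖β‖ ^ 2)) = ‖β * conj γ‖ ^ 2 / u := by
    rw [e0, norm_mul, RCLike.norm_conj]
    field_simp
  have e3 : ((‖β‖ ^ 2 / (u + ‖β‖ ^ 2) ^ 2 : ℝ) : ℂ) = β * conj β / (u + β * conj β) ^ 2 := by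
    rw [Complex.mul_conj, Complex.normSq_eq_norm_sq]
    push_cast
    rfl
  rw [Complex.real_smul, radialIntegrand, e1, e2, e0c, e0d, e3, stereoIntegrand]
  simp only [map_mul, Complex.conj_conj]
  have e4 : β * (u / (u + β * conj β)) + γ * (β * conj β / (u + β * conj β)) =
      β * (u + conj β * γ) / (u + β * conj β) := by
    field_simp
  rw [e4]
  rcases eq_or_ne ((u : ℂ) + conj β * γ) 0 with h | h
  · simp [h]
  · field_simp

theorem integrableOn_stereoIntegrand {β γ : ℂ} (hβ : β ≠ 0) (hγ : γ ≠ 0) (hβγ : β ≠ γ) :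
    IntegrableOn (stereoIntegrand (β * conj γ)) (Ioi 0) := by
  have hb : 0 < ‖β‖ ^ 2 := by have := norm_pos_iff.2 hβ; positivity
  refine (integrableOn_comp_moebius hb (integrableOn_radialIntegrand hβ hγ hβγ)).congr_fun
    (fun u hu => ?_) measurableSet_Ioi
  exact moebius_radialIntegrand γ hβ hu

theorem integral_radialIntegrand {β : ℂ} (γ : ℂ) (hβ : β ≠ 0) :
    ∫ τ in Ioo 0 1, radialIntegrand β γ τ = ∫ u in Ioi 0, stereoIntegrand (β * conj γ) u := by
  have hb : 0 < ‖β‖ ^ 2 := by have := norm_pos_iff.2 hβ; positivity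
  rw [integral_comp_moebius _ hb]
  exact setIntegral_congr_fun measurableSet_Ioi fun u hu => moebius_radialIntegrand γ hβ hu

theorem inversion_stereoIntegrand {w : ℂ} (hw : w ≠ 0) {u : ℝ} (hu : 0 < u) :
    (‖w‖ ^ 2 / u ^ 2) • stereoIntegrand w (‖w‖ ^ 2 / u) = conj (stereoIntegrand w u) := by
  have hw' : 0 < ‖w‖ := norm_pos_iff.2 hw
  have huc : (u : ℂ) ≠ 0 := by exact_mod_cast hu.ne'
  have hwc : conj w ≠ 0 := by simpa using hw
  have e1 : ‖w‖ ^ 2 / (‖w‖ ^ 2 / u) = u := by field_simp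
  have e2 : ((‖w‖ ^ 2 / u : ℝ) : ℂ) = w * conj w / u := by
    rw [Complex.mul_conj, Complex.normSq_eq_norm_sq]
    push_cast
    rfl
  have e3 : ((‖w‖ ^ 2 / u ^ 2 : ℝ) : ℂ) = w * conj w / u ^ 2 := by
    rw [Complex.mul_conj, Complex.normSq_eq_norm_sq]
    push_cast
    rfl
  rw [Complex.real_smul, stereoIntegrand, stereoIntegrand, e1, e2, e3]
  simp only [map_add, map_mul, map_div₀, map_inv₀, Complex.conj_conj, Complex.conj_ofReal]
  have e4 : w * conj w / u + conj w = conj w * (u + w) / u := by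
    field_simp
    ring
  rw [e4]
  rcases eq_or_ne ((u : ℂ) + w) 0 with h | h
  · simp [h]
  · field_simp
    ring

/-- The inversion u ↦ |w|²/u exchanges the two logarithms and conjugates the integrand, so only its
real part has to be integrated. -/
theorem conj_integral_stereoIntegrand {w : ℂ} (hw : w ≠ 0) :
    conj (∫ u in Ioi 0, stereoIntegrand w u) = ∫ u in Ioi 0, stereoIntegrand w u := by
  have hw' : 0 < ‖w‖ ^ 2 := by have := norm_pos_iff.2 hw; positivity
  rw [← integral_conj, integral_comp_inversion (stereoIntegrand w) hw']
  exact (setIntegral_congr_fun measurableSet_Ioi fun u hu => inversion_stereoIntegrand hw hu).symm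

/-- An antiderivative that relates `stereoIntegrand` to `logKernel`. -/
def stereoPrimitive (w : ℂ) (u : ℝ) : ℝ :=
  Real.log (1 + u) * (Real.log u - Real.log ‖(u : ℂ) + w‖) +
    Real.log (1 + ‖w‖ ^ 2 / u) * (Real.log ‖(u : ℂ) + w‖ - Real.log ‖w‖)

/-- `logKernel` after `v = 1 / u`. -/
def invLogKernel (w : ℂ) (u : ℝ) : ℝ := (1 / u ^ 2) • logKernel w (1 / u)

theorem invLogKernel_eq {w : ℂ} {u : ℝ} (hu : 0 < u) (h : (u : ℂ) + w ≠ 0) :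
    invLogKernel w u = (Real.log ‖(u : ℂ) + w‖ - Real.log u) / (1 + u) := by
  have huc : (u : ℂ) ≠ 0 := by exact_mod_cast hu.ne'
  have e : 1 + w * ((1 / u : ℝ) : ℂ) = (u + w) / u := by
    push_cast
    field_simp
  rw [invLogKernel, logKernel, e, norm_div, Complex.norm_real, Real.norm_of_nonneg hu.le,
    Real.log_div (norm_ne_zero_iff.2 h) hu.ne', smul_eq_mul]
  field_simp
  ring

theorem norm_inversion_add {w : ℂ} {u : ℝ} (hu : 0 < u) :
    ‖((‖w‖ ^ 2 / u : ℝ) : ℂ) + w‖ = ‖w‖ * ‖(u : ℂ) + w‖ / u := by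
  have huc : (u : ℂ) ≠ 0 := by exact_mod_cast hu.ne'
  have e : ((‖w‖ ^ 2 / u : ℝ) : ℂ) + w = w * conj ((u : ℂ) + w) / u := by
    rw [map_add, Complex.conj_ofReal, mul_add, Complex.mul_conj, Complex.normSq_eq_norm_sq]
    push_cast
    field_simp
    ring
  rw [e, norm_div, norm_mul, RCLike.norm_conj, Complex.norm_real, Real.norm_of_nonneg hu.le]

theorem inversion_invLogKernel_eq {w : ℂ} (hw : w ≠ 0) {u : ℝ} (hu : 0 < u) (h : (u : ℂ) + w ≠ 0) :
    (‖w‖ ^ 2 / u ^ 2) • invLogKernel w (‖w‖ ^ 2 / u) =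
      ‖w‖ ^ 2 / (u * (u + ‖w‖ ^ 2)) * (Real.log ‖(u : ℂ) + w‖ - Real.log ‖w‖) := by
  have hw' : 0 < ‖w‖ := norm_pos_iff.2 hw
  have hn := norm_inversion_add (w := w) hu
  have hp : 0 < ‖(u : ℂ) + w‖ := norm_pos_iff.2 h
  have h2 : ((‖w‖ ^ 2 / u : ℝ) : ℂ) + w ≠ 0 := by
    rw [← norm_pos_iff, hn]
    positivity
  rw [invLogKernel_eq (by positivity) h2, hn, Real.log_div (by positivity) hu.ne',
    Real.log_mul hw'.ne' hp.ne', Real.log_div (by positivity) hu.ne', Real.log_pow, smul_eq_mul]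
  have : 1 + ‖w‖ ^ 2 / u = (u + ‖w‖ ^ 2) / u := by field_simp
  rw [this]
  push_cast
  field_simp
  ring

theorem stereoPrimitive_inversion {w : ℂ} (hw : w ≠ 0) {u : ℝ} (hu : 0 < u) (h : (u : ℂ) + w ≠ 0) :
    stereoPrimitive w (‖w‖ ^ 2 / u) = -stereoPrimitive w u := by
  have hw' : 0 < ‖w‖ := norm_pos_iff.2 hw
  have hp : 0 < ‖(u : ℂ) + w‖ := norm_pos_iff.2 h
  have e1 : ‖w‖ ^ 2 / (‖w‖ ^ 2 / u) = u := by field_simp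
  rw [stereoPrimitive, stereoPrimitive, e1, norm_inversion_add hu,
    Real.log_div (by positivity) hu.ne', Real.log_div (by positivity) hu.ne',
    Real.log_mul hw'.ne' hp.ne', Real.log_pow]
  push_cast
  ring

theorem hasDerivAt_log_norm_add {w : ℂ} {u : ℝ} (h : (u : ℂ) + w ≠ 0) :
    HasDerivAt (fun u : ℝ => Real.log ‖(u : ℂ) + w‖) ((u + w)⁻¹ : ℂ).re u := by
  have e : ∀ u : ℝ, Real.log ‖(u : ℂ) + w‖ = Real.log ((u + w.re) ^ 2 + w.im ^ 2) / 2 := by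
    intro u
    have : (u + w.re) ^ 2 + w.im ^ 2 = ‖(u : ℂ) + w‖ ^ 2 := by
      rw [Complex.sq_norm, Complex.normSq_apply]
      simp
      ring
    rw [this, Real.log_pow]
    push_cast
    ring
  have hN : (u + w.re) ^ 2 + w.im ^ 2 ≠ 0 := by
    intro h0
    apply h
    have h1 : u + w.re = 0 := by nlinarith [sq_nonneg (u + w.re), sq_nonneg w.im]
    have h2 : w.im = 0 := by nlinarith [sq_nonneg (u + w.re), sq_nonneg w.im]
    exact Complex.ext (by simpa using h1) (by simpa using h2)
  have hd : HasDerivAt (fun u : ℝ => (u + w.re) ^ 2 + w.im ^ 2) (2 * (u + w.re)) u := by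
    have := (((hasDerivAt_id u).add_const w.re).pow 2).add_const (w.im ^ 2)
    simpa using this
  simp_rw [e]
  convert! (hd.log hN).div_const 2 using 1
  rw [Complex.inv_re, Complex.normSq_apply]
  simp only [Complex.add_re, Complex.ofReal_re, Complex.add_im, Complex.ofReal_im, zero_add]
  have hN' : (u + w.re) * (u + w.re) + w.im * w.im ≠ 0 := by
    rwa [pow_two, pow_two] at hN
  field_simp

theorem hasDerivAt_log_one_add {u : ℝ} (hu : 0 < u) :
    HasDerivAt (fun u : ℝ => Real.log (1 + u)) (1 / (1 + u)) u := by
  have := ((hasDerivAt_id u).const_add 1).log (by simp only [id]; positivity)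
  simpa using this

theorem hasDerivAt_log_one_add_div {c u : ℝ} (hc : 0 < c) (hu : 0 < u) :
    HasDerivAt (fun u : ℝ => Real.log (1 + c / u)) (-(c / (u * (u + c)))) u := by
  have := ((hasDerivAt_inversion (c := c) hu).const_add 1).log (by positivity)
  convert! this using 1
  field_simp

theorem re_stereoIntegrand {w : ℂ} {u : ℝ} (hu : 0 < u) (h : (u : ℂ) + w ≠ 0) :
    (stereoIntegrand w u).re = (1 / u - ((u + w)⁻¹ : ℂ).re) * Real.log (1 + u) +
      ((u + w)⁻¹ : ℂ).re * Real.log (1 + ‖w‖ ^ 2 / u) := by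
  have huc : (u : ℂ) ≠ 0 := by exact_mod_cast hu.ne'
  have hc : (u : ℂ) + conj w ≠ 0 := by
    intro h0
    apply h
    have := congrArg conj h0
    simpa using this
  have e1 : ((u : ℂ) + conj w)⁻¹.re = ((u : ℂ) + w)⁻¹.re := by
    rw [← Complex.conj_re (((u : ℂ) + w)⁻¹)]
    simp
  have e2 : conj w / (u * (u + conj w)) = ((1 / u : ℝ) : ℂ) - ((u : ℂ) + conj w)⁻¹ := by
    push_cast
    field_simp
    ring
  rw [stereoIntegrand, e2, Complex.add_re, Complex.re_mul_ofReal, Complex.re_mul_ofReal,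
    Complex.sub_re, e1, Complex.ofReal_re]

/-- Differentiating the logarithms 1 + u and 1 + |w|²/u produces `invLogKernel` and its image under
inversion; differentiating the other factors produces the real part of `stereoIntegrand`. Up to the
boundary terms the integral is thus twice that of `logKernel`. -/
theorem hasDerivAt_stereoPrimitive {w : ℂ} (hw : w ≠ 0) {u : ℝ} (hu : 0 < u)
    (h : (u : ℂ) + w ≠ 0) : HasDerivAt (stereoPrimitive w)
      ((stereoIntegrand w u).re - invLogKernel w u -
        (‖w‖ ^ 2 / u ^ 2) • invLogKernel w (‖w‖ ^ 2 / u)) u := by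
  have hw' : 0 < ‖w‖ ^ 2 := by have := norm_pos_iff.2 hw; positivity
  have hL := hasDerivAt_log_norm_add h
  have h1 := (hasDerivAt_log_one_add hu).mul ((Real.hasDerivAt_log hu.ne').sub hL)
  have h2 := (hasDerivAt_log_one_add_div hw' hu).mul (hL.sub_const (Real.log ‖w‖))
  refine (h1.add h2).congr_deriv ?_
  rw [re_stereoIntegrand hu h, invLogKernel_eq hu h, inversion_invLogKernel_eq hw hu h]
  simp only [Pi.sub_apply]
  field_simp
  ring

theorem continuousAt_log_abs_mul {K : ℝ → ℝ} {c : ℝ} (hK : DifferentiableAt ℝ K c) (h0 : K c = 0) :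
    ContinuousAt (fun u => Real.log |u - c| * K u) c := by
  have e : (fun u => Real.log |u - c| * K u) =
      fun u => ((u - c) * Real.log (u - c)) * dslope K c u := by
    ext u
    have := sub_smul_dslope K c u
    rw [h0, sub_zero, smul_eq_mul] at this
    rw [← this, Real.log_abs]
    ring
  rw [e]
  refine ContinuousAt.mul ?_ (continuousAt_dslope_same.2 hK)
  exact (Real.continuous_mul_log.comp (continuous_id.sub continuous_const)).continuousAt

/-- If w is real and negative, log|u + w| is singular at u = |w|. Its coefficient log(1 + |w|²/u) -
log(1 + u) vanishes exactly there, and x log x is continuous. -/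
theorem continuousAt_stereoPrimitive {w : ℂ} (hw : w ≠ 0) {u : ℝ} (hu : 0 < u) :
    ContinuousAt (stereoPrimitive w) u := by
  have hw' : 0 < ‖w‖ ^ 2 := by have := norm_pos_iff.2 hw; positivity
  by_cases h : (u : ℂ) + w = 0
  · have hwu : w = -(u : ℂ) := by linear_combination h
    have hn : ‖w‖ = u := by rw [hwu, norm_neg, Complex.norm_real, Real.norm_of_nonneg hu.le]
    have hL : ∀ v : ℝ, ‖(v : ℂ) + w‖ = |v - u| := by
      intro v
      rw [hwu, ← sub_eq_add_neg, ← Complex.ofReal_sub, Complex.norm_real, Real.norm_eq_abs]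
    have e : stereoPrimitive w = fun v => (Real.log (1 + v) * Real.log v -
        Real.log (1 + ‖w‖ ^ 2 / v) * Real.log ‖w‖) +
        Real.log |v - u| * (Real.log (1 + ‖w‖ ^ 2 / v) - Real.log (1 + v)) := by
      ext v
      rw [stereoPrimitive, hL]
      ring
    rw [e]
    have d1 := hasDerivAt_log_one_add hu
    have d2 := hasDerivAt_log_one_add_div hw' hu
    refine ContinuousAt.add ((d1.continuousAt.mul (Real.continuousAt_log hu.ne')).sub
      (d2.continuousAt.mul continuousAt_const)) ?_
    refine continuousAt_log_abs_mul (d2.sub d1).differentiableAt ?_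
    simp only [hn]
    rw [pow_two, mul_div_assoc, div_self hu.ne', mul_one, sub_self]
  · exact (hasDerivAt_stereoPrimitive hw hu h).continuousAt

theorem tendsto_log_one_add_mul_div {c : ℝ} (hc : 0 < c) :
    Tendsto (fun u : ℝ => Real.log (1 + c * u) / u) atTop (𝓝 0) := by
  have h1 : Tendsto (fun u : ℝ => 1 + c * u) atTop atTop :=
    tendsto_atTop_add_const_left _ _ (tendsto_id.const_mul_atTop hc)
  have h2 := (Real.isLittleO_log_id_atTop.tendsto_div_nhds_zero).comp h1
  have h3 : Tendsto (fun u : ℝ => u⁻¹ + c) atTop (𝓝 (0 + c)) := tendsto_inv_atTop_zero.add_const c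
  have h4 := h2.mul h3
  rw [zero_mul] at h4
  refine h4.congr' ?_
  filter_upwards [eventually_gt_atTop 0] with u hu
  simp only [Function.comp, id]
  field_simp

theorem abs_log_norm_one_add_le {z : ℂ} (hz : ‖z‖ ≤ 1 / 2) :
    |Real.log ‖1 + z‖| ≤ 3 / 2 * ‖z‖ := by
  rw [← Complex.log_re]
  exact (Complex.abs_re_le_norm _).trans (Complex.norm_log_one_add_half_le_self hz)

/-- In each product one factor is O(1/u) and the other grows at most like log u. -/
theorem tendsto_stereoPrimitive_atTop {w : ℂ} (hw : w ≠ 0) :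
    Tendsto (stereoPrimitive w) atTop (𝓝 0) := by
  have hw' : 0 < ‖w‖ := norm_pos_iff.2 hw
  have hb : Tendsto (fun u : ℝ => (3 / 2 * ‖w‖) * (Real.log (1 + 1 * u) / u) +
      ‖w‖ ^ 2 * (Real.log (1 + ‖w‖⁻¹ * u) / u)) atTop (𝓝 0) := by
    have := ((tendsto_log_one_add_mul_div one_pos).const_mul (3 / 2 * ‖w‖)).add
      ((tendsto_log_one_add_mul_div (inv_pos.2 hw')).const_mul (‖w‖ ^ 2))
    simpa using this
  refine squeeze_zero_norm' ?_ hb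
  filter_upwards [eventually_gt_atTop (2 * ‖w‖)] with u hu
  have hu0 : 0 < u := by linarith
  have huc : (u : ℂ) ≠ 0 := by exact_mod_cast hu0.ne'
  have hnu : ‖(u : ℂ)‖ = u := by rw [Complex.norm_real, Real.norm_of_nonneg hu0.le]
  have hge : ‖w‖ ≤ ‖(u : ℂ) + w‖ := by
    have := norm_sub_le ((u : ℂ) + w) w
    rw [add_sub_cancel_right, hnu] at this
    linarith
  have hle : ‖(u : ℂ) + w‖ ≤ u + ‖w‖ := by
    have := norm_add_le (u : ℂ) w
    rwa [hnu] at this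
  have hp : 0 < ‖(u : ℂ) + w‖ := hw'.trans_le hge
  have hz : ‖w / u‖ ≤ 1 / 2 := by
    rw [norm_div, hnu, div_le_iff₀ hu0]
    linarith
  have e1 : Real.log u - Real.log ‖(u : ℂ) + w‖ = -Real.log ‖1 + w / u‖ := by
    have : 1 + w / u = (u + w) / u := by field_simp
    rw [this, norm_div, hnu, Real.log_div hp.ne' hu0.ne']
    ring
  have b1 : |Real.log (1 + u) * (Real.log u - Real.log ‖(u : ℂ) + w‖)| ≤
      (3 / 2 * ‖w‖) * (Real.log (1 + 1 * u) / u) := by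
    have h0 : 0 ≤ Real.log (1 + u) := Real.log_nonneg (by linarith)
    rw [e1, abs_mul, abs_neg, abs_of_nonneg h0, one_mul]
    calc _ ≤ Real.log (1 + u) * (3 / 2 * ‖w / u‖) := by
          gcongr
          exact abs_log_norm_one_add_le hz
      _ = _ := by
          rw [norm_div, hnu]
          ring
  have b2 : |Real.log (1 + ‖w‖ ^ 2 / u) * (Real.log ‖(u : ℂ) + w‖ - Real.log ‖w‖)| ≤
      ‖w‖ ^ 2 * (Real.log (1 + ‖w‖⁻¹ * u) / u) := by
    have h0 : 0 ≤ Real.log (1 + ‖w‖ ^ 2 / u) :=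
      Real.log_nonneg (by have : 0 ≤ ‖w‖ ^ 2 / u := by positivity
                          linarith)
    have h1 : Real.log (1 + ‖w‖ ^ 2 / u) ≤ ‖w‖ ^ 2 / u := by
      have := Real.log_le_sub_one_of_pos (x := 1 + ‖w‖ ^ 2 / u) (by positivity)
      linarith
    have h2 : 0 ≤ Real.log ‖(u : ℂ) + w‖ - Real.log ‖w‖ :=
      sub_nonneg.2 (Real.log_le_log hw' hge)
    have h3 : Real.log ‖(u : ℂ) + w‖ - Real.log ‖w‖ ≤ Real.log (1 + ‖w‖⁻¹ * u) := by
      rw [← Real.log_div hp.ne' hw'.ne']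
      refine Real.log_le_log (by positivity) ?_
      rw [div_le_iff₀ hw']
      have : (1 + ‖w‖⁻¹ * u) * ‖w‖ = u + ‖w‖ := by field_simp; ring
      linarith
    rw [abs_of_nonneg (mul_nonneg h0 h2)]
    calc _ ≤ ‖w‖ ^ 2 / u * Real.log (1 + ‖w‖⁻¹ * u) := mul_le_mul h1 h3 h2 (by positivity)
      _ = _ := by ring
  rw [Real.norm_eq_abs, stereoPrimitive]
  exact (abs_add_le _ _).trans (add_le_add b1 b2)

/-- The primitive is odd under u ↦ |w|²/u, which carries 0 to ∞. -/
theorem tendsto_stereoPrimitive_zero {w : ℂ} (hw : w ≠ 0) :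
    Tendsto (stereoPrimitive w) (𝓝[>] 0) (𝓝 0) := by
  have hw' : 0 < ‖w‖ := norm_pos_iff.2 hw
  have h1 : Tendsto (fun u : ℝ => ‖w‖ ^ 2 / u) (𝓝[>] 0) atTop := by
    simp only [div_eq_mul_inv]
    exact tendsto_inv_nhdsGT_zero.const_mul_atTop (by positivity)
  have h2 := ((tendsto_stereoPrimitive_atTop hw).comp h1).neg
  rw [neg_zero] at h2
  refine h2.congr' ?_
  filter_upwards [Ioo_mem_nhdsGT hw'] with u hu
  have h : (u : ℂ) + w ≠ 0 := by
    intro h0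
    have : w = -(u : ℂ) := by linear_combination h0
    have hn : ‖w‖ = u := by rw [this, norm_neg, Complex.norm_real, Real.norm_of_nonneg hu.1.le]
    exact absurd hn hu.2.ne'
  simp only [Function.comp]
  rw [stereoPrimitive_inversion hw hu.1 h, neg_neg]

theorem integrableOn_invLogKernel (w : ℂ) : IntegrableOn (invLogKernel w) (Ioi 0) :=
  integrableOn_comp_inversion one_pos (integrableOn_logKernel w)

theorem integral_invLogKernel (w : ℂ) :
    ∫ u in Ioi 0, invLogKernel w u = ∫ v in Ioi 0, logKernel w v :=
  (integral_comp_inversion (logKernel w) one_pos).symm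

theorem integral_re_stereoIntegrand {w : ℂ} (hw : w ≠ 0)
    (hint : IntegrableOn (stereoIntegrand w) (Ioi 0)) :
    ∫ u in Ioi 0, (stereoIntegrand w u).re = 2 * ∫ v in Ioi 0, logKernel w v := by
  have hw' : 0 < ‖w‖ ^ 2 := by have := norm_pos_iff.2 hw; positivity
  have i1 : IntegrableOn (fun u => (stereoIntegrand w u).re) (Ioi 0) := hint.re
  have i2 := integrableOn_invLogKernel w
  have i3 := integrableOn_comp_inversion hw' i2
  have i12 : IntegrableOn (fun u => (stereoIntegrand w u).re - invLogKernel w u) (Ioi 0) :=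
    i1.sub i2
  have i4 := i12.sub i3
  have hs : {u : ℝ | (u : ℂ) + w = 0}.Countable := by
    refine Subsingleton.countable ?_
    intro s hs t ht
    have hs' : (s : ℂ) + w = 0 := hs
    have ht' : (t : ℂ) + w = 0 := ht
    have : (s : ℂ) = t := by linear_combination hs' - ht'
    exact_mod_cast this
  have h0 : stereoPrimitive w 0 = 0 := by simp [stereoPrimitive]
  have hcont : ContinuousOn (stereoPrimitive w) (Ici 0) := by
    intro u hu
    rcases (mem_Ici.1 hu).eq_or_lt with rfl | hu
    · rw [← continuousWithinAt_Ioi_iff_Ici, ContinuousWithinAt, h0]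
      exact tendsto_stereoPrimitive_zero hw
    · exact (continuousAt_stereoPrimitive hw hu).continuousWithinAt
  have hftc : ∀ X : ℝ, 0 ≤ X → ∫ u in (0 : ℝ)..X, ((stereoIntegrand w u).re - invLogKernel w u -
      (‖w‖ ^ 2 / u ^ 2) • invLogKernel w (‖w‖ ^ 2 / u)) = stereoPrimitive w X := by
    intro X hX
    -- At u = -w the primitive may fail to be differentiable; continuity suffices on this set of at
    -- most one point.
    rw [integral_eq_of_hasDerivAt_off_countable_of_le (stereoPrimitive w) _ hX hs
      (hcont.mono Icc_subset_Ici_self)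
      (fun u hu => hasDerivAt_stereoPrimitive hw hu.1.1 hu.2) ?_, h0, sub_zero]
    rw [intervalIntegrable_iff_integrableOn_Ioc_of_le hX]
    exact i4.mono_set Ioc_subset_Ioi_self
  have hlim := intervalIntegral_tendsto_integral_Ioi 0 i4 tendsto_id
  have hlim2 : Tendsto (fun X : ℝ => ∫ u in (0 : ℝ)..id X, ((fun u => (stereoIntegrand w u).re -
      invLogKernel w u) - fun u => (‖w‖ ^ 2 / u ^ 2) • invLogKernel w (‖w‖ ^ 2 / u)) u) atTop (𝓝 0) := by
    refine (tendsto_stereoPrimitive_atTop hw).congr' ?_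
    filter_upwards [eventually_ge_atTop 0] with X hX
    exact (hftc X hX).symm
  have h := tendsto_nhds_unique hlim hlim2
  simp only [Pi.sub_apply] at h
  rw [integral_sub i12 i3, integral_sub i1 i2, ← integral_comp_inversion _ hw',
    integral_invLogKernel] at h
  linarith

/-- The value of the one-dimensional integral in terms of dilogarithms. -/
theorem neg_integral_radialIntegrand {β γ : ℂ} (hβ : β ≠ 0) (hγ : γ ≠ 0) (hβγ : β ≠ γ) :
    -∫ τ in Ioo 0 1, radialIntegrand β γ τ =
      ((2 * ((dilog (1 - β * conj γ)).re - (dilog 1).re) : ℝ) : ℂ) := by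
  have hw : β * conj γ ≠ 0 := mul_ne_zero hβ (by simpa using hγ)
  have hint := integrableOn_stereoIntegrand hβ hγ hβγ
  have h1 := integral_re_stereoIntegrand hw hint
  have h2 := integral_re hint
  simp only [RCLike.re_eq_complex_re] at h2
  rw [re_dilog_sub_re_dilog_one, integral_radialIntegrand γ hβ,
    ← Complex.conj_eq_iff_re.1 (conj_integral_stereoIntegrand hw), ← h2, h1]
  push_cast
  ring

/-! ### Change of variables in Minkowski space -/

/-- Collects four real coordinates `(τ, Re q, Im q, σ)` into `((τ, q), σ)`. -/
def packCoords (v : Fin 4 → ℝ) : (ℝ × ℂ) × ℝ := ((v 0, ⟨v 1, v 2⟩), v 3)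

theorem measurePreserving_packCoords : MeasurePreserving packCoords := by
  have h1 := volume_preserving_piFinSuccAbove (fun _ : Fin 4 => ℝ) 3
  have h2 := volume_preserving_piFinSuccAbove (fun _ : Fin 3 => ℝ) 0
  have h3 := Complex.volume_preserving_equiv_pi.symm
  have h4 : MeasurePreserving (fun p : ℝ × (Fin 2 → ℝ) =>
      (p.1, Complex.measurableEquivPi.symm p.2)) := (MeasurePreserving.id volume).prod h3
  have h5 : MeasurePreserving (fun p : ℝ × (Fin 3 → ℝ) => (p.1,
      (fun p : ℝ × (Fin 2 → ℝ) => (p.1, Complex.measurableEquivPi.symm p.2))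
        (MeasurableEquiv.piFinSuccAbove (fun _ : Fin 3 => ℝ) 0 p.2))) :=
    (MeasurePreserving.id volume).prod (h4.comp h2)
  have h6 : MeasurePreserving (Prod.swap : ℝ × (ℝ × ℂ) → (ℝ × ℂ) × ℝ) :=
    Measure.measurePreserving_swap
  have h7 := h6.comp (h5.comp h1)
  have e : packCoords = Prod.swap ∘ (fun p : ℝ × (Fin 3 → ℝ) => (p.1,
      (fun p : ℝ × (Fin 2 → ℝ) => (p.1, Complex.measurableEquivPi.symm p.2))
        (MeasurableEquiv.piFinSuccAbove (fun _ : Fin 3 => ℝ) 0 p.2))) ∘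
      (MeasurableEquiv.piFinSuccAbove (fun _ : Fin 4 => ℝ) 3) := by
    ext v
    · rfl
    · simp only [packCoords, Complex.measurableEquivPi]
      refine Complex.ext ?_ ?_ <;> simp <;> rfl
    · rfl
  rwa [← e] at h7

/-- The polar form of the Minkowski square. -/
theorem sq_basis_polar (a b : Fin 4) :
    sq (Pi.single a 1 + Pi.single b 1) - sq (Pi.single a 1) - sq (Pi.single b 1) =
      Matrix.diagonal ![2, -2, -2, -2] a b := by
  fin_cases a <;> fin_cases b <;> simp [sq] <;> norm_num

/-- A linear coordinate system in which the Minkowski square is `-c (v₃ v₀ + v₁² + v₂²)` rescales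
Lebesgue measure by `c² / 2`. -/
theorem map_volume_eq_smul_of_sq_eq {L : Mink →ₗ[ℝ] (Fin 4 → ℝ)} {c : ℝ} (hc : c ≠ 0)
    (h : ∀ x, sq x = -c * (L x 3 * L x 0 + L x 1 ^ 2 + L x 2 ^ 2)) :
    Measure.map L volume = ENNReal.ofReal (c ^ 2 / 2) • volume := by
  set M := LinearMap.toMatrix' L with hM
  have hMe : ∀ a b, M a b = L (Pi.single b 1) a := by
    intro a b
    rw [hM, LinearMap.toMatrix'_apply]
  -- The matrix of L carries the Gram matrix of the form in the new coordinates to that of the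
  -- Minkowski square. Determinants give det(L)²·(-4c⁴) = -16, hence |det L| c² = 2; no explicit
  -- matrix for L is needed.
  have hG : Mᵀ * !![0, 0, 0, -c; 0, -2 * c, 0, 0; 0, 0, -2 * c, 0; -c, 0, 0, 0] * M =
      Matrix.diagonal ![2, -2, -2, -2] := by
    ext a b
    rw [← sq_basis_polar, h, h, h]
    simp only [Matrix.mul_apply, Fin.sum_univ_four, Matrix.transpose_apply, hMe, map_add,
      Pi.add_apply]
    simp
    ring
  have hdet := congrArg Matrix.det hG
  rw [Matrix.det_mul, Matrix.det_mul, Matrix.det_transpose, Matrix.det_diagonal] at hdet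
  have hd : Matrix.det !![0, 0, 0, -c; 0, -2 * c, 0, 0; 0, 0, -2 * c, 0; -c, 0, 0, 0] =
      -4 * c ^ 4 := by
    simp [Matrix.det_succ_row_zero, Fin.sum_univ_succ, Fin.succAbove]
    ring
  have hp : ∏ i, ![(2 : ℝ), -2, -2, -2] i = -16 := by
    simp [Fin.prod_univ_four]
    norm_num
  rw [hd, hp] at hdet
  have hsq : (LinearMap.det L * c ^ 2) ^ 2 = 2 ^ 2 := by
    rw [← LinearMap.det_toMatrix', ← hM]
    linarith
  have habs : |LinearMap.det L| * c ^ 2 = 2 := by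
    have := abs_eq_abs.2 (sq_eq_sq_iff_eq_or_eq_neg.1 hsq)
    rwa [abs_mul, abs_of_nonneg (by positivity : 0 ≤ c ^ 2), abs_two] at this
  have hne : LinearMap.det L ≠ 0 := by
    rintro h0
    rw [h0] at habs
    simp at habs
  rw [Measure.map_linearMap_addHaar_eq_smul_addHaar volume hne, abs_inv]
  congr 2
  have := abs_pos.2 hne
  field_simp
  linarith

theorem ae_ne_mul_add (β c : ℂ) : ∀ᵐ p : (ℝ × ℂ) × ℝ, p.1.2 ≠ β * p.1.1 + c := by
  have h : ∀ᵐ z : ℝ × ℂ, z.2 ≠ β * z.1 + c := by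
    rw [Measure.volume_eq_prod, Measure.ae_prod_iff_ae_ae]
    · exact ae_of_all _ fun τ => Measure.ae_ne volume (β * (τ : ℂ) + c)
    · refine (measurableSet_eq_fun measurable_snd ?_).compl
      fun_prop
  rw [Measure.volume_eq_prod]
  exact Measure.quasiMeasurePreserving_fst.ae h

/-! ### The alternating sum over pairs of legs -/

/-- The `iε` limit for one pair of legs, including the collinear degenerations `β = 0`, `γ = 0`. -/
theorem tendsto_mul_integral_legIntegrand {β γ : ℂ} (hβγ : β ≠ γ) :
    Tendsto (fun ε => 1 / (2 * Complex.I * Real.pi ^ 2) * (β * γ * ∫ x, legIntegrand β γ ε x))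
      (𝓝[>] 0) (𝓝 ((2 * ((dilog (1 - β * conj γ)).re - (dilog 1).re) : ℝ) : ℂ)) := by
  -- The prefactor βγ vanishes, and so does the limit, which is Li₂(1) - Li₂(1).
  by_cases hβ : β = 0
  · simp [hβ]
  by_cases hγ : γ = 0
  · simp [hγ]
  rw [← neg_integral_radialIntegrand hβ hγ hβγ]
  exact tendsto_integral_legIntegrand hβ hγ hβγ

theorem integrable_mul_legIntegrand {β γ : ℂ} (hβγ : β ≠ γ) {ε : ℝ} (hε : ε ≠ 0) :
    Integrable fun x => β * γ * legIntegrand β γ ε x := by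
  by_cases hβ : β = 0
  · simp [hβ]
  by_cases hγ : γ = 0
  · simp [hγ]
  exact (integrable_legIntegrand hβ hγ hβγ hε).const_mul _

/-- The alternating sum over the four pairs of legs. -/
def legSum (β β' γ γ' : ℂ) (ε : ℝ) (p : (ℝ × ℂ) × ℝ) : ℂ :=
  β * γ * legIntegrand β γ ε p + β' * γ' * legIntegrand β' γ' ε p
    - β' * γ * legIntegrand β' γ ε p - β * γ' * legIntegrand β γ' ε p

/-- Partial fractions in each pair of linear factors: (β-β')q = β(q-β't) - β'(q-βt) with t = τ, and
likewise for γ. The factor q² of the numerator supplies one q for each pair. -/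
theorem legSum_eq (β β' γ γ' : ℂ) (ε : ℝ) {p : (ℝ × ℂ) × ℝ}
    (h1 : p.1.2 - β * p.1.1 ≠ 0) (h2 : p.1.2 - β' * p.1.1 ≠ 0)
    (h3 : p.1.2 + γ * (1 - p.1.1) ≠ 0) (h4 : p.1.2 + γ' * (1 - p.1.1) ≠ 0) :
    legSum β β' γ γ' ε p = (β - β') * (γ - γ') * p.1.2 ^ 2 /
      (((((-(p.2 * p.1.1 + ‖p.1.2‖ ^ 2) : ℝ) : ℂ) + Complex.I * ε) *
        ((((p.2 - 1) * (1 - p.1.1) - ‖p.1.2‖ ^ 2 : ℝ) : ℂ) + Complex.I * ε)) *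
        (p.1.2 - β' * p.1.1) * (p.1.2 - β * p.1.1) *
        (p.1.2 + γ' * (1 - p.1.1)) * (p.1.2 + γ * (1 - p.1.1))) := by
  simp only [legSum, legIntegrand]
  generalize (((-(p.2 * p.1.1 + ‖p.1.2‖ ^ 2) : ℝ) : ℂ) + Complex.I * ε) *
        ((((p.2 - 1) * (1 - p.1.1) - ‖p.1.2‖ ^ 2 : ℝ) : ℂ) + Complex.I * ε) = R
  rcases eq_or_ne R 0 with rfl | hR
  · simp
  generalize p.1.2 = q at *
  generalize ((p.1.1 : ℝ) : ℂ) = t at *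
  have e1 : (β - β') * q = β * (q - β' * t) - β' * (q - β * t) := by ring
  have e2 : (γ - γ') * q = γ * (q + γ' * (1 - t)) - γ' * (q + γ * (1 - t)) := by ring
  have e3 : (β - β') * (γ - γ') * q ^ 2 = ((β - β') * q) * ((γ - γ') * q) := by ring
  rw [e3, e1, e2]
  generalize q - β * t = u at *
  generalize q - β' * t = u' at *
  generalize q + γ * (1 - t) = v at *
  generalize q + γ' * (1 - t) = v' at *
  field_simp
  ring

theorem integrable_legSum {β β' γ γ' : ℂ} (h1 : β ≠ γ) (h2 : β' ≠ γ') (h3 : β' ≠ γ) (h4 : β ≠ γ')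
    {ε : ℝ} (hε : ε ≠ 0) : Integrable (legSum β β' γ γ' ε) :=
  (((integrable_mul_legIntegrand h1 hε).add (integrable_mul_legIntegrand h2 hε)).sub
    (integrable_mul_legIntegrand h3 hε)).sub (integrable_mul_legIntegrand h4 hε)

theorem measurable_legSum (β β' γ γ' : ℂ) (ε : ℝ) : Measurable (legSum β β' γ γ' ε) := by
  have h := fun β γ => (measurable_legIntegrand β γ ε).const_mul (β * γ)
  exact (((h β γ).add (h β' γ')).sub (h β' γ)).sub (h β γ')

theorem tendsto_integral_legSum {β β' γ γ' : ℂ} (h1 : β ≠ γ) (h2 : β' ≠ γ') (h3 : β' ≠ γ)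
    (h4 : β ≠ γ') :
    Tendsto (fun ε => 1 / (2 * Complex.I * Real.pi ^ 2) * ∫ p, legSum β β' γ γ' ε p) (𝓝[>] 0)
      (𝓝 ((2 * ((dilog (1 - β * conj γ)).re + (dilog (1 - β' * conj γ')).re -
        (dilog (1 - β' * conj γ)).re - (dilog (1 - β * conj γ')).re) : ℝ) : ℂ)) := by
  have h := (((tendsto_mul_integral_legIntegrand h1).add (tendsto_mul_integral_legIntegrand h2)).sub
    (tendsto_mul_integral_legIntegrand h3)).sub (tendsto_mul_integral_legIntegrand h4)
  refine (h.congr' ?_).trans (le_of_eq ?_)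
  · filter_upwards [self_mem_nhdsWithin] with ε hε
    have hε' : ε ≠ 0 := (mem_Ioi.1 hε).ne'
    have i1 := integrable_mul_legIntegrand h1 hε'
    have i2 := integrable_mul_legIntegrand h2 hε'
    have i3 := integrable_mul_legIntegrand h3 hε'
    have i4 := integrable_mul_legIntegrand h4 hε'
    have e12 := integral_add i1 i2
    have i12 := i1.add i2
    have e123 := integral_sub i12 i3
    have e1234 := integral_sub (i12.sub i3) i4
    simp only [Pi.add_apply, Pi.sub_apply] at e12 e123 e1234
    simp only [legSum]
    rw [e1234, e123, e12]
    simp only [integral_const_mul]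
    ring
  · congr 1
    push_cast
    ring

/-! ### Spinor identities -/

theorem herm_add (x y : Mink) : herm (x + y) = herm x + herm y := by
  ext a b
  fin_cases a <;> fin_cases b <;> simp [herm] <;> ring

theorem herm_smul (c : ℝ) (x : Mink) : herm (c • x) = (c : ℂ) • herm x := by
  ext a b
  fin_cases a <;> fin_cases b <;> simp [herm] <;> ring

/-- `⟨u|x|w]` as a linear function of `x`. -/
def sandwichLin (u w : Spinor) : Mink →ₗ[ℝ] ℂ where
  toFun x := sandwich u x w
  map_add' x y := by
    simp only [sandwich, herm_add, Matrix.add_mulVec, dotProduct_add]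
  map_smul' c x := by
    simp only [sandwich, herm_smul, Matrix.smul_mulVec, dotProduct_smul, RingHom.id_apply,
      Complex.real_smul, smul_eq_mul]

theorem sandwich_sub (u w : Spinor) (x y : Mink) :
    sandwich u (x - y) w = sandwich u x w - sandwich u y w :=
  (sandwichLin u w).map_sub x y

theorem sandwich_add_smul_left (u v w : Spinor) (c : ℂ) (x : Mink) :
    sandwich (u + c • v) x w = sandwich u x w + c * sandwich v x w := by
  simp only [sandwich, Matrix.mulVec_add, Matrix.mulVec_smul, dotProduct_add, dotProduct_smul,
    smul_eq_mul]

theorem sandwich_add_smul_right (u v w : Spinor) (c : ℂ) (x : Mink) :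
    sandwich u x (v + c • w) = sandwich u x v + c * sandwich u x w := by
  simp only [sandwich, add_dotProduct, smul_dotProduct, smul_eq_mul]

theorem conj_sandwich (u w : Spinor) (x : Mink) :
    conj (sandwich u x w) = sandwich (star w) x (star u) := by
  simp [sandwich, herm, Matrix.mulVec, dotProduct, Fin.sum_univ_two]
  ring

theorem angle_self (u : Spinor) : angle u u = 0 := by
  rw [angle]
  ring

theorem angle_star (u v : Spinor) : angle (star u) (star v) = conj (angle u v) := by
  simp [angle]

/-- The expansion of a spinor in a normalized basis. -/
theorem eq_add_smul_of_angle {ξ f u : Spinor} (h : angle ξ f = 1) (hu : angle u f = 1) :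
    u = ξ + angle ξ u • f := by
  simp only [angle] at *
  ext a
  fin_cases a
  · simp
    linear_combination (ξ 0) * hu - (u 0) * h
  · simp
    linear_combination (ξ 1) * hu - (u 1) * h

/-- Multiplicativity of the determinant: the 2×2 array of matrix elements is the product of the
matrix of x with the two matrices of spinors, and x² is twice the determinant of x. -/
theorem sq_mul_angle_mul_angle (x : Mink) (u v w z : Spinor) :
    (sq x : ℂ) * (angle u v * angle w z) =
      2 * (sandwich u x w * sandwich v x z - sandwich u x z * sandwich v x w) := by
  rw [sq_eq_two_mul_det]
  simp only [sandwich, angle, Matrix.det_fin_two, Matrix.mulVec, dotProduct, Fin.sum_univ_two]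
  ring

theorem angle_vecMul_mul_angle (x y : Mink) (w u v : Spinor) :
    angle (w ᵥ* herm x) (w ᵥ* herm y) * angle u v =
      sandwich u x w * sandwich v y w - sandwich v x w * sandwich u y w := by
  simp only [sandwich, angle, Matrix.mulVec, Matrix.vecMul, dotProduct, Fin.sum_univ_two]
  ring

theorem pairing_refTwistor (Z : Twistor) (η : Spinor) :
    pairing Z (refTwistor η) = angle Z.1 (star (moveIndex η)) := by
  simp [pairing, refTwistor, angle, moveIndex, dotProduct, Fin.sum_univ_two]

theorem aInv_eq_sandwich (P : NullPolygon n) (k l : ZMod n) :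
    aInv P.Z k l = sandwich (P.lam k) (P.x k - P.x l) (star (P.lam l)) := by
  have h : P.lam k ⬝ᵥ star (herm (P.x l) *ᵥ P.lam l) =
      sandwich (P.lam k) (P.x l) (star (P.lam l)) := by
    rw [← star_star (P.lam k), ← conj_sandwich, sandwich, star_star, Matrix.dotProduct_star,
      dotProduct_comm, Complex.star_def]
  rw [sandwich_sub, aInv, pairing, NullPolygon.Z, NullPolygon.Z, star_smul, dotProduct_smul, h,
    smul_dotProduct, dotProduct_comm _ (star (P.lam l)), ← sandwich]
  simp only [star_neg, smul_eq_mul, Complex.star_def, Complex.conj_I]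
  linear_combination (sandwich (P.lam k) (P.x l) (star (P.lam l)) -
    sandwich (P.lam k) (P.x k) (star (P.lam l))) * Complex.I_mul_I

/-- The edge matrix has rank one and contracts λ_k with its own index-shifted copy, that is, with
⟨λ_k λ_k⟩ = 0. -/
theorem mulVec_edge (P : NullPolygon n) (k : ZMod n) (w : Spinor) :
    sandwich (P.lam k) (P.x k - P.x (k + 1)) w = 0 := by
  rw [sandwich, P.edge]
  simp [moveIndex, Matrix.mulVec, dotProduct, Fin.sum_univ_two, Matrix.vecMulVec]
  ring

/-! ### The Jacobian and the d log form -/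

/-- The four functionals are the entries of x between two pairs of spinors, so a change of either
pair multiplies the determinant by the square of its bracket. The constant i reflects the
orientation and the factor 1/√2 in `herm`. -/
theorem det_sandwich (u v w z : Spinor) :
    Matrix.det (Matrix.of fun k m : Fin 4 =>
      ![sandwich u (Pi.single m 1) w, sandwich v (Pi.single m 1) w,
        sandwich u (Pi.single m 1) z, sandwich v (Pi.single m 1) z] k) =
      Complex.I * (angle u v * angle w z) ^ 2 := by
  have h : (((Real.sqrt 2 : ℝ) : ℂ)⁻¹) ^ 2 = 1 / 2 := by
    rw [inv_pow, ← Complex.ofReal_pow, Real.sq_sqrt (by norm_num)]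
    norm_num
  have e0 : ∀ u w : Spinor, sandwich u (Pi.single 0 1) w =
      ((Real.sqrt 2 : ℝ) : ℂ)⁻¹ * (w 0 * u 0 + w 1 * u 1) := by
    intro u w
    simp [sandwich, herm, Matrix.mulVec, dotProduct, Fin.sum_univ_two]
    ring
  have e1 : ∀ u w : Spinor, sandwich u (Pi.single 1 1) w =
      ((Real.sqrt 2 : ℝ) : ℂ)⁻¹ * (w 0 * u 1 + w 1 * u 0) := by
    intro u w
    simp [sandwich, herm, Matrix.mulVec, dotProduct, Fin.sum_univ_two]
    ring
  have e2 : ∀ u w : Spinor, sandwich u (Pi.single 2 1) w =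
      ((Real.sqrt 2 : ℝ) : ℂ)⁻¹ * (Complex.I * (w 0 * u 1 - w 1 * u 0)) := by
    intro u w
    simp [sandwich, herm, Matrix.mulVec, dotProduct, Fin.sum_univ_two]
    ring
  have e3 : ∀ u w : Spinor, sandwich u (Pi.single 3 1) w =
      ((Real.sqrt 2 : ℝ) : ℂ)⁻¹ * (w 0 * u 0 - w 1 * u 1) := by
    intro u w
    simp [sandwich, herm, Matrix.mulVec, dotProduct, Fin.sum_univ_two]
    ring
  generalize ((Real.sqrt 2 : ℝ) : ℂ)⁻¹ = κ at *
  have h4 : κ ^ 4 = 1 / 4 := by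
    linear_combination (κ ^ 2 + 1 / 2) * h
  simp [Matrix.det_succ_row_zero, Fin.sum_univ_succ, Fin.succAbove, e0, e1, e2, e3, angle]
  linear_combination (4 * Complex.I * (u 0 * v 1 - u 1 * v 0) ^ 2 * (w 0 * z 1 - w 1 * z 0) ^ 2) * h4

theorem sandwich_add_smul_single (u w : Spinor) (x v : Mink) (t : ℝ) :
    sandwich u (x + t • v) w = sandwich u x w + t * sandwich u v w := by
  have := (sandwichLin u w).map_add x (t • v)
  rwa [map_smul, Complex.real_smul] at this

theorem differentiable_sandwich_sub (u w : Spinor) (y : Mink) :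
    Differentiable ℝ fun x => sandwich u (x - y) w := by
  intro x
  exact ((sandwichLin u w).toContinuousLinearMap.differentiableAt).comp x
    (differentiableAt_id.sub_const y)

theorem hasDerivAt_sandwich (u w : Spinor) (y x v : Mink) :
    HasDerivAt (fun t : ℝ => sandwich u (x + t • v - y) w) (sandwich u v w) 0 := by
  have e : (fun t : ℝ => sandwich u (x + t • v - y) w) =
      fun t : ℝ => sandwich u (x - y) w + t * sandwich u v w := by
    ext t
    rw [add_sub_right_comm, sandwich_add_smul_single]
  rw [e]
  simpa using ((Complex.ofRealCLM.hasDerivAt (x := 0)).mul_const (sandwich u v w)).const_add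
    (sandwich u (x - y) w)

theorem fderiv_apply_eq_of_hasDerivAt {F : Mink → ℂ} {x v : Mink} {d : ℂ}
    (hF : DifferentiableAt ℝ F x) (h : HasDerivAt (fun t : ℝ => F (x + t • v)) d 0) :
    fderiv ℝ F x v = d := by
  rw [← hF.lineDeriv_eq_fderiv, lineDeriv]
  exact h.deriv

theorem fderiv_complexCoord {η u u' : Spinor} {y x : Mink} (h : linFactor η u' (x - y) ≠ 0)
    (v : Mink) : fderiv ℝ (complexCoord η u u' y) x v =
      (linFactor η u v * linFactor η u' (x - y) - linFactor η u (x - y) * linFactor η u' v) /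
        linFactor η u' (x - y) ^ 2 := by
  apply fderiv_apply_eq_of_hasDerivAt
  · have h1 := differentiable_sandwich_sub u (moveIndex η) y x
    have h2 := differentiable_sandwich_sub u' (moveIndex η) y x
    exact (h1.mul (h2.inv h)).congr_of_eventuallyEq (Eventually.of_forall fun x => div_eq_mul_inv _ _)
  · have h1 := hasDerivAt_sandwich u (moveIndex η) y x v
    have h2 := hasDerivAt_sandwich u' (moveIndex η) y x v
    convert! h1.div h2 (by simpa [linFactor] using h) using 1
    simp [linFactor]

/-- The Minkowski square in the frame of two normalized spinors. -/
theorem sq_eq_of_angle {ξ f : Spinor} (h : angle ξ f = 1) (x : Mink) :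
    (sq x : ℂ) = 2 * (sandwich ξ x (star ξ) * sandwich f x (star f) -
      sandwich ξ x (star f) * sandwich f x (star ξ)) := by
  rw [← sq_mul_angle_mul_angle, angle_star, h, map_one, mul_one, mul_one]

theorem fderiv_realCoord {η ξ : Spinor} (hξ : angle ξ (star (moveIndex η)) = 1) {y x : Mink}
    (h : dotN η (x - y) ≠ 0) (v : Mink) :
    fderiv ℝ (realCoord η y) x v =
      -(linFactor η ξ (x - y) * sandwich (star (moveIndex η)) (x - y) (star ξ) /
          dotN η (x - y) ^ 2) * dotN η v +
        sandwich (star (moveIndex η)) (x - y) (star ξ) / dotN η (x - y) * linFactor η ξ v +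
        linFactor η ξ (x - y) / dotN η (x - y) * sandwich (star (moveIndex η)) v (star ξ) -
        sandwich ξ v (star ξ) := by
  have hf : star (star (moveIndex η)) = moveIndex η := star_star _
  -- In the frame the coordinate is |⟨ξ|x|η]|²/(x·n) - ⟨ξ|x|ξ̄], a rational function of linear
  -- functionals.
  have e : realCoord η y = fun x => -(2 * (sandwich ξ (x - y) (star ξ) *
      sandwich (star (moveIndex η)) (x - y) (moveIndex η) - sandwich ξ (x - y) (moveIndex η) *
        sandwich (star (moveIndex η)) (x - y) (star ξ))) *
        (2 * sandwich (star (moveIndex η)) (x - y) (moveIndex η))⁻¹ := by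
    ext x
    rw [realCoord, sq_eq_of_angle hξ, hf, dotN, div_eq_mul_inv]
  have h' : 2 * sandwich (star (moveIndex η)) (x - y) (moveIndex η) ≠ 0 :=
    mul_ne_zero two_ne_zero h
  rw [e]
  apply fderiv_apply_eq_of_hasDerivAt
  · have h1 := differentiable_sandwich_sub ξ (star ξ) y x
    have h2 := differentiable_sandwich_sub (star (moveIndex η)) (moveIndex η) y x
    have h3 := differentiable_sandwich_sub ξ (moveIndex η) y x
    have h4 := differentiable_sandwich_sub (star (moveIndex η)) (star ξ) y x
    exact ((((h1.mul h2).sub (h3.mul h4)).const_mul 2).neg).mul ((h2.const_mul 2).inv h')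
  · have h1 := hasDerivAt_sandwich ξ (star ξ) y x v
    have h2 := hasDerivAt_sandwich (star (moveIndex η)) (moveIndex η) y x v
    have h3 := hasDerivAt_sandwich ξ (moveIndex η) y x v
    have h4 := hasDerivAt_sandwich (star (moveIndex η)) (star ξ) y x v
    convert! ((((h1.mul h2).sub (h3.mul h4)).const_mul 2).neg).mul
      ((h2.const_mul 2).fun_inv (by simpa using h')) using 1
    simp only [dotN] at h
    simp [linFactor, dotN]
    field_simp
    ring

theorem det_of_row_eq_sum (C : Matrix (Fin 4) (Fin 4) ℂ) (R : Fin 4 → Fin 4 → ℂ)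
    (J : Fin 4 → Fin 4 → ℂ) (h : ∀ k m, J k m = ∑ l, C k l * R l m) :
    Matrix.det (Matrix.of fun k m => J k m) = C.det * Matrix.det (Matrix.of fun k m => R k m) := by
  rw [← Matrix.det_mul]
  congr 1
  ext k m
  rw [Matrix.of_apply, h, Matrix.mul_apply]
  rfl

/-- The integrand of a generic diagram is a `d log` form. -/
theorem kermitIntegrand_eq_dlogDensity {P : NullPolygon n} {η : Spinor} {i j : ZMod n}
    (hnorm : ∀ k, angle (P.lam k) (star (moveIndex η)) = 1) (ε : ℝ) {x₀ : Mink}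
    (hi : dotN η (x₀ - P.x i) ≠ 0) (hj : dotN η (x₀ - P.x j) ≠ 0)
    (h1 : linFactor η (P.lam (i - 1)) (x₀ - P.x i) ≠ 0)
    (h2 : linFactor η (P.lam i) (x₀ - P.x i) ≠ 0)
    (h3 : linFactor η (P.lam (j - 1)) (x₀ - P.x j) ≠ 0)
    (h4 : linFactor η (P.lam j) (x₀ - P.x j) ≠ 0) :
    1 / (Complex.I * (Real.pi : ℂ) ^ 2) * kermitIntegrand P η i j ε x₀ =
      dlogDensity P η i j ε x₀ := by
  obtain ⟨ξ, hξdef⟩ : ∃ ξ, ξ = P.lam i := ⟨_, rfl⟩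
  have hξ : angle ξ (star (moveIndex η)) = 1 := hξdef ▸ hnorm i
  have hlam : ∀ k, P.lam k = ξ + angle ξ (P.lam k) • star (moveIndex η) :=
    fun k => eq_add_smul_of_angle hξ (hnorm k)
  generalize hb : (fun k => angle ξ (P.lam k)) = b
  replace hlam : ∀ k, P.lam k = ξ + b k • star (moveIndex η) := by
    intro k
    rw [← hb]
    exact hlam k
  have hL : ∀ k x, linFactor η (P.lam k) x = linFactor η ξ x + b k * dotN η x := by
    intro k x
    rw [linFactor, hlam k, sandwich_add_smul_left]
    rfl
  have hcross : ∀ k l x v, linFactor η (P.lam k) v * linFactor η (P.lam l) x -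
      linFactor η (P.lam k) x * linFactor η (P.lam l) v =
      (b l - b k) * (dotN η x * linFactor η ξ v - linFactor η ξ x * dotN η v) := by
    intro k l x v
    rw [hL, hL, hL, hL]
    ring
  have hang : ∀ k l, angle (P.lam k) (P.lam l) = b l - b k := by
    intro k l
    have := angle_self ξ
    rw [hlam k, hlam l]
    simp only [angle, Pi.add_apply, Pi.smul_apply, smul_eq_mul] at *
    linear_combination (b l - b k) * hξ
  have heta : ∀ x y, angle (etaSpinor η x) (etaSpinor η y) =
      linFactor η ξ x * dotN η y - dotN η x * linFactor η ξ y := by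
    intro x y
    have := angle_vecMul_mul_angle x y (moveIndex η) ξ (star (moveIndex η))
    rw [hξ, mul_one] at this
    exact this
  have hf : angle (moveIndex η) (star ξ) = -1 := by
    have := congrArg conj hξ
    rw [← angle_star, star_star, map_one] at this
    simp only [angle] at *
    linear_combination -this
  have hf' : angle (star (moveIndex η)) ξ = -1 := by
    simp only [angle] at *
    linear_combination -hξ
  have hdet := det_sandwich (star (moveIndex η)) ξ (moveIndex η) (star ξ)
  rw [hf, hf'] at hdet
  have hjac : jacobian ![realCoord η (P.x i), realCoord η (P.x j),
        complexCoord η (P.lam (i - 1)) (P.lam i) (P.x i),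
        complexCoord η (P.lam (j - 1)) (P.lam j) (P.x j)] x₀ =
      Complex.I * ((b i - b (i - 1)) * (b j - b (j - 1)) *
        (linFactor η ξ (x₀ - P.x i) * dotN η (x₀ - P.x j) -
          dotN η (x₀ - P.x i) * linFactor η ξ (x₀ - P.x j)) ^ 2) /
        (dotN η (x₀ - P.x i) * dotN η (x₀ - P.x j) *
        linFactor η (P.lam i) (x₀ - P.x i) ^ 2 * linFactor η (P.lam j) (x₀ - P.x j) ^ 2) := by
    -- The rows expand the four differentials in the functionals x·n, ⟨ξ|x|η], ⟨η̄|x|ξ̄], ⟨ξ|x|ξ̄].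
    -- The last two rows involve only the first two functionals, since s and t are Möbius functions
    -- of ⟨ξ|x|η]/(x·n).
    rw [jacobian, det_of_row_eq_sum
      !![-(linFactor η ξ (x₀ - P.x i) * sandwich (star (moveIndex η)) (x₀ - P.x i) (star ξ) /
            dotN η (x₀ - P.x i) ^ 2),
          sandwich (star (moveIndex η)) (x₀ - P.x i) (star ξ) / dotN η (x₀ - P.x i),
          linFactor η ξ (x₀ - P.x i) / dotN η (x₀ - P.x i), -1;
        -(linFactor η ξ (x₀ - P.x j) * sandwich (star (moveIndex η)) (x₀ - P.x j) (star ξ) /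
            dotN η (x₀ - P.x j) ^ 2),
          sandwich (star (moveIndex η)) (x₀ - P.x j) (star ξ) / dotN η (x₀ - P.x j),
          linFactor η ξ (x₀ - P.x j) / dotN η (x₀ - P.x j), -1;
        -((b i - b (i - 1)) * linFactor η ξ (x₀ - P.x i)) / linFactor η (P.lam i) (x₀ - P.x i) ^ 2,
          (b i - b (i - 1)) * dotN η (x₀ - P.x i) / linFactor η (P.lam i) (x₀ - P.x i) ^ 2, 0, 0;
        -((b j - b (j - 1)) * linFactor η ξ (x₀ - P.x j)) / linFactor η (P.lam j) (x₀ - P.x j) ^ 2,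
          (b j - b (j - 1)) * dotN η (x₀ - P.x j) / linFactor η (P.lam j) (x₀ - P.x j) ^ 2, 0, 0]
      _ _ ?_, hdet]
    · simp [Matrix.det_succ_row_zero, Fin.sum_univ_succ, Fin.succAbove]
      field_simp
      ring
    · intro k m
      fin_cases k
      · simp [Fin.sum_univ_four, fderiv_realCoord hξ hi]
        simp [linFactor, dotN]
        ring
      · simp [Fin.sum_univ_four, fderiv_realCoord hξ hj]
        simp [linFactor, dotN]
        ring
      · simp [Fin.sum_univ_four, fderiv_complexCoord h2]
        rw [hcross]
        simp [linFactor, dotN]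
        ring
      · simp [Fin.sum_univ_four, fderiv_complexCoord h4]
        rw [hcross]
        simp [linFactor, dotN]
        ring
  have e1 : ∀ y : Mink, dotN η (x₀ - y) ≠ 0 →
      realCoord η y x₀ + Complex.I * ε * shift η y x₀ =
        -((sq (x₀ - y) : ℂ) + Complex.I * ε) / (2 * dotN η (x₀ - y)) := by
    intro y hy
    rw [realCoord, shift]
    field_simp
    ring
  rw [dlogDensity, hjac, e1 _ hi, e1 _ hj, kermitIntegrand, complexCoord, complexCoord, hang, hang,
    heta]
  generalize (sq (x₀ - P.x i) : ℂ) + Complex.I * ε = Si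
  generalize (sq (x₀ - P.x j) : ℂ) + Complex.I * ε = Sj
  rcases eq_or_ne Si 0 with rfl | hSi
  · simp
  rcases eq_or_ne Sj 0 with rfl | hSj
  · simp
  have hpi : (Real.pi : ℂ) ≠ 0 := by exact_mod_cast Real.pi_ne_zero
  have hI : (1 : ℂ) / (Complex.I * Real.pi ^ 2) = -Complex.I / Real.pi ^ 2 := by
    rw [div_eq_div_iff (mul_ne_zero Complex.I_ne_zero (pow_ne_zero 2 hpi)) (pow_ne_zero 2 hpi)]
    linear_combination (Real.pi : ℂ) ^ 2 * Complex.I_mul_I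
  rw [hI]
  field_simp
  ring

/-! ### Coordinates adapted to the chord -/

theorem ofReal_re_sandwich_star (u : Spinor) (x : Mink) :
    ((sandwich u x (star u)).re : ℂ) = sandwich u x (star u) := by
  have h := conj_sandwich u (star u) x
  rw [star_star] at h
  exact Complex.conj_eq_iff_re.1 h

theorem ofReal_re_dotN (η : Spinor) (x : Mink) : ((dotN η x).re : ℂ) = dotN η x := by
  have h := ofReal_re_sandwich_star (star (moveIndex η)) x
  rwa [star_star] at h

/-- A spinor `ξ` and positive scale `m` adapted to the chord `X = x_i - x_j`: `ξ` is normalized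
against `η`, `⟨ξ|X|η] = 0`, and `⟨ξ|X|ξ̄] = -m² X·n`. -/
structure ChordFrame (η : Spinor) (X : Mink) where
  /-- The adapted spinor. -/
  ξ : Spinor
  /-- The scale. -/
  m : ℝ
  m_pos : 0 < m
  angle_eq : angle ξ (star (moveIndex η)) = 1
  lin_eq : linFactor η ξ X = 0
  diag_eq : sandwich ξ X (star ξ) = -((m : ℂ) ^ 2 * dotN η X)

/-- The chord frame of a spacelike chord. -/
def chordFrame {η : Spinor} {X : Mink} {u : Spinor} (hu : angle u (star (moveIndex η)) = 1)
    (hX : sq X < 0) (hn : dotN η X ≠ 0) : ChordFrame η X :=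
  have hre : (dotN η X).re ≠ 0 := fun h => hn (by rw [← ofReal_re_dotN, h, Complex.ofReal_zero])
  have hpos : 0 < -sq X / (2 * (dotN η X).re ^ 2) := by
    have := pow_pos (abs_pos.2 hre) 2
    rw [sq_abs] at this
    exact div_pos (by linarith) (by linarith)
  have ha : angle (u + (-(linFactor η u X / dotN η X)) • star (moveIndex η))
      (star (moveIndex η)) = 1 := by
    simp only [angle, Pi.add_apply, Pi.smul_apply, smul_eq_mul] at *
    linear_combination hu
  have hl : linFactor η (u + (-(linFactor η u X / dotN η X)) • star (moveIndex η)) X = 0 := by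
    have e : linFactor η (u + (-(linFactor η u X / dotN η X)) • star (moveIndex η)) X =
        linFactor η u X + -(linFactor η u X / dotN η X) * dotN η X :=
      sandwich_add_smul_left _ _ _ _ _
    rw [e]
    field_simp
    ring
  -- Adding a multiple of η̄ keeps the normalization and can be chosen to kill ⟨ξ|X|η]. Then X² =
  -- 2⟨ξ|X|ξ̄](X·n), which fixes m; spacelikeness makes the radicand positive.
  { ξ := u + (-(linFactor η u X / dotN η X)) • star (moveIndex η)
    m := Real.sqrt (-sq X / (2 * (dotN η X).re ^ 2))
    m_pos := Real.sqrt_pos.2 hpos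
    angle_eq := ha
    lin_eq := hl
    diag_eq := by
      have h := sq_eq_of_angle ha X
      rw [star_star] at h
      rw [linFactor] at hl
      rw [hl, zero_mul, sub_zero] at h
      rw [← Complex.ofReal_pow, Real.sq_sqrt hpos.le]
      push_cast
      rw [ofReal_re_dotN, h, dotN] 
      rw [dotN] at hn
      field_simp }

namespace ChordFrame

variable {η : Spinor} {X : Mink} (F : ChordFrame η X)

/-- The dimensionless coordinates `(τ, Re q, Im q, σ)` adapted to a chord. -/
def coord : Mink →ₗ[ℝ] (Fin 4 → ℝ) :=
  LinearMap.pi ![(-(dotN η X).re⁻¹) • Complex.reLm ∘ₗ sandwichLin (star (moveIndex η)) (moveIndex η),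
    ((dotN η X).re * F.m)⁻¹ • Complex.reLm ∘ₗ sandwichLin F.ξ (moveIndex η),
    ((dotN η X).re * F.m)⁻¹ • Complex.imLm ∘ₗ sandwichLin F.ξ (moveIndex η),
    ((dotN η X).re * F.m ^ 2)⁻¹ • Complex.reLm ∘ₗ sandwichLin F.ξ (star F.ξ)]

theorem re_dotN_ne (hn : dotN η X ≠ 0) : (dotN η X).re ≠ 0 :=
  fun h => hn (by rw [← ofReal_re_dotN, h, Complex.ofReal_zero])

theorem m_ne : (F.m : ℂ) ≠ 0 := by exact_mod_cast F.m_pos.ne'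

theorem dotN_eq (hn : dotN η X ≠ 0) (x : Mink) : dotN η x = -(dotN η X * F.coord x 0) := by
  have e : F.coord x 0 = -(dotN η X).re⁻¹ * (dotN η x).re := rfl
  have h := re_dotN_ne hn
  rw [e, ← ofReal_re_dotN η x, ← ofReal_re_dotN η X]
  norm_cast
  field_simp

theorem linFactor_eq (hn : dotN η X ≠ 0) (x : Mink) :
    linFactor η F.ξ x = dotN η X * F.m * (⟨F.coord x 1, F.coord x 2⟩ : ℂ) := by
  have e1 : F.coord x 1 = ((dotN η X).re * F.m)⁻¹ * (linFactor η F.ξ x).re := rfl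
  have e2 : F.coord x 2 = ((dotN η X).re * F.m)⁻¹ * (linFactor η F.ξ x).im := rfl
  have h := re_dotN_ne hn
  have hm := F.m_pos.ne'
  rw [e1, e2, ← ofReal_re_dotN η X, ← Complex.ofReal_mul]
  apply Complex.ext
  · rw [Complex.re_ofReal_mul, Complex.ofReal_re]
    field_simp
  · rw [Complex.im_ofReal_mul, Complex.ofReal_re]
    field_simp

theorem diag_eq_coord (hn : dotN η X ≠ 0) (x : Mink) :
    sandwich F.ξ x (star F.ξ) = dotN η X * F.m ^ 2 * F.coord x 3 := by
  have e : F.coord x 3 = ((dotN η X).re * F.m ^ 2)⁻¹ * (sandwich F.ξ x (star F.ξ)).re := rfl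
  have h := re_dotN_ne hn
  have hm := F.m_pos.ne'
  rw [e, ← ofReal_re_sandwich_star F.ξ x, ← ofReal_re_dotN η X]
  norm_cast
  field_simp

theorem sq_chord_eq : sq X = -(2 * (dotN η X).re ^ 2 * F.m ^ 2) := by
  have h := sq_eq_of_angle F.angle_eq X
  have hl := F.lin_eq
  rw [linFactor] at hl
  rw [star_star, hl, zero_mul, sub_zero, F.diag_eq, ← dotN, ← ofReal_re_dotN η X] at h
  have h' : ((sq X : ℝ) : ℂ) = ((-(2 * (dotN η X).re ^ 2 * F.m ^ 2) : ℝ) : ℂ) := by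
    rw [h]
    push_cast
    ring
  exact_mod_cast h'

theorem coord_chord (hn : dotN η X ≠ 0) :
    F.coord X 0 = -1 ∧ F.coord X 1 = 0 ∧ F.coord X 2 = 0 ∧ F.coord X 3 = -1 := by
  have h0 := F.dotN_eq hn X
  have h1 := F.linFactor_eq hn X
  have h3 := F.diag_eq_coord hn X
  have hm := F.m_ne
  rw [F.lin_eq, eq_comm, mul_eq_zero, or_iff_right (mul_ne_zero hn hm)] at h1
  refine ⟨?_, congrArg Complex.re h1, congrArg Complex.im h1, ?_⟩
  · have : ((F.coord X 0 : ℝ) : ℂ) = ((-1 : ℝ) : ℂ) := by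
      push_cast
      apply mul_left_cancel₀ hn
      linear_combination h0
    exact_mod_cast this
  · have : ((F.coord X 3 : ℝ) : ℂ) = ((-1 : ℝ) : ℂ) := by
      push_cast
      apply mul_left_cancel₀ (mul_ne_zero hn (pow_ne_zero 2 hm))
      rw [← h3, F.diag_eq]
      ring
    exact_mod_cast this

theorem sq_eq (hn : dotN η X ≠ 0) (x : Mink) :
    sq x = -(-sq X) * (F.coord x 3 * F.coord x 0 + F.coord x 1 ^ 2 + F.coord x 2 ^ 2) := by
  have h := sq_eq_of_angle F.angle_eq x
  have hq : sandwich F.ξ x (moveIndex η) * sandwich (star (moveIndex η)) x (star F.ξ) =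
      ((dotN η X).re : ℂ) ^ 2 * F.m ^ 2 * ((F.coord x 1 ^ 2 + F.coord x 2 ^ 2 : ℝ) : ℂ) := by
    have e := F.linFactor_eq hn x
    rw [linFactor, ← ofReal_re_dotN η X] at e
    have e' := Complex.normSq_mk (F.coord x 1) (F.coord x 2)
    rw [← conj_sandwich, e, map_mul, map_mul, Complex.conj_ofReal, Complex.conj_ofReal,
      pow_two (F.coord x 1), pow_two (F.coord x 2), ← e', ← Complex.mul_conj]
    ring
  rw [star_star, hq, F.diag_eq_coord hn, ← dotN, F.dotN_eq hn x, ← ofReal_re_dotN η X,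
    Complex.ofReal_re] at h
  rw [F.sq_chord_eq]
  have h' : ((sq x : ℝ) : ℂ) = ((-(-(-(2 * (dotN η X).re ^ 2 * F.m ^ 2))) *
      (F.coord x 3 * F.coord x 0 + F.coord x 1 ^ 2 + F.coord x 2 ^ 2) : ℝ) : ℂ) := by
    rw [h]
    push_cast
    ring
  exact_mod_cast h'

/-- The loop coordinates `((τ, q), σ)` of a point relative to a base point. -/
def loopCoord (y x : Mink) : (ℝ × ℂ) × ℝ := packCoords (F.coord (x - y))

theorem map_loopCoord (hX : sq X < 0) (hn : dotN η X ≠ 0) (y : Mink) :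
    Measure.map (F.loopCoord y) volume = ENNReal.ofReal (sq X ^ 2 / 2) • volume := by
  have h1 := map_volume_eq_smul_of_sq_eq (L := F.coord) (neg_ne_zero.2 hX.ne) (F.sq_eq hn)
  have hL : Measurable F.coord := F.coord.toContinuousLinearMap.continuous.measurable
  have hs : Measurable fun x : Mink => x - y := measurable_id.sub_const y
  have e : F.loopCoord y = packCoords ∘ F.coord ∘ fun x => x - y := rfl
  rw [e, ← Measure.map_map measurePreserving_packCoords.measurable
    (hL.comp hs), ← Measure.map_map hL hs,
    (measurePreserving_sub_right volume y).map_eq, h1, Measure.map_smul,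
    measurePreserving_packCoords.map_eq, neg_sq]

theorem measurable_loopCoord (y : Mink) : Measurable (F.loopCoord y) :=
  measurePreserving_packCoords.measurable.comp
    (F.coord.toContinuousLinearMap.continuous.measurable.comp (measurable_id.sub_const y))

end ChordFrame

theorem angle_lam_eq_one {P : NullPolygon n} {η : Spinor}
    (h : ∀ k, pairing (P.Z k) (refTwistor η) = 1) (k : ZMod n) :
    angle (P.lam k) (star (moveIndex η)) = 1 := by
  rw [← h k, pairing_refTwistor]
  rfl

/-- The edge from x_{i-1} to x_i is annihilated by λ_{i-1}, so in matrix elements of either leg the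
vertex may be taken to be x_i. -/
theorem sandwich_vertex_left {P : NullPolygon n} {i k : ZMod n}
    (hk : k ∈ ({i - 1, i} : Set (ZMod n))) (w : Spinor) :
    sandwich (P.lam k) (P.x k) w = sandwich (P.lam k) (P.x i) w := by
  rcases hk with rfl | rfl
  · have h := mulVec_edge P (i - 1) w
    rw [sub_add_cancel, sandwich_sub] at h
    exact sub_eq_zero.1 h
  · rfl

theorem sandwich_vertex_right {P : NullPolygon n} {i k : ZMod n}
    (hk : k ∈ ({i - 1, i} : Set (ZMod n))) (u : Spinor) :
    sandwich u (P.x k) (star (P.lam k)) = sandwich u (P.x i) (star (P.lam k)) := by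
  have h := congrArg conj (sandwich_vertex_left (P := P) hk (star u))
  rwa [conj_sandwich, conj_sandwich, star_star] at h

namespace ChordFrame

variable {η : Spinor} {X : Mink} (F : ChordFrame η X)

/-- The position of a leg in the frame. -/
def leg (u : Spinor) : ℂ := angle F.ξ u / F.m

theorem eq_add_leg_smul {u : Spinor} (hu : angle u (star (moveIndex η)) = 1) :
    u = F.ξ + (F.m * F.leg u) • star (moveIndex η) := by
  rw [leg, mul_div_cancel₀ _ F.m_ne]
  exact eq_add_smul_of_angle F.angle_eq hu

theorem linFactor_leg {u : Spinor} (hu : angle u (star (moveIndex η)) = 1) (x : Mink) :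
    linFactor η u x = linFactor η F.ξ x + F.m * F.leg u * dotN η x := by
  conv_lhs => rw [F.eq_add_leg_smul hu, linFactor, sandwich_add_smul_left]
  rfl

theorem angle_leg {u v : Spinor} (hu : angle u (star (moveIndex η)) = 1)
    (hv : angle v (star (moveIndex η)) = 1) : angle u v = F.m * (F.leg v - F.leg u) := by
  have h := F.angle_eq
  conv_lhs => rw [F.eq_add_leg_smul hu, F.eq_add_leg_smul hv]
  simp only [angle, Pi.add_apply, Pi.smul_apply, smul_eq_mul] at *
  linear_combination (F.m * (F.leg v - F.leg u)) * h

theorem sandwich_leg {u v : Spinor} (hu : angle u (star (moveIndex η)) = 1)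
    (hv : angle v (star (moveIndex η)) = 1) :
    sandwich u X (star v) = dotN η X * F.m ^ 2 * (F.leg u * conj (F.leg v) - 1) := by
  have hl := F.lin_eq
  rw [linFactor] at hl
  have hl' : sandwich (star (moveIndex η)) X (star F.ξ) = 0 := by
    rw [← conj_sandwich, hl, map_zero]
  have e : star v = star F.ξ + conj (F.m * F.leg v) • moveIndex η := by
    conv_lhs => rw [F.eq_add_leg_smul hv]
    rw [star_add, star_smul, star_star]
    rfl
  conv_lhs => rw [e, F.eq_add_leg_smul hu, sandwich_add_smul_left, sandwich_add_smul_right,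
    sandwich_add_smul_right, hl, hl', F.diag_eq, ← dotN]
  rw [map_mul, Complex.conj_ofReal]
  ring

theorem etaSpinor_angle (x y : Mink) : angle (etaSpinor η x) (etaSpinor η y) =
    linFactor η F.ξ x * dotN η y - dotN η x * linFactor η F.ξ y := by
  have h := angle_vecMul_mul_angle x y (moveIndex η) F.ξ (star (moveIndex η))
  rw [F.angle_eq, mul_one] at h
  exact h

end ChordFrame

/-! ### The invariants and the integrand in terms of leg positions -/

section Kinematics

variable {P : NullPolygon n} {η : Spinor} {i j : ZMod n}

theorem aInv_eq_leg (hnorm : ∀ k, angle (P.lam k) (star (moveIndex η)) = 1)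
    (F : ChordFrame η (P.x i - P.x j)) {k l : ZMod n} (hk : k ∈ ({i - 1, i} : Set (ZMod n)))
    (hl : l ∈ ({j - 1, j} : Set (ZMod n))) :
    aInv P.Z k l = dotN η (P.x i - P.x j) * F.m ^ 2 *
      (F.leg (P.lam k) * conj (F.leg (P.lam l)) - 1) := by
  rw [aInv_eq_sandwich, sandwich_sub, sandwich_vertex_left hk, sandwich_vertex_right hl,
    ← sandwich_sub, F.sandwich_leg (hnorm k) (hnorm l)]

theorem aInv_sum_eq (hnorm : ∀ k, angle (P.lam k) (star (moveIndex η)) = 1)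
    (F : ChordFrame η (P.x i - P.x j)) :
    aInv P.Z i j + aInv P.Z (i - 1) (j - 1) - aInv P.Z (i - 1) j - aInv P.Z i (j - 1) =
      dotN η (P.x i - P.x j) * angle (P.lam (i - 1)) (P.lam i) *
        conj (angle (P.lam (j - 1)) (P.lam j)) := by
  rw [F.angle_leg (hnorm _) (hnorm _), F.angle_leg (hnorm _) (hnorm _)]
  repeat rw [aInv_eq_leg hnorm F (by simp) (by simp)]
  simp only [map_mul, map_sub, Complex.conj_ofReal]
  ring

/-- The a_kl are c(b_k conj(b_l) - 1) with c = m² X·n. In the quotient of the 2×2 minor by the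
alternating sum, both are multiples of (b_i - b_{i-1}) conj(b_j - b_{j-1}), with coefficients -c²
and c. -/
theorem vStar_eq (hnorm : ∀ k, angle (P.lam k) (star (moveIndex η)) = 1)
    (F : ChordFrame η (P.x i - P.x j)) (hn : dotN η (P.x i - P.x j) ≠ 0)
    (hi : angle (P.lam (i - 1)) (P.lam i) ≠ 0) (hj : angle (P.lam (j - 1)) (P.lam j) ≠ 0) :
    vStar P.Z i j = -(dotN η (P.x i - P.x j) * F.m ^ 2) := by
  have hj' : conj (angle (P.lam (j - 1)) (P.lam j)) ≠ 0 := by simpa using hj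
  rw [vStar, aInv_sum_eq hnorm F, div_eq_iff (mul_ne_zero (mul_ne_zero hn hi) hj'),
    F.angle_leg (hnorm _) (hnorm _), F.angle_leg (hnorm _) (hnorm _)]
  repeat rw [aInv_eq_leg hnorm F (by simp) (by simp)]
  simp only [map_mul, map_sub, Complex.conj_ofReal]
  ring

theorem aInv_div_vStar (hnorm : ∀ k, angle (P.lam k) (star (moveIndex η)) = 1)
    (F : ChordFrame η (P.x i - P.x j)) (hn : dotN η (P.x i - P.x j) ≠ 0)
    (hi : angle (P.lam (i - 1)) (P.lam i) ≠ 0) (hj : angle (P.lam (j - 1)) (P.lam j) ≠ 0)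
    {k l : ZMod n} (hk : k ∈ ({i - 1, i} : Set (ZMod n))) (hl : l ∈ ({j - 1, j} : Set (ZMod n))) :
    aInv P.Z k l / vStar P.Z i j = 1 - F.leg (P.lam k) * conj (F.leg (P.lam l)) := by
  have hm := F.m_ne
  rw [vStar_eq hnorm F hn hi hj, aInv_eq_leg hnorm F hk hl]
  field_simp
  ring

theorem kermitValue_eq (hnorm : ∀ k, angle (P.lam k) (star (moveIndex η)) = 1)
    (F : ChordFrame η (P.x i - P.x j)) (hn : dotN η (P.x i - P.x j) ≠ 0)
    (hi : angle (P.lam (i - 1)) (P.lam i) ≠ 0) (hj : angle (P.lam (j - 1)) (P.lam j) ≠ 0) :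
    kermitValue P.Z i j =
      ((2 * ((dilog (1 - F.leg (P.lam i) * conj (F.leg (P.lam j)))).re +
        (dilog (1 - F.leg (P.lam (i - 1)) * conj (F.leg (P.lam (j - 1))))).re -
        (dilog (1 - F.leg (P.lam (i - 1)) * conj (F.leg (P.lam j)))).re -
        (dilog (1 - F.leg (P.lam i) * conj (F.leg (P.lam (j - 1))))).re) : ℝ) : ℂ) := by
  rw [kermitValue, Complex.add_conj, dilogSum]
  repeat rw [aInv_div_vStar hnorm F hn hi hj (by simp) (by simp)]
  simp only [Complex.add_re, Complex.sub_re]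

/-- Moving from x_i to x_j shifts (τ, q, σ) by (-1, 0, -1), so q is common to both vertices and is
the only variable left in the numerator bracket. The factor -X² > 0 of each propagator rescales ε
without changing its sign. -/
theorem kermitIntegrand_eq_legSum (hnorm : ∀ k, angle (P.lam k) (star (moveIndex η)) = 1)
    (F : ChordFrame η (P.x i - P.x j)) (hn : dotN η (P.x i - P.x j) ≠ 0)
    (hX : sq (P.x i - P.x j) < 0) (ε : ℝ) (x₀ : Mink)
    (h1 : (F.loopCoord (P.x i) x₀).1.2 - F.leg (P.lam i) * (F.loopCoord (P.x i) x₀).1.1 ≠ 0)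
    (h2 : (F.loopCoord (P.x i) x₀).1.2 - F.leg (P.lam (i - 1)) * (F.loopCoord (P.x i) x₀).1.1 ≠ 0)
    (h3 : (F.loopCoord (P.x i) x₀).1.2 + F.leg (P.lam j) * (1 - (F.loopCoord (P.x i) x₀).1.1) ≠ 0)
    (h4 : (F.loopCoord (P.x i) x₀).1.2 +
      F.leg (P.lam (j - 1)) * (1 - (F.loopCoord (P.x i) x₀).1.1) ≠ 0) :
    kermitIntegrand P η i j ε x₀ = ((sq (P.x i - P.x j) : ℂ) ^ 2)⁻¹ *
      legSum (F.leg (P.lam i)) (F.leg (P.lam (i - 1))) (F.leg (P.lam j)) (F.leg (P.lam (j - 1)))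
        (ε / -sq (P.x i - P.x j)) (F.loopCoord (P.x i) x₀) := by
  have hm := F.m_ne
  rw [legSum_eq _ _ _ _ _ h1 h2 h3 h4]
  obtain ⟨c0, c1, c2, c3⟩ := F.coord_chord hn
  have hadd : x₀ - P.x j = (x₀ - P.x i) + (P.x i - P.x j) := by abel
  have hsqi := F.sq_eq hn (x₀ - P.x i)
  have hsqj := F.sq_eq hn (x₀ - P.x j)
  have hpi := F.dotN_eq hn (x₀ - P.x i)
  have hpj := F.dotN_eq hn (x₀ - P.x j)
  have hqi := F.linFactor_eq hn (x₀ - P.x i)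
  have hqj := F.linFactor_eq hn (x₀ - P.x j)
  rw [hadd, map_add] at hsqj hpj hqj
  simp only [Pi.add_apply, c0, c1, c2, c3, add_zero] at hsqj hpj hqj
  rw [← hadd] at hsqj hpj hqj
  have hsq := F.sq_chord_eq
  have hsqc : (sq (P.x i - P.x j) : ℂ) = -(2 * dotN η (P.x i - P.x j) ^ 2 * F.m ^ 2) := by
    rw [hsq]
    push_cast
    rw [ofReal_re_dotN]
  have hsq0 : (sq (P.x i - P.x j) : ℂ) ≠ 0 := by exact_mod_cast hX.ne
  rw [kermitIntegrand, F.etaSpinor_angle, F.angle_leg (hnorm _) (hnorm _),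
    F.angle_leg (hnorm _) (hnorm _), F.linFactor_leg (hnorm _), F.linFactor_leg (hnorm _),
    F.linFactor_leg (hnorm _), F.linFactor_leg (hnorm _), hsqi, hsqj, hpi, hpj, hqi, hqj]
  simp only [ChordFrame.loopCoord, packCoords] at *
  have hnq : ‖(⟨F.coord (x₀ - P.x i) 1, F.coord (x₀ - P.x i) 2⟩ : ℂ)‖ ^ 2 =
      F.coord (x₀ - P.x i) 1 ^ 2 + F.coord (x₀ - P.x i) 2 ^ 2 := by
    rw [Complex.sq_norm, Complex.normSq_mk]
    ring
  have hp1 : ((-(-sq (P.x i - P.x j)) * (F.coord (x₀ - P.x i) 3 * F.coord (x₀ - P.x i) 0 +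
      F.coord (x₀ - P.x i) 1 ^ 2 + F.coord (x₀ - P.x i) 2 ^ 2) : ℝ) : ℂ) + Complex.I * ε =
      -(sq (P.x i - P.x j) : ℂ) * (((-(F.coord (x₀ - P.x i) 3 * F.coord (x₀ - P.x i) 0 +
        (F.coord (x₀ - P.x i) 1 ^ 2 + F.coord (x₀ - P.x i) 2 ^ 2)) : ℝ) : ℂ) +
        Complex.I * ((ε / -sq (P.x i - P.x j) : ℝ) : ℂ)) := by
    push_cast
    field_simp
    ring
  have hp2 : ((-(-sq (P.x i - P.x j)) * ((F.coord (x₀ - P.x i) 3 + -1) *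
      (F.coord (x₀ - P.x i) 0 + -1) +
      F.coord (x₀ - P.x i) 1 ^ 2 + F.coord (x₀ - P.x i) 2 ^ 2) : ℝ) : ℂ) + Complex.I * ε =
      -(sq (P.x i - P.x j) : ℂ) * ((((F.coord (x₀ - P.x i) 3 - 1) * (1 - F.coord (x₀ - P.x i) 0) -
        (F.coord (x₀ - P.x i) 1 ^ 2 + F.coord (x₀ - P.x i) 2 ^ 2) : ℝ) : ℂ) +
        Complex.I * ((ε / -sq (P.x i - P.x j) : ℝ) : ℂ)) := by
    push_cast
    field_simp
    ring
  rw [hnq, hp1, hp2]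
  generalize ((-(F.coord (x₀ - P.x i) 3 * F.coord (x₀ - P.x i) 0 +
        (F.coord (x₀ - P.x i) 1 ^ 2 + F.coord (x₀ - P.x i) 2 ^ 2)) : ℝ) : ℂ) +
        Complex.I * ((ε / -sq (P.x i - P.x j) : ℝ) : ℂ) = R₁
  generalize (((F.coord (x₀ - P.x i) 3 - 1) * (1 - F.coord (x₀ - P.x i) 0) -
        (F.coord (x₀ - P.x i) 1 ^ 2 + F.coord (x₀ - P.x i) 2 ^ 2) : ℝ) : ℂ) +
        Complex.I * ((ε / -sq (P.x i - P.x j) : ℝ) : ℂ) = R₂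
  rcases eq_or_ne R₁ 0 with rfl | hR₁
  · simp
  rcases eq_or_ne R₂ 0 with rfl | hR₂
  · simp
  push_cast
  generalize (F.coord (x₀ - P.x i) 0 : ℂ) = τ at *
  generalize (⟨F.coord (x₀ - P.x i) 1, F.coord (x₀ - P.x i) 2⟩ : ℂ) = q at *
  generalize dotN η (P.x i - P.x j) = D at *
  generalize (sq (P.x i - P.x j) : ℂ) = S at *
  generalize (F.m : ℂ) = m at *
  have eu : ∀ b : ℂ, D * m * q + m * b * -(D * τ) = D * m * (q - b * τ) := fun b => by ring
  have ev : ∀ b : ℂ, D * m * q + m * b * -(D * (τ + -1)) = D * m * (q + b * (1 - τ)) :=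
    fun b => by ring
  rw [eu, eu, ev, ev]
  have en : D * m * q * -(D * (τ + -1)) - -(D * τ) * (D * m * q) = D ^ 2 * m * q := by ring
  rw [en]
  generalize q - F.leg (P.lam i) * τ = u at *
  generalize q - F.leg (P.lam (i - 1)) * τ = u' at *
  generalize q + F.leg (P.lam j) * (1 - τ) = v at *
  generalize q + F.leg (P.lam (j - 1)) * (1 - τ) = v' at *
  field_simp

end Kinematics

/-! ### The loop integral of a generic diagram -/

section Kinematics

variable {P : NullPolygon n} {η : Spinor} {i j : ZMod n}

/-- The partial fractions fail only where a linear factor vanishes, which is a graph of q over τ and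
hence a null set. -/
theorem ae_kermitIntegrand_eq (hnorm : ∀ k, angle (P.lam k) (star (moveIndex η)) = 1)
    (F : ChordFrame η (P.x i - P.x j)) (hn : dotN η (P.x i - P.x j) ≠ 0)
    (hX : sq (P.x i - P.x j) < 0) (ε : ℝ) :
    kermitIntegrand P η i j ε =ᵐ[volume] fun x₀ => ((sq (P.x i - P.x j) : ℂ) ^ 2)⁻¹ *
      legSum (F.leg (P.lam i)) (F.leg (P.lam (i - 1))) (F.leg (P.lam j)) (F.leg (P.lam (j - 1)))
        (ε / -sq (P.x i - P.x j)) (F.loopCoord (P.x i) x₀) := by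
  have hae : ∀ β c : ℂ, ∀ᵐ x₀ : Mink,
      (F.loopCoord (P.x i) x₀).1.2 ≠ β * (F.loopCoord (P.x i) x₀).1.1 + c := by
    intro β c
    have h : ∀ᵐ p ∂Measure.map (F.loopCoord (P.x i)) volume, p.1.2 ≠ β * p.1.1 + c := by
      rw [F.map_loopCoord hX hn]
      exact Measure.ae_smul_measure (ae_ne_mul_add β c) _
    exact ae_of_ae_map (F.measurable_loopCoord (P.x i)).aemeasurable h
  filter_upwards [hae (F.leg (P.lam i)) 0, hae (F.leg (P.lam (i - 1))) 0,
    hae (F.leg (P.lam j)) (-F.leg (P.lam j)), hae (F.leg (P.lam (j - 1))) (-F.leg (P.lam (j - 1)))]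
    with x₀ h1 h2 h3 h4
  refine kermitIntegrand_eq_legSum hnorm F hn hX ε x₀ ?_ ?_ ?_ ?_
  · intro h
    exact h1 (by linear_combination h)
  · intro h
    exact h2 (by linear_combination h)
  · intro h
    exact h3 (by linear_combination h)
  · intro h
    exact h4 (by linear_combination h)

/-- Distinct leg positions of non-collinear legs. -/
theorem leg_ne (hnorm : ∀ k, angle (P.lam k) (star (moveIndex η)) = 1) {X : Mink}
    (F : ChordFrame η X) {k l : ZMod n} (h : angle (P.lam k) (P.lam l) ≠ 0) :
    F.leg (P.lam k) ≠ F.leg (P.lam l) := by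
  intro he
  apply h
  rw [F.angle_leg (hnorm _) (hnorm _), he, sub_self, mul_zero]

/-- The adapted frame of a generic diagram. -/
def GenericKinematics.frame (hK : GenericKinematics P η i j) : ChordFrame η (P.x i - P.x j) :=
  chordFrame (angle_lam_eq_one hK.normalized i) hK.spacelike hK.dotN_ne

theorem GenericKinematics.integrable_legSum (hK : GenericKinematics P η i j) {ε : ℝ} (hε : 0 < ε) :
    Integrable (legSum (hK.frame.leg (P.lam i)) (hK.frame.leg (P.lam (i - 1)))
      (hK.frame.leg (P.lam j)) (hK.frame.leg (P.lam (j - 1))) (ε / -sq (P.x i - P.x j))) := by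
  have hnorm := angle_lam_eq_one hK.normalized
  have hs := hK.spacelike
  exact Kermit.integrable_legSum (leg_ne hnorm _ (hK.legs_ij _ (by simp) _ (by simp)))
    (leg_ne hnorm _ (hK.legs_ij _ (by simp) _ (by simp)))
    (leg_ne hnorm _ (hK.legs_ij _ (by simp) _ (by simp)))
    (leg_ne hnorm _ (hK.legs_ij _ (by simp) _ (by simp))) (div_pos hε (by linarith)).ne'

theorem GenericKinematics.integrable (hK : GenericKinematics P η i j) {ε : ℝ} (hε : 0 < ε) :
    Integrable (kermitIntegrand P η i j ε) := by
  have hnorm := angle_lam_eq_one hK.normalized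
  refine Integrable.congr ?_
    (ae_kermitIntegrand_eq hnorm hK.frame hK.dotN_ne hK.spacelike ε).symm
  refine Integrable.const_mul ?_ _
  have h := (hK.integrable_legSum hε).smul_measure
    (ENNReal.ofReal_ne_top (r := sq (P.x i - P.x j) ^ 2 / 2))
  rw [← hK.frame.map_loopCoord hK.spacelike hK.dotN_ne (P.x i)] at h
  exact h.comp_measurable (hK.frame.measurable_loopCoord (P.x i))

/-- The Jacobian (X²)²/2 cancels the prefactor 1/(X²)² of the integrand; the remaining 1/2 turns
1/(iπ²) into 1/(2iπ²). -/
theorem GenericKinematics.kermit_eq (hK : GenericKinematics P η i j) (ε : ℝ) :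
    kermit P η i j ε = 1 / (2 * Complex.I * Real.pi ^ 2) *
      ∫ p, legSum (hK.frame.leg (P.lam i)) (hK.frame.leg (P.lam (i - 1)))
        (hK.frame.leg (P.lam j)) (hK.frame.leg (P.lam (j - 1))) (ε / -sq (P.x i - P.x j)) p := by
  have hnorm := angle_lam_eq_one hK.normalized
  have hs : (sq (P.x i - P.x j) : ℂ) ≠ 0 := by exact_mod_cast hK.spacelike.ne
  have hpi : (Real.pi : ℂ) ≠ 0 := by exact_mod_cast Real.pi_ne_zero
  have hI := Complex.I_ne_zero
  rw [kermit, integral_congr_ae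
    (ae_kermitIntegrand_eq hnorm hK.frame hK.dotN_ne hK.spacelike ε), integral_const_mul,
    ← integral_map (hK.frame.measurable_loopCoord (P.x i)).aemeasurable
      (measurable_legSum _ _ _ _ _).aestronglyMeasurable,
    hK.frame.map_loopCoord hK.spacelike hK.dotN_ne, integral_smul_measure,
    ENNReal.toReal_ofReal (by positivity), Complex.real_smul]
  push_cast
  field_simp

theorem GenericKinematics.tendsto_kermit (hK : GenericKinematics P η i j) :
    Tendsto (kermit P η i j) (𝓝[>] 0) (𝓝 (kermitValue P.Z i j)) := by
  have hnorm := angle_lam_eq_one hK.normalized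
  have hs : 0 < -sq (P.x i - P.x j) := neg_pos.2 hK.spacelike
  rw [kermitValue_eq hnorm hK.frame hK.dotN_ne hK.legs_i hK.legs_j]
  have h := tendsto_integral_legSum (leg_ne hnorm hK.frame (hK.legs_ij i (by simp) j (by simp)))
    (leg_ne hnorm hK.frame (hK.legs_ij (i - 1) (by simp) (j - 1) (by simp)))
    (leg_ne hnorm hK.frame (hK.legs_ij (i - 1) (by simp) j (by simp)))
    (leg_ne hnorm hK.frame (hK.legs_ij i (by simp) (j - 1) (by simp)))
  have hε : Tendsto (fun ε : ℝ => ε / -sq (P.x i - P.x j)) (𝓝[>] 0) (𝓝[>] 0) := by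
    refine tendsto_nhdsWithin_iff.2 ⟨?_, ?_⟩
    · have : Tendsto (fun ε : ℝ => ε / -sq (P.x i - P.x j)) (𝓝 0)
          (𝓝 (0 / -sq (P.x i - P.x j))) := tendsto_id.div_const _
      rw [zero_div] at this
      exact this.mono_left nhdsWithin_le_nhds
    · filter_upwards [self_mem_nhdsWithin] with ε hε
      exact div_pos hε hs
  refine (h.comp hε).congr fun ε => ?_
  rw [hK.kermit_eq]
  rfl

theorem GenericKinematics.aInv_sum_ne_zero (hK : GenericKinematics P η i j) :
    aInv P.Z i j + aInv P.Z (i - 1) (j - 1) - aInv P.Z (i - 1) j - aInv P.Z i (j - 1) ≠ 0 := by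
  rw [aInv_sum_eq (angle_lam_eq_one hK.normalized) hK.frame]
  exact mul_ne_zero (mul_ne_zero hK.dotN_ne hK.legs_i) (by simpa using hK.legs_j)

theorem GenericKinematics.vStar_eq_sq_div (hK : GenericKinematics P η i j) :
    vStar P.Z i j = (sq (P.x i - P.x j) : ℂ) / (2 * dotN η (P.x i - P.x j)) := by
  have hn := hK.dotN_ne
  rw [vStar_eq (angle_lam_eq_one hK.normalized) hK.frame hn hK.legs_i hK.legs_j,
    hK.frame.sq_chord_eq]
  push_cast
  rw [ofReal_re_dotN]
  field_simp

theorem GenericKinematics.vStar_ne_zero (hK : GenericKinematics P η i j) :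
    vStar P.Z i j ≠ 0 := by
  rw [hK.vStar_eq_sq_div]
  exact div_ne_zero (by exact_mod_cast hK.spacelike.ne) (mul_ne_zero two_ne_zero hK.dotN_ne)

end Kinematics

/-! ### Dual conformal invariance and the main theorem -/

theorem kermitValue_congr {Z Z' : ZMod n → Twistor} (h : ∀ k l, pairing (Z' k) (Z' l) =
    pairing (Z k) (Z l)) (i j : ZMod n) : kermitValue Z' i j = kermitValue Z i j := by
  have ha : aInv Z' = aInv Z := by
    ext k l
    rw [aInv, aInv, h]
  simp only [kermitValue, dilogSum, vStar, ha]

end Kermit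

end

theorem mainTheorem2 {n : ℕ} [NeZero n] (P : Kermit.NullPolygon n) (η : Kermit.Spinor)
    (i j : ZMod n) (hK : Kermit.GenericKinematics P η i j) :
    -- for every ε > 0 the regulated integral converges absolutely
    (∀ ε : ℝ, 0 < ε → Integrable (Kermit.kermitIntegrand P η i j ε)) ∧
    -- its value as ε → 0⁺
    Tendsto (Kermit.kermit P η i j) (𝓝[>] 0) (𝓝 (Kermit.kermitValue P.Z i j)) ∧
    -- the normalized integrand is the `d log` form with shifted real poles
    (∀ ε : ℝ, 0 < ε → ∀ x₀ : Kermit.Mink,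
      Kermit.dotN η (x₀ - P.x i) ≠ 0 → Kermit.dotN η (x₀ - P.x j) ≠ 0 →
      Kermit.linFactor η (P.lam (i - 1)) (x₀ - P.x i) ≠ 0 →
      Kermit.linFactor η (P.lam i) (x₀ - P.x i) ≠ 0 →
      Kermit.linFactor η (P.lam (j - 1)) (x₀ - P.x j) ≠ 0 →
      Kermit.linFactor η (P.lam j) (x₀ - P.x j) ≠ 0 →
      1 / (Complex.I * (Real.pi : ℂ) ^ 2) * Kermit.kermitIntegrand P η i j ε x₀ =
        Kermit.dlogDensity P η i j ε x₀) ∧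
    -- the space-time expressions for the invariants
    (∀ k l : ZMod n, Kermit.aInv P.Z k l =
      Kermit.sandwich (P.lam k) (P.x k - P.x l) (star (P.lam l))) ∧
    (Kermit.aInv P.Z i j + Kermit.aInv P.Z (i - 1) (j - 1)
      - Kermit.aInv P.Z (i - 1) j - Kermit.aInv P.Z i (j - 1) ≠ 0) ∧
    Kermit.vStar P.Z i j ≠ 0 ∧
    Kermit.vStar P.Z i j =
      (Kermit.sq (P.x i - P.x j) : ℂ) / (2 * Kermit.dotN η (P.x i - P.x j)) ∧
    -- dual conformal invariance, with the reference twistor transformed along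
    (∀ g : Kermit.Twistor ≃ₗ[ℂ] Kermit.Twistor, Kermit.IsDualConformal g →
      (∀ k, Kermit.pairing (g (P.Z k)) (g (Kermit.refTwistor η)) = 1) ∧
      Kermit.kermitValue (fun k => g (P.Z k)) i j = Kermit.kermitValue P.Z i j ∧
      ∀ (P' : Kermit.NullPolygon n) (η' : Kermit.Spinor),
        Kermit.GenericKinematics P' η' i j → (∀ k, P'.Z k = g (P.Z k)) →
        Kermit.refTwistor η' = g (Kermit.refTwistor η) →
        Tendsto (Kermit.kermit P' η' i j) (𝓝[>] 0) (𝓝 (Kermit.kermitValue P.Z i j))) := by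
  have hnorm := Kermit.angle_lam_eq_one hK.normalized
  refine ⟨fun ε hε => hK.integrable hε, hK.tendsto_kermit,
    fun ε _ x₀ h1 h2 h3 h4 h5 h6 =>
      Kermit.kermitIntegrand_eq_dlogDensity hnorm ε h1 h2 h3 h4 h5 h6,
    Kermit.aInv_eq_sandwich P, hK.aInv_sum_ne_zero, hK.vStar_ne_zero, hK.vStar_eq_sq_div,
    fun g hg => ?_⟩
  have hv : Kermit.kermitValue (fun k => g (P.Z k)) i j = Kermit.kermitValue P.Z i j :=
    Kermit.kermitValue_congr (fun k l => hg _ _) i j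
  refine ⟨fun k => by rw [hg, hK.normalized k], hv, fun P' η' hK' hZ _ => ?_⟩
  rw [← hv, ← funext hZ]
  exact hK'.tendsto_kermit
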